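/- **Setting.** Let $a,b\in\mathbb R$, $c_1,c_2>0$ with $a-c_1>0$, and $\Omega=\{(x,y):|x-a|<c_1,\ |y-b|<c_2\}$, $\Gamma=\{(x,y): x=a+c_1,\ |y-b|<c_2\}$, so that $\partial_n=\partial_x$ on $\Gamma$. Let $\varepsilon\in(0,1)$, $R>0$. Equip $H^k(\Omega)$ with $\|u\|_{H^k}^2=\sum_{|m|\le k}\|\partial^m u\|_{L^2(\Omega)}^2$ and $H^k\times H^k$ with $\|(r,s)\|^2=\|r\|^2+\|s\|^2$; let $[\cdot,\cdot]$ be the scalar product of $H^3(\Omega)\times H^3(\Omega)$. Put $H^3_0(\Omega)=\{u\in H^3(\Omega): u|_{\partial\Omega}=0,\ \partial_n u|_\Gamma=0\}$. Let $s_0(\mathbf x,\varphi)$ $(\mathbf x\in\partial\Omega)$ and $s_1(\mathbf x,\varphi)$ $(\mathbf x\in\Gamma)$ be real functions differentiable in $\varphi\in(0,2\pi)$. Let $\overline{B(R)}$ be the set of all families $\varphi\mapsto(r,s)(\cdot,\varphi)\in H^3(\Omega)\times H^3(\Omega)$, $\varphi\in(0,2\pi)$, such that $\sup_{\varphi}\|(r,s)(\cdot,\varphi)\|_{H^3\times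 H^3}\le R$ and, for every $\varphi$, $$r|_{\partial\Omega}=\partial_\varphi s_0,\quad \partial_n r|_\Gamma=\partial_\varphi s_1,\quad s|_{\partial\Omega}=\partial_\varphi s_0-\varepsilon s_0,\quad \partial_n s|_\Gamma=\partial_\varphi s_1-\varepsilon s_1 .$$ Let $L_1(r,s)=\Delta r+2\nabla r\cdot\nabla\frac{r-s}{\varepsilon}$, $L_2(r,s)=\Delta s+2\nabla r\cdot\nabla\frac{r-s}{\varepsilon}$ and, for $\lambda>0$, $\alpha\in(0,1)$, $$J_{\lambda,\alpha}(r,s)(\varphi)=\sqrt\varepsilon\int_\Omega\big[(L_1(r,s))^2+(L_2(r,s))^2\big](\mathbf x,\varphi)\,e^{2\lambda x^2}\,d\mathbf x+\alpha\|(r,s)(\cdot,\varphi)\|^2_{H^3\times H^3}.$$ **Theorem 5.2.** 1. For each $\lambda>0$, $\varphi\in(0,2\pi)$, $\alpha\in(0,1)$ and $(r,s)\in\overline{B(R)}$ the functional $J_{\lambda,\alpha}(\cdot)(\varphi)$ has a unique Fréchet derivative $J'_{\lambda,\alpha}(r,s)(\varphi)\in H_0^3(\Omega)\times H_0^3(\Omega)$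 at $(r,s)(\cdot,\varphi)$; that is, $J((r,s)+h)-J(r,s)-[J'(r,s),h]=o(\|h\|_{H^3\times H^3})$ for $h\in H_0^3\times H_0^3$. There is $D>0$ depending only on $\lambda,\varphi,R,\Omega,\varepsilon$ such that for all $(r_1,s_1),(r_2,s_2)\in\overline{B(R)}$ $$\|J'_{\lambda,\alpha}(r_2,s_2)(\varphi)-J'_{\lambda,\alpha}(r_1,s_1)(\varphi)\|_{H^3\times H^3}\le D\,\|(r_2,s_2)(\cdot,\varphi)-(r_1,s_1)(\cdot,\varphi)\|_{H^3\times H^3}.$$ 2. Let $\lambda_0=\lambda_0(\Omega)\ge1$ be any given number. There are $\lambda_1=\lambda_1(R,\Omega,\varepsilon)\ge\lambda_0$ and $C_1=C_1(R,\Omega,\varepsilon)>0$ (independent of $\alpha$, $\varphi$, $\lambda$, $s_0$, $s_1$) such that for all $\lambda\ge\lambda_1$, $\alpha\in(0,1)$, $\varphi\in(0,2\pi)$ and all $(r_1,s_1),(r_2,s_2)\in\overline{B(R)}$, with $h=(r_2-r_1,s_2-s_1)(\cdot,\varphi)$, $$J_{\lambda,\alpha}(r_2,s_2)(\varphi)-J_{\lambda,\alpha}(r_1,s_1)(\varphi)-[J'_{\lambda,\alpha}(r_1,s_1)(\varphi),h]\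 \ge\ C_1e^{\lambda(a-c_1)^2}\|h\|^2_{H^2\times H^2}+\alpha\|h\|^2_{H^3\times H^3}.$$ If $a-c_1>1/2$, the same inequality also holds with $e^{\lambda(a-c_1)}$ in place of $e^{\lambda(a-c_1)^2}$. 3. For each $\lambda\ge\lambda_1$ and $\alpha\in(0,1)$: if $\overline{B(R)}\ne\varnothing$, there is a unique $(r_{\min},s_{\min})\in\overline{B(R)}$ that minimizes $J_{\lambda,\alpha}(\cdot)(\varphi)$ on $\overline{B(R)}$ for every $\varphi\in(0,2\pi)$. An element $(r_{\min},s_{\min})$ of $\overline{B(R)}$ is this minimizer if and only if $$\big[J'_{\lambda,\alpha}(r_{\min},s_{\min})(\varphi),\,(r_{\min},s_{\min})(\cdot,\varphi)-(r,s)(\cdot,\varphi)\big]\le0\qquad\forall\varphi\in(0,2\pi),\ \forall(r,s)\in\overline{B(R)}.$$ -/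

import Mathlib

open MeasureTheory Set
open scoped ContDiff

noncomputable section

namespace EIT

/-- The open rectangle with centre `(a, b)` and half-sides `c₁`, `c₂`. -/
def rect (a b c₁ c₂ : ℝ) : Set (ℝ × ℝ) :=
  Ioo (a - c₁) (a + c₁) ×ˢ Ioo (b - c₂) (b + c₂)

/-- The right-hand open side of the rectangle; its outward normal is `(1, 0)`. -/
def rightSide (a b c₁ c₂ : ℝ) : Set (ℝ × ℝ) :=
  {a + c₁} ×ˢ Ioo (b - c₂) (b + c₂)

/-- The open interval of source angles. -/
abbrev Angle : Type := Ioo (0 : ℝ) (2 * Real.pi)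

/-! ### Sobolev spaces on a plane domain, through weak derivatives -/

/-- Test functions: real, smooth, with compact support inside `Ω`. -/
def IsTest (Ω : Set (ℝ × ℝ)) (η : ℝ × ℝ → ℝ) : Prop :=
  ContDiff ℝ ∞ η ∧ HasCompactSupport η ∧ tsupport η ⊆ Ω

/-- Classical partial derivative in the direction `v`. -/
def pd (v : ℝ × ℝ) (η : ℝ × ℝ → ℝ) : ℝ × ℝ → ℝ := fun z => fderiv ℝ η z v

/-- Classical iterated partial derivative `∂ₓ^i ∂ᵧ^j η` for `m = (i, j)`. -/
def iterPd (m : ℕ × ℕ) (η : ℝ × ℝ → ℝ) : ℝ × ℝ → ℝ :=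
  (pd (1, 0))^[m.1] ((pd (0, 1))^[m.2] η)

/-- Real `L²(Ω)` with respect to Lebesgue measure. -/
abbrev L2 (Ω : Set (ℝ × ℝ)) : Type := Lp ℝ 2 ((volume : Measure (ℝ × ℝ)).restrict Ω)

/-- `v` is the weak derivative of order `m` of `u` on `Ω`. -/
def IsWeakDeriv (Ω : Set (ℝ × ℝ)) (m : ℕ × ℕ) (u v : L2 Ω) : Prop :=
  ∀ η, IsTest Ω η →
    ∫ z in Ω, u z * iterPd m η z = (-1) ^ (m.1 + m.2) * ∫ z in Ω, v z * η z

/-- The multi-indices of order at most `k`. -/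
def multiIndices (k : ℕ) : Finset (ℕ × ℕ) :=
  (Finset.range (k + 1) ×ˢ Finset.range (k + 1)).filter fun m => m.1 + m.2 ≤ k

/-- Families of `L²` functions indexed by the multi-indices of order at most three, with the
Hilbert norm whose square is the sum of the squares of the `L²` norms. -/
abbrev Jet (Ω : Set (ℝ × ℝ)) : Type := PiLp 2 fun _ : multiIndices 3 => L2 Ω

lemma smooth_pd {η : ℝ × ℝ → ℝ} (v : ℝ × ℝ) (h : ContDiff ℝ ∞ η ∧ HasCompactSupport η) :
    ContDiff ℝ ∞ (pd v η) ∧ HasCompactSupport (pd v η) :=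
  ⟨(h.1.fderiv_right (m := ∞) (by simp)).clm_apply contDiff_const, h.2.fderiv_apply ℝ v⟩

lemma smooth_iterate {η : ℝ × ℝ → ℝ} (v : ℝ × ℝ) (n : ℕ)
    (h : ContDiff ℝ ∞ η ∧ HasCompactSupport η) :
    ContDiff ℝ ∞ ((pd v)^[n] η) ∧ HasCompactSupport ((pd v)^[n] η) := by
  induction n with
  | zero => exact h
  | succ n ih => rw [Function.iterate_succ_apply']; exact smooth_pd v ih

lemma smooth_iterPd {η : ℝ × ℝ → ℝ} (m : ℕ × ℕ) (h : ContDiff ℝ ∞ η ∧ HasCompactSupport η) :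
    ContDiff ℝ ∞ (iterPd m η) ∧ HasCompactSupport (iterPd m η) :=
  smooth_iterate _ _ (smooth_iterate _ _ h)

lemma integrable_mul_smooth {Ω : Set (ℝ × ℝ)} (u : L2 Ω) {η : ℝ × ℝ → ℝ}
    (h : ContDiff ℝ ∞ η ∧ HasCompactSupport η) :
    Integrable (fun z => u z * η z) (volume.restrict Ω) :=
  MemLp.integrable_mul (p := 2) (q := 2) (Lp.memLp u)
    (h.1.continuous.memLp_of_hasCompactSupport h.2)

lemma isWeakDeriv_zero (Ω : Set (ℝ × ℝ)) (m : ℕ × ℕ) : IsWeakDeriv Ω m 0 0 := by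
  intro η _
  have h0 := Lp.coeFn_zero ℝ 2 ((volume : Measure (ℝ × ℝ)).restrict Ω)
  have e : ∀ ζ : ℝ × ℝ → ℝ, ∫ z in Ω, (0 : L2 Ω) z * ζ z = 0 := by
    intro ζ
    rw [integral_congr_ae (g := fun _ => (0 : ℝ))]
    · simp
    · filter_upwards [h0] with z hz
      rw [hz, Pi.zero_apply, zero_mul]
  rw [e, e, mul_zero]

lemma IsWeakDeriv.add {Ω : Set (ℝ × ℝ)} {m : ℕ × ℕ} {u v u' v' : L2 Ω}
    (h : IsWeakDeriv Ω m u v) (h' : IsWeakDeriv Ω m u' v') :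
    IsWeakDeriv Ω m (u + u') (v + v') := by
  intro η hη
  have hs : ContDiff ℝ ∞ η ∧ HasCompactSupport η := ⟨hη.1, hη.2.1⟩
  have e : ∀ (f g : L2 Ω) (ζ : ℝ × ℝ → ℝ), (ContDiff ℝ ∞ ζ ∧ HasCompactSupport ζ) →
      ∫ z in Ω, (f + g) z * ζ z = (∫ z in Ω, f z * ζ z) + ∫ z in Ω, g z * ζ z := by
    intro f g ζ hζ
    rw [← integral_add (integrable_mul_smooth f hζ) (integrable_mul_smooth g hζ)]
    refine integral_congr_ae ?_
    filter_upwards [Lp.coeFn_add f g] with z hz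
    rw [hz, Pi.add_apply, add_mul]
  rw [e _ _ _ (smooth_iterPd m hs), e _ _ _ hs, h η hη, h' η hη, mul_add]

lemma IsWeakDeriv.smul {Ω : Set (ℝ × ℝ)} {m : ℕ × ℕ} {u v : L2 Ω} (c : ℝ)
    (h : IsWeakDeriv Ω m u v) : IsWeakDeriv Ω m (c • u) (c • v) := by
  intro η hη
  have e : ∀ (f : L2 Ω) (ζ : ℝ × ℝ → ℝ),
      ∫ z in Ω, (c • f) z * ζ z = c * ∫ z in Ω, f z * ζ z := by
    intro f ζ
    rw [← integral_const_mul]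
    refine integral_congr_ae ?_
    filter_upwards [Lp.coeFn_smul c f] with z hz
    rw [hz, Pi.smul_apply, smul_eq_mul, mul_assoc]
  rw [e, e, h η hη]
  ring

/-- The subspace of those families whose members are the weak derivatives of the `(0, 0)` member. -/
def sobolevThree (Ω : Set (ℝ × ℝ)) : Submodule ℝ (Jet Ω) where
  carrier := {u | ∀ m : multiIndices 3, IsWeakDeriv Ω m (u ⟨(0, 0), by decide⟩) (u m)}
  zero_mem' := fun m => isWeakDeriv_zero Ω m
  add_mem' := fun hu hv m => (hu m).add (hv m)
  smul_mem' := fun c _ hu m => (hu m).smul c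

/-- The Sobolev space `H³(Ω)`: an element is a function `u ∈ L²(Ω)` (the component `(0, 0)`)
together with its (unique) weak derivatives of order at most three, all in `L²(Ω)`. The inherited
norm is `‖u‖² = ∑ ‖∂^m u‖²_{L²(Ω)}` over all multi-indices `m` of order at most three. -/
def H3 (Ω : Set (ℝ × ℝ)) : Type := sobolevThree Ω

instance (Ω : Set (ℝ × ℝ)) : NormedAddCommGroup (H3 Ω) :=
  inferInstanceAs (NormedAddCommGroup (sobolevThree Ω))

instance (Ω : Set (ℝ × ℝ)) : InnerProductSpace ℝ (H3 Ω) :=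
  inferInstanceAs (InnerProductSpace ℝ (sobolevThree Ω))

variable {Ω : Set (ℝ × ℝ)}

/-- The function itself. -/
def val (u : H3 Ω) : L2 Ω := u.1 ⟨(0, 0), by decide⟩

/-- Weak derivative in `x`. -/
def dx (u : H3 Ω) : L2 Ω := u.1 ⟨(1, 0), by decide⟩

/-- Weak derivative in `y`. -/
def dy (u : H3 Ω) : L2 Ω := u.1 ⟨(0, 1), by decide⟩

/-- Weak second derivative in `x`. -/
def dxx (u : H3 Ω) : L2 Ω := u.1 ⟨(2, 0), by decide⟩

/-- Weak second derivative in `y`. -/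
def dyy (u : H3 Ω) : L2 Ω := u.1 ⟨(0, 2), by decide⟩

/-- The square of the `H²(Ω)` norm of an element of `H³(Ω)`. -/
def sobolevTwoSq (u : H3 Ω) : ℝ :=
  ∑ m : multiIndices 3, if m.1.1 + m.1.2 ≤ 2 then ‖u.1 m‖ ^ 2 else 0

/-- The Hilbert space `H³(Ω) × H³(Ω)`, with `‖(r, s)‖² = ‖r‖² + ‖s‖²`. -/
abbrev Pair (Ω : Set (ℝ × ℝ)) : Type := WithLp 2 (H3 Ω × H3 Ω)

/-- The square of the `H²(Ω) × H²(Ω)` norm. -/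
def h2NormSq (p : Pair Ω) : ℝ := sobolevTwoSq p.fst + sobolevTwoSq p.snd

/-! ### Boundary conditions -/

/-- `f` has a representative that is continuous up to the boundary and equals `g` on the part `S`
of the boundary. (On a rectangle, `H³(Ω) ⊂ C¹(closure Ω)`, so this is the usual trace for an
element of `H³(Ω)` and for its first derivatives.) -/
def HasTrace (f : L2 Ω) (S : Set (ℝ × ℝ)) (g : ℝ × ℝ → ℝ) : Prop :=
  ∃ w : ℝ × ℝ → ℝ, ContinuousOn w (closure Ω) ∧ f =ᵐ[volume.restrict Ω] w ∧ ∀ z ∈ S, w z = g z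

lemma hasTrace_zero (S : Set (ℝ × ℝ)) : HasTrace (0 : L2 Ω) S 0 :=
  ⟨0, continuousOn_const, Lp.coeFn_zero _ _ _, fun _ _ => rfl⟩

lemma HasTrace.add_zero {f g : L2 Ω} {S : Set (ℝ × ℝ)} (hf : HasTrace f S 0)
    (hg : HasTrace g S 0) : HasTrace (f + g) S 0 := by
  obtain ⟨w, hw, hfw, hwS⟩ := hf
  obtain ⟨w', hw', hgw, hwS'⟩ := hg
  refine ⟨w + w', hw.add hw', (Lp.coeFn_add f g).trans (hfw.add hgw), fun z hz => ?_⟩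
  simp [hwS z hz, hwS' z hz]

lemma HasTrace.smul_zero {f : L2 Ω} {S : Set (ℝ × ℝ)} (c : ℝ) (hf : HasTrace f S 0) :
    HasTrace (c • f) S 0 := by
  obtain ⟨w, hw, hfw, hwS⟩ := hf
  refine ⟨c • w, hw.const_smul c, (Lp.coeFn_smul c f).trans (hfw.const_smul c), fun z hz => ?_⟩
  simp [hwS z hz]

/-- `H₀³(Ω) × H₀³(Ω)`, where `H₀³(Ω)` consists of the `u ∈ H³(Ω)` with `u = 0` on `∂Ω` and
`∂ₙu = ∂ₓu = 0` on the right-hand side `Γ`. -/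
def H30Pair (Ω Γ : Set (ℝ × ℝ)) : Submodule ℝ (Pair Ω) where
  carrier := {h | (HasTrace (val h.fst) (frontier Ω) 0 ∧ HasTrace (dx h.fst) Γ 0) ∧
    HasTrace (val h.snd) (frontier Ω) 0 ∧ HasTrace (dx h.snd) Γ 0}
  zero_mem' := by exact ⟨⟨hasTrace_zero _, hasTrace_zero _⟩, hasTrace_zero _, hasTrace_zero _⟩
  add_mem' := fun hu hv => ⟨⟨hu.1.1.add_zero hv.1.1, hu.1.2.add_zero hv.1.2⟩,
    hu.2.1.add_zero hv.2.1, hu.2.2.add_zero hv.2.2⟩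
  smul_mem' := fun c _ hu => ⟨⟨hu.1.1.smul_zero c, hu.1.2.smul_zero c⟩,
    hu.2.1.smul_zero c, hu.2.2.smul_zero c⟩

/-- Admissible boundary data: `s₀` on `∂Ω` and `s₁` on `Γ` are differentiable in the angle. -/
def IsData (Ω Γ : Set (ℝ × ℝ)) (s₀ s₁ : ℝ × ℝ → ℝ → ℝ) : Prop :=
  (∀ z ∈ frontier Ω, ∀ φ : Angle, DifferentiableAt ℝ (s₀ z) φ) ∧
    ∀ z ∈ Γ, ∀ φ : Angle, DifferentiableAt ℝ (s₁ z) φ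

/-- The boundary conditions at the angle `φ`: on `∂Ω`, `r = ∂_φ s₀` and `s = ∂_φ s₀ - ε s₀`;
on `Γ`, `∂ₙr = ∂_φ s₁` and `∂ₙs = ∂_φ s₁ - ε s₁`. -/
def BoundaryCond (Ω Γ : Set (ℝ × ℝ)) (ε : ℝ) (s₀ s₁ : ℝ × ℝ → ℝ → ℝ) (φ : Angle)
    (p : Pair Ω) : Prop :=
  HasTrace (val p.fst) (frontier Ω) (fun z => deriv (s₀ z) φ) ∧
  HasTrace (dx p.fst) Γ (fun z => deriv (s₁ z) φ) ∧
  HasTrace (val p.snd) (frontier Ω) (fun z => deriv (s₀ z) φ - ε * s₀ z φ) ∧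
  HasTrace (dx p.snd) Γ (fun z => deriv (s₁ z) φ - ε * s₁ z φ)

/-- The closed ball of radius `R`: families `φ ↦ (r, s)(·, φ) ∈ H³(Ω) × H³(Ω)` satisfying the
boundary conditions for every `φ` and `sup_φ ‖(r, s)(·, φ)‖ ≤ R`. -/
def closedBall (Ω Γ : Set (ℝ × ℝ)) (ε : ℝ) (s₀ s₁ : ℝ × ℝ → ℝ → ℝ) (R : ℝ) :
    Set (Angle → Pair Ω) :=
  {p | ∀ φ, BoundaryCond Ω Γ ε s₀ s₁ φ (p φ) ∧ ‖p φ‖ ≤ R}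

/-! ### The functional -/

/-- The nonlinear term `2 ∇r · ∇((r - s) / ε)`. -/
def nonlin (ε : ℝ) (p : Pair Ω) (z : ℝ × ℝ) : ℝ :=
  2 * (dx p.fst z * ((dx p.fst z - dx p.snd z) / ε) +
    dy p.fst z * ((dy p.fst z - dy p.snd z) / ε))

/-- `L₁(r, s) = Δr + 2 ∇r · ∇((r - s) / ε)`. -/
def opL₁ (ε : ℝ) (p : Pair Ω) (z : ℝ × ℝ) : ℝ :=
  dxx p.fst z + dyy p.fst z + nonlin ε p z

/-- `L₂(r, s) = Δs + 2 ∇r · ∇((r - s) / ε)`. -/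
def opL₂ (ε : ℝ) (p : Pair Ω) (z : ℝ × ℝ) : ℝ :=
  dxx p.snd z + dyy p.snd z + nonlin ε p z

/-- The weighted Tikhonov-like functional, with weight `exp (2 lam x²)`. The value at the angle
`φ` of the functional on a family `p` is `J ε lam α (p φ)`. -/
def J (ε lam α : ℝ) (p : Pair Ω) : ℝ :=
  √ε * (∫ z in Ω, (opL₁ ε p z ^ 2 + opL₂ ε p z ^ 2) * Real.exp (2 * lam * z.1 ^ 2)) +
    α * ‖p‖ ^ 2

/-- `g ∈ H₀³ × H₀³` is the Fréchet derivative of `J` at `p`: along `h ∈ H₀³ × H₀³`,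
`J (p + h) = J p + [g, h] + o(‖h‖)`, with the scalar product and norm of `H³ × H³`. -/
def IsFrechetDeriv (Γ : Set (ℝ × ℝ)) (ε lam α : ℝ) (p : Pair Ω) (g : H30Pair Ω Γ) : Prop :=
  HasFDerivAt (fun h : H30Pair Ω Γ => J ε lam α (p + (h : Pair Ω))) (innerSL ℝ g) 0

/-- `p` minimizes `J(·)(φ)` over the family ball `B`, for every angle `φ`. -/
def IsMinimizer (ε lam α : ℝ) (B : Set (Angle → Pair Ω)) (p : Angle → Pair Ω) : Prop :=
  p ∈ B ∧ ∀ φ, ∀ q ∈ B, J ε lam α (p φ) ≤ J ε lam α (q φ)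

end EIT

end

/-! At a fixed angle the functional is a quartic polynomial on a Hilbert space. Absorb the square
root exp(λx²) of the weight into the maps; then J(p) = √ε (‖A₁p + B(p,p)‖² + ‖A₂p + B(p,p)‖²) +
α‖p‖², where A₁, A₂ are weighted Laplacians and B is a bounded bilinear map, because gradients of H³
functions on a rectangle are bounded (`exists_isModel`). Differentiability, the Lipschitz bound on
balls and an exact formula for the remainder after the linear term (`energy_add`) are then algebra.
The gradient exists by the Riesz theorem on the closed subspace H₀³ × H₀³.

The analytic content is the lower bound for that remainder (`exists_coercive`). Its good part is a
multiple of S = ‖A₁h‖² + ‖A₂h‖². Everything else is at least quadratic in ∇h. Terms with bounded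
coefficients are controlled by ∫|∇h|²w, and the Carleman estimate `ZeroTraces.carleman_first` gives
λ∫|∇h|²w ≤ 3S, so a large λ absorbs them. The pairing of A₁p + B(p,p) with B(h,h) also contains
second derivatives of p, which lie in H¹ but need not be bounded. For these,
`integral_second_mul_first_le` bounds ∫|D²p|²|∇h|²w by a multiple of R²(λ∫|∇h|²w + λ⁻¹∫|D²h|²w). By
`ZeroTraces.carleman_second`, control of D²h costs one factor λ, which the λ⁻¹ compensates. The
result is a bound K₁S with K₁ independent of λ, and Young's inequality turns it into a small
fraction of S.

A quarter of S survives. On the rectangle w ≥ exp(2λa²), where `a` denotes from here on the abscissa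
of the left side, so S dominates λ⁻¹exp(2λa²) times the squared H² norm of h. The factor λ is paid
for by giving up part of the exponent: 2a² drops to a², or to a when a > 1/2.

The Carleman estimates are integrated by parts on lines, without approximation by smooth functions.
A function with an L¹ weak derivative has a representative that is a primitive on almost every line
(`exists_sliceX_of_weak`), and zero Dirichlet data force tangential derivatives to vanish on the
sides (`ZeroTraces.exists_sliceReps`).

Finally, the term α‖h‖² makes J strongly convex on the closed convex set of admissible pairs at one
angle. So minimizing sequences are Cauchy, and the variational inequality is the first-order
condition. No regularity in the angle is asked of a family, hence the angles decouple. -/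

noncomputable section

namespace EIT

/-! ### Primitives on an interval -/

/-- On `[a, b]`, `F` is a primitive of the integrable function `f`. -/
structure Prim (a b : ℝ) (F f : ℝ → ℝ) : Prop where
  int : IntervalIntegrable f volume a b
  eq : ∀ x ∈ Icc a b, F x = F a + ∫ t in a..x, f t

lemma Prim.absolutelyContinuous {a b : ℝ} (hab : a ≤ b) {F f : ℝ → ℝ} (h : Prim a b F f) :
    AbsolutelyContinuousOnInterval (fun x => F a + ∫ t in a..x, f t) a b := by
  have h1 : AbsolutelyContinuousOnInterval (fun _ : ℝ => F a) a b :=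
    ((LipschitzWith.const (F a)).lipschitzOnWith).absolutelyContinuousOnInterval
  exact h1.fun_add (h.int.absolutelyContinuousOnInterval_intervalIntegral (by simp [hab]))

lemma Prim.continuousOn {a b : ℝ} (hab : a ≤ b) {F f : ℝ → ℝ} (h : Prim a b F f) :
    ContinuousOn F (Icc a b) := by
  have := (h.absolutelyContinuous hab).continuousOn
  rw [uIcc_of_le hab] at this
  exact this.congr h.eq

lemma Prim.mono {a b e : ℝ} (hae : a ≤ e) (heb : e ≤ b) {F f : ℝ → ℝ} (h : Prim a b F f) :
    Prim a e F f :=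
  ⟨h.int.mono_set (by
    rw [uIcc_of_le hae, uIcc_of_le (hae.trans heb)]; exact Icc_subset_Icc_right heb),
    fun x hx => h.eq x ⟨hx.1, hx.2.trans heb⟩⟩

lemma Prim.ae_hasDerivAt {a b : ℝ} (hab : a ≤ b) {F f : ℝ → ℝ} (h : Prim a b F f) :
    ∀ᵐ x, x ∈ uIcc a b → HasDerivAt (fun x => F a + ∫ t in a..x, f t) (f x) x := by
  filter_upwards [h.int.ae_hasDerivAt_integral] with x hx hx'
  exact (hx hx' a (by simp [hab])).const_add _

/-- Both factors agree on the interval with absolutely continuous functions, so their product is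
absolutely continuous and is recovered from the a.e. product rule. The integrations by parts below
rest on this. -/
lemma Prim.mul {a b : ℝ} (hab : a ≤ b) {F f G g : ℝ → ℝ} (hF : Prim a b F f)
    (hG : Prim a b G g) : Prim a b (fun x => F x * G x) (fun x => f x * G x + F x * g x) := by
  have cF := hF.continuousOn hab
  have cG := hG.continuousOn hab
  rw [← uIcc_of_le hab] at cF cG
  refine ⟨(hF.int.mul_continuousOn cG).add (hG.int.continuousOn_mul cF), fun x hx => ?_⟩
  have hF' := hF.mono hx.1 hx.2
  have hG' := hG.mono hx.1 hx.2
  have aF := hF'.absolutelyContinuous hx.1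
  have aG := hG'.absolutelyContinuous hx.1
  have key := (aF.fun_mul aG).integral_deriv_eq_sub
  have : ∫ t in a..x, (f t * G t + F t * g t) =
      ∫ t in a..x, deriv (fun x => (F a + ∫ t in a..x, f t) * (G a + ∫ t in a..x, g t)) t := by
    apply intervalIntegral.integral_congr_ae
    filter_upwards [hF'.ae_hasDerivAt hx.1, hG'.ae_hasDerivAt hx.1] with t h1 h2 ht
    have ht' : t ∈ uIcc a x := uIoc_subset_uIcc ht
    have ht'' : t ∈ Icc a x := by rwa [uIcc_of_le hx.1] at ht'
    have := ((h1 ht').mul (h2 ht')).deriv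
    rw [← hF'.eq t ht'', ← hG'.eq t ht''] at this
    exact this.symm
  rw [this, key, ← hF'.eq x ⟨hx.1, le_rfl⟩, ← hG'.eq x ⟨hx.1, le_rfl⟩]
  simp

lemma Prim.of_hasDerivAt {a b : ℝ} {F f : ℝ → ℝ} (h : ∀ x, HasDerivAt F (f x) x)
    (hf : Continuous f) : Prim a b F f :=
  ⟨hf.intervalIntegrable _ _, fun x _ => by
    rw [intervalIntegral.integral_eq_sub_of_hasDerivAt (fun t _ => h t)
      (hf.intervalIntegrable _ _)]; ring⟩

lemma Prim.congr_deriv {a b : ℝ} (hab : a ≤ b) {F f g : ℝ → ℝ} (h : Prim a b F f)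
    (hfg : f =ᵐ[volume.restrict (Ioo a b)] g) : Prim a b F g := by
  have hfg' : f =ᵐ[volume.restrict (Ioc a b)] g := by
    rwa [← restrict_Ioo_eq_restrict_Ioc]
  refine ⟨h.int.congr_ae (by rwa [uIoc_of_le hab]), fun x hx => ?_⟩
  rw [h.eq x hx, intervalIntegral.integral_of_le hx.1, intervalIntegral.integral_of_le hx.1]
  congr 1
  exact integral_congr_ae (ae_mono (Measure.restrict_mono (Ioc_subset_Ioc_right hx.2) le_rfl) hfg')

/-- Two continuous functions on `[a, b]` that agree a.e. on `(a, b)` agree on `[a, b]`. -/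
lemma eqOn_Icc_of_ae_eq {a b : ℝ} (hab : a < b) {F G : ℝ → ℝ} (hF : ContinuousOn F (Icc a b))
    (hG : ContinuousOn G (Icc a b)) (h : F =ᵐ[volume.restrict (Ioo a b)] G) :
    EqOn F G (Icc a b) := by
  have h1 : EqOn F G (Ioo a b) :=
    Measure.eqOn_Ioo_of_ae_eq (μ := volume) h (hF.mono Ioo_subset_Icc_self)
      (hG.mono Ioo_subset_Icc_self)
  refine h1.of_subset_closure hF hG Ioo_subset_Icc_self ?_
  rw [closure_Ioo hab.ne]

lemma Prim.of_ae_eq {a b : ℝ} (hab : a < b) {F G f : ℝ → ℝ} (h : Prim a b F f)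
    (hG : ContinuousOn G (Icc a b)) (hFG : F =ᵐ[volume.restrict (Ioo a b)] G) :
    Prim a b G f := by
  have := eqOn_Icc_of_ae_eq hab (h.continuousOn hab.le) hG hFG
  refine ⟨h.int, fun x hx => ?_⟩
  rw [← this hx, ← this ⟨le_rfl, hab.le⟩, h.eq x hx]

lemma Prim.abs_sub_le {a b : ℝ} {F f : ℝ → ℝ} (h : Prim a b F f) {x t : ℝ}
    (hx : x ∈ Icc a b) (ht : t ∈ Icc a b) : |F x - F t| ≤ ∫ s in Ioo a b, |f s| := by
  have hab : a ≤ b := hx.1.trans hx.2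
  have hi : ∀ z ∈ Icc a b, IntervalIntegrable f volume a z := fun z hz => (h.mono hz.1 hz.2).int
  rw [h.eq x hx, h.eq t ht, add_sub_add_left_eq_sub,
    intervalIntegral.integral_interval_sub_left (hi x hx) (hi t ht)]
  refine (intervalIntegral.norm_integral_le_integral_norm_uIoc (f := f)).trans ?_
  rw [← integral_Ioc_eq_integral_Ioo]
  refine setIntegral_mono_set ?_ (ae_of_all _ fun _ => abs_nonneg _) ?_
  · exact ((intervalIntegrable_iff_integrableOn_Ioc_of_le hab).1 h.int).abs
  · refine LE.le.eventuallyLE ?_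
    intro z hz
    rcases le_total t x with h1 | h1
    · rw [uIoc_of_le h1] at hz; exact ⟨ht.1.trans_lt hz.1, hz.2.trans hx.2⟩
    · rw [uIoc_of_ge h1] at hz; exact ⟨hx.1.trans_lt hz.1, hz.2.trans ht.2⟩

/-- One-dimensional Sobolev inequality. -/
lemma Prim.abs_le {a b : ℝ} (hab : a < b) {F f : ℝ → ℝ} (h : Prim a b F f) {x : ℝ}
    (hx : x ∈ Icc a b) :
    |F x| ≤ (b - a)⁻¹ * (∫ s in Ioo a b, |F s|) + ∫ s in Ioo a b, |f s| := by
  have hFi : IntegrableOn F (Ioo a b) :=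
    ((h.continuousOn hab.le).integrableOn_Icc).mono_set Ioo_subset_Icc_self
  have hc : IntegrableOn (fun _ : ℝ => ∫ s in Ioo a b, |f s|) (Ioo a b) :=
    integrableOn_const (by simp)
  -- Average the inequality |F x| ≤ |F t| + ∫|f| over t.
  have h1 : ∫ _ in Ioo a b, |F x| ≤ ∫ t in Ioo a b, (|F t| + ∫ s in Ioo a b, |f s|) := by
    refine setIntegral_mono_on (integrableOn_const (by simp)) (hFi.abs.add hc)
      measurableSet_Ioo fun t ht => ?_
    have h2 := h.abs_sub_le hx (Ioo_subset_Icc_self ht)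
    have h3 := abs_sub_abs_le_abs_sub (F x) (F t)
    linarith
  rw [integral_add hFi.abs hc] at h1
  have hpos : 0 < b - a := sub_pos.2 hab
  simp only [setIntegral_const, measureReal_def, Real.volume_Ioo, smul_eq_mul,
    ENNReal.toReal_ofReal hpos.le] at h1
  rw [← div_eq_inv_mul, ← sub_le_iff_le_add, le_div_iff₀ hpos]
  linarith

/-! ### Slices on a box -/

/-- The open box `(a, b) × (c, d)`. -/
abbrev box (a b c d : ℝ) : Set (ℝ × ℝ) := Ioo a b ×ˢ Ioo c d

/-- For a.e. `y ∈ (c, d)`, `F(·, y)` is a primitive of `f(·, y)` on `[a, b]`. -/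
def SliceX (a b c d : ℝ) (F f : ℝ × ℝ → ℝ) : Prop :=
  ∀ᵐ y ∂volume.restrict (Ioo c d), Prim a b (fun x => F (x, y)) (fun x => f (x, y))

/-- For a.e. `x ∈ (a, b)`, `F(x, ·)` is a primitive of `f(x, ·)` on `[c, d]`. -/
def SliceY (a b c d : ℝ) (F f : ℝ × ℝ → ℝ) : Prop :=
  ∀ᵐ x ∂volume.restrict (Ioo a b), Prim c d (fun y => F (x, y)) (fun y => f (x, y))

lemma sliceY_iff_swap {a b c d : ℝ} {F f : ℝ × ℝ → ℝ} :
    SliceY a b c d F f ↔ SliceX c d a b (F ∘ Prod.swap) (f ∘ Prod.swap) := Iff.rfl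

lemma volume_restrict_box (a b c d : ℝ) : (volume : Measure (ℝ × ℝ)).restrict (box a b c d) =
    (volume.restrict (Ioo a b)).prod (volume.restrict (Ioo c d)) := by
  rw [Measure.volume_eq_prod, Measure.prod_restrict]

lemma measurableSet_box (a b c d : ℝ) : MeasurableSet (box a b c d) :=
  measurableSet_Ioo.prod measurableSet_Ioo

lemma measurePreserving_swap_box (a b c d : ℝ) : MeasurePreserving Prod.swap
    ((volume : Measure (ℝ × ℝ)).restrict (box c d a b))
    ((volume : Measure (ℝ × ℝ)).restrict (box a b c d)) := by
  rw [volume_restrict_box, volume_restrict_box]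
  exact Measure.measurePreserving_swap

lemma setIntegral_box_swap (a b c d : ℝ) (f : ℝ × ℝ → ℝ) :
    ∫ z in box c d a b, f z.swap = ∫ z in box a b c d, f z :=
  (measurePreserving_swap_box a b c d).integral_comp MeasurableEquiv.prodComm.measurableEmbedding f

lemma integrableOn_box_swap {a b c d : ℝ} {f : ℝ × ℝ → ℝ} (h : IntegrableOn f (box a b c d)) :
    IntegrableOn (f ∘ Prod.swap) (box c d a b) :=
  ((measurePreserving_swap_box a b c d).integrable_comp_emb
    MeasurableEquiv.prodComm.measurableEmbedding).2 h

lemma ae_box_swap {a b c d : ℝ} {p : ℝ × ℝ → Prop}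
    (h : ∀ᵐ z ∂volume.restrict (box a b c d), p z) :
    ∀ᵐ z ∂volume.restrict (box c d a b), p z.swap :=
  (measurePreserving_swap_box a b c d).quasiMeasurePreserving.ae h

lemma ae_ae_left {a b c d : ℝ} {p : ℝ × ℝ → Prop}
    (h : ∀ᵐ z ∂volume.restrict (box a b c d), p z) :
    ∀ᵐ x ∂volume.restrict (Ioo a b), ∀ᵐ y ∂volume.restrict (Ioo c d), p (x, y) := by
  rw [volume_restrict_box] at h
  exact Measure.ae_ae_of_ae_prod h

lemma ae_ae_right {a b c d : ℝ} {p : ℝ × ℝ → Prop}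
    (h : ∀ᵐ z ∂volume.restrict (box a b c d), p z) :
    ∀ᵐ y ∂volume.restrict (Ioo c d), ∀ᵐ x ∂volume.restrict (Ioo a b), p (x, y) :=
  ae_ae_left (ae_box_swap h)

lemma setIntegral_box {a b c d : ℝ} {f : ℝ × ℝ → ℝ} (h : IntegrableOn f (box a b c d)) :
    ∫ z in box a b c d, f z = ∫ x in Ioo a b, ∫ y in Ioo c d, f (x, y) := by
  rw [IntegrableOn, volume_restrict_box] at h
  rw [volume_restrict_box, integral_prod _ h]

lemma setIntegral_box' {a b c d : ℝ} {f : ℝ × ℝ → ℝ} (h : IntegrableOn f (box a b c d)) :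
    ∫ z in box a b c d, f z = ∫ y in Ioo c d, ∫ x in Ioo a b, f (x, y) := by
  rw [← setIntegral_box_swap]
  exact setIntegral_box (integrableOn_box_swap h)

lemma SliceX.integral {a b c d : ℝ} (hab : a ≤ b) {F f : ℝ × ℝ → ℝ} (h : SliceX a b c d F f)
    (hf : IntegrableOn f (box a b c d)) :
    ∫ z in box a b c d, f z = ∫ y in Ioo c d, (F (b, y) - F (a, y)) := by
  rw [setIntegral_box' hf]
  refine integral_congr_ae ?_
  filter_upwards [h] with y hy
  rw [hy.eq b ⟨hab, le_rfl⟩, intervalIntegral.integral_of_le hab, integral_Ioc_eq_integral_Ioo]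
  ring

lemma SliceY.integral {a b c d : ℝ} (hcd : c ≤ d) {F f : ℝ × ℝ → ℝ} (h : SliceY a b c d F f)
    (hf : IntegrableOn f (box a b c d)) :
    ∫ z in box a b c d, f z = ∫ x in Ioo a b, (F (x, d) - F (x, c)) := by
  rw [← setIntegral_box_swap]
  exact SliceX.integral hcd (sliceY_iff_swap.1 h) (integrableOn_box_swap hf)

lemma SliceX.mul {a b c d : ℝ} (hab : a ≤ b) {F f G g : ℝ × ℝ → ℝ} (hF : SliceX a b c d F f)
    (hG : SliceX a b c d G g) :
    SliceX a b c d (fun z => F z * G z) (fun z => f z * G z + F z * g z) := by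
  filter_upwards [hF, hG] with y h1 h2
  exact h1.mul hab h2

lemma SliceY.mul {a b c d : ℝ} (hcd : c ≤ d) {F f G g : ℝ × ℝ → ℝ} (hF : SliceY a b c d F f)
    (hG : SliceY a b c d G g) :
    SliceY a b c d (fun z => F z * G z) (fun z => f z * G z + F z * g z) := by
  filter_upwards [hF, hG] with x h1 h2
  exact h1.mul hcd h2

lemma SliceX.congr_deriv {a b c d : ℝ} (hab : a ≤ b) {F f g : ℝ × ℝ → ℝ} (h : SliceX a b c d F f)
    (hfg : f =ᵐ[volume.restrict (box a b c d)] g) : SliceX a b c d F g := by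
  filter_upwards [h, ae_ae_right hfg] with y h1 h2
  exact h1.congr_deriv hab h2

lemma SliceY.congr_deriv {a b c d : ℝ} (hcd : c ≤ d) {F f g : ℝ × ℝ → ℝ} (h : SliceY a b c d F f)
    (hfg : f =ᵐ[volume.restrict (box a b c d)] g) : SliceY a b c d F g := by
  filter_upwards [h, ae_ae_left hfg] with y h1 h2
  exact h1.congr_deriv hcd h2

lemma SliceX.of_ae_eq {a b c d : ℝ} (hab : a < b) {F G f : ℝ × ℝ → ℝ} (h : SliceX a b c d F f)
    (hG : ContinuousOn G (Icc a b ×ˢ Icc c d)) (hFG : F =ᵐ[volume.restrict (box a b c d)] G) :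
    SliceX a b c d G f := by
  filter_upwards [h, ae_ae_right hFG, ae_restrict_mem measurableSet_Ioo] with y h1 h2 hy
  exact h1.of_ae_eq hab (hG.comp (by fun_prop) fun x hx => ⟨hx, Ioo_subset_Icc_self hy⟩) h2

lemma SliceY.of_ae_eq {a b c d : ℝ} (hcd : c < d) {F G f : ℝ × ℝ → ℝ} (h : SliceY a b c d F f)
    (hG : ContinuousOn G (Icc a b ×ˢ Icc c d)) (hFG : F =ᵐ[volume.restrict (box a b c d)] G) :
    SliceY a b c d G f := by
  filter_upwards [h, ae_ae_left hFG, ae_restrict_mem measurableSet_Ioo] with x h1 h2 hx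
  exact h1.of_ae_eq hcd (hG.comp (by fun_prop) fun y hy => ⟨Ioo_subset_Icc_self hx, hy⟩) h2

lemma sliceX_weight (a b c d : ℝ) {p p' : ℝ → ℝ} (hp : ∀ x, HasDerivAt p (p' x) x)
    (hp' : Continuous p') : SliceX a b c d (fun z => p z.1) (fun z => p' z.1) :=
  ae_of_all _ fun _ => Prim.of_hasDerivAt hp hp'

lemma sliceY_weight (a b c d : ℝ) (p : ℝ → ℝ) :
    SliceY a b c d (fun z => p z.1) (fun _ => 0) :=
  ae_of_all _ fun x => Prim.of_hasDerivAt (fun y => hasDerivAt_const y (p x)) continuous_const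

/-! ### Functions with a weak derivative on a box are primitives on almost every slice -/

lemma exists_smooth_integral_eq_one {a b : ℝ} (hab : a < b) :
    ∃ ρ : ℝ → ℝ, ContDiff ℝ ∞ ρ ∧ HasCompactSupport ρ ∧ tsupport ρ ⊆ Ioo a b ∧ ∫ t, ρ t = 1 := by
  let f : ContDiffBump ((a + b) / 2) :=
    ⟨(b - a) / 8, (b - a) / 4, by linarith, by linarith⟩
  refine ⟨f.normed volume, f.contDiff_normed, f.hasCompactSupport_normed, ?_, f.integral_normed⟩
  rw [f.tsupport_normed_eq]
  intro x hx
  rw [Metric.mem_closedBall, Real.dist_eq, abs_le] at hx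
  have h : f.rOut = (b - a) / 4 := rfl
  rw [h] at hx
  constructor <;> linarith [hx.1, hx.2]

/-- Smoothness is that of a convolution depending smoothly on a parameter, where only one factor has
to be smooth. Taking `f = 1` gives integrals over horizontal lines, and the Heaviside function gives
primitives. -/
lemma contDiff_slice_convolution {f : ℝ → ℝ} (hf : LocallyIntegrable f) {ζ : ℝ × ℝ → ℝ}
    (hζ : ContDiff ℝ ∞ ζ) {k : Set ℝ} (hk : IsCompact k) (hs : ∀ x y, x ∉ k → ζ (x, y) = 0) :
    ContDiff ℝ ∞ fun z : ℝ × ℝ => ∫ t, f (z.1 - t) * ζ (t, z.2) := by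
  have h := contDiffOn_convolution_right_with_param (n := ⊤) (μ := volume)
    (ContinuousLinearMap.mul ℝ ℝ) (g := fun y x : ℝ => ζ (x, y)) isOpen_univ hk
    (fun y x _ hx => hs x y hx) hf
    (by
      rw [univ_prod_univ, contDiffOn_univ]
      exact hζ.comp (contDiff_snd.prodMk contDiff_fst))
  rw [univ_prod_univ, contDiffOn_univ] at h
  have h' : ContDiff ℝ ∞ _ := h.comp (contDiff_snd.prodMk contDiff_fst)
  convert! h' using 1
  ext z
  simp only [Function.comp]
  rw [convolution_eq_swap]
  rfl

lemma contDiff_slice_integral {ζ : ℝ × ℝ → ℝ}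
    (hζ : ContDiff ℝ ∞ ζ) {k : Set ℝ} (hk : IsCompact k) (hs : ∀ x y, x ∉ k → ζ (x, y) = 0) :
    ContDiff ℝ ∞ fun y : ℝ => ∫ t, ζ (t, y) := by
  have h := contDiff_slice_convolution (f := fun _ => 1) (locallyIntegrable_const 1) hζ hk hs
  simp only [one_mul] at h
  exact h.comp ((contDiff_const (c := (0 : ℝ))).prodMk contDiff_id)

/-- The slices vanish to the left of `e`, so integrating from `e` is integrating from -∞, that is,
convolving with the indicator of [0, ∞). -/
lemma contDiff_slice_primitive {ζ : ℝ × ℝ → ℝ} {e : ℝ}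
    (hζ : ContDiff ℝ ∞ ζ) {k : Set ℝ} (hk : IsCompact k) (hs : ∀ x y, x ∉ k → ζ (x, y) = 0)
    (he : ∀ x ∈ k, e ≤ x) :
    ContDiff ℝ ∞ fun z : ℝ × ℝ => ∫ t in e..z.1, ζ (t, z.2) := by
  have hl : LocallyIntegrable (fun t : ℝ => (Ici (0 : ℝ)).indicator (fun _ => (1 : ℝ)) t) :=
    (locallyIntegrable_const 1).indicator measurableSet_Ici
  convert! contDiff_slice_convolution hl hζ hk hs using 1
  ext z
  have hi : ∀ s : Set ℝ, IntegrableOn (fun t => ζ (t, z.2)) s := fun s =>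
    ((hζ.continuous.comp (by fun_prop : Continuous fun t : ℝ => (t, z.2))).integrable_of_hasCompactSupport
      (HasCompactSupport.intro hk fun x hx => hs x _ hx)).integrableOn
  have h1 : ∫ t in Iic e, ζ (t, z.2) = 0 := by
    rw [integral_Iic_eq_integral_Iio]
    refine setIntegral_eq_zero_of_forall_eq_zero fun t ht => hs _ _ fun hk' => ?_
    exact absurd (he t hk') (not_le.2 ht)
  have h2 := intervalIntegral.integral_Iic_sub_Iic (hi (Iic e)) (hi (Iic z.1))
  rw [← h2, h1, sub_zero, ← integral_indicator measurableSet_Iic]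
  congr 1
  ext t
  by_cases ht : t ≤ z.1
  · simp [indicator, ht]
  · simp [indicator, ht]

/-- The variable endpoint is moved into the integrand as a condition, which leaves a parametric
integral of a jointly measurable function. -/
lemma aestronglyMeasurable_slice_primitive {a b c d : ℝ} {g : ℝ × ℝ → ℝ}
    (hg : StronglyMeasurable g) : AEStronglyMeasurable (fun z : ℝ × ℝ => ∫ t in a..z.1, g (t, z.2))
      (volume.restrict (box a b c d)) := by
  have hm : StronglyMeasurable fun z : ℝ × ℝ =>
      ∫ t, (if a < t ∧ t ≤ z.1 then g (t, z.2) else 0) := by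
    refine StronglyMeasurable.integral_prod_right'
      (f := fun q : (ℝ × ℝ) × ℝ => if a < q.2 ∧ q.2 ≤ q.1.1 then g (q.2, q.1.2) else 0) ?_
    refine StronglyMeasurable.ite (f := fun q : (ℝ × ℝ) × ℝ => g (q.2, q.1.2)) (g := fun _ => 0)
      ?_ (hg.comp_measurable (by fun_prop)) stronglyMeasurable_const
    exact (measurableSet_lt measurable_const measurable_snd).inter
      (measurableSet_le measurable_snd (measurable_fst.comp measurable_fst))
  refine hm.aestronglyMeasurable.congr ?_
  filter_upwards [ae_restrict_mem (measurableSet_box a b c d)] with z hz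
  rw [intervalIntegral.integral_of_le hz.1.1.le, ← integral_indicator measurableSet_Ioc]
  simp only [indicator, mem_Ioc]

lemma integrableOn_comp_snd {a b c d : ℝ} {m : ℝ → ℝ} (hm : IntegrableOn m (Ioo c d)) :
    IntegrableOn (fun z : ℝ × ℝ => m z.2) (box a b c d) := by
  rw [IntegrableOn, volume_restrict_box]
  exact Integrable.comp_snd hm _

lemma sliceX_primitive {a b c d : ℝ} (hab : a ≤ b) {g : ℝ × ℝ → ℝ}
    (hg : IntegrableOn g (box a b c d)) :
    SliceX a b c d (fun z => ∫ t in a..z.1, g (t, z.2)) g := by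
  have h := integrableOn_box_swap hg
  rw [IntegrableOn, volume_restrict_box] at h
  filter_upwards [h.prod_right_ae] with y hy
  refine ⟨?_, fun x hx => by simp⟩
  rw [intervalIntegrable_iff_integrableOn_Ioc_of_le hab, IntegrableOn, ← restrict_Ioo_eq_restrict_Ioc]
  exact hy

lemma integrableOn_slice_primitive {a b c d : ℝ} {g : ℝ × ℝ → ℝ} (hab : a ≤ b)
    (hg : IntegrableOn g (box a b c d)) (hm : StronglyMeasurable g) :
    IntegrableOn (fun z : ℝ × ℝ => ∫ t in a..z.1, g (t, z.2)) (box a b c d) := by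
  have h := integrableOn_box_swap hg
  rw [IntegrableOn, volume_restrict_box] at h
  refine Integrable.mono' (integrableOn_comp_snd h.integral_norm_prod_left)
    (aestronglyMeasurable_slice_primitive hm) ?_
  have hs : ∀ᵐ z ∂volume.restrict (box a b c d),
      Prim a b (fun x => ∫ t in a..x, g (t, z.2)) (fun x => g (x, z.2)) := by
    rw [volume_restrict_box]
    exact Measure.quasiMeasurePreserving_snd.ae (sliceX_primitive hab hg)
  filter_upwards [hs, ae_restrict_mem (measurableSet_box a b c d)] with z hz hzb
  have := hz.abs_sub_le (Ioo_subset_Icc_self hzb.1) (left_mem_Icc.2 hab)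
  simpa using this

/-- The du Bois-Reymond argument with a parameter: subtract from `u` the primitive `U` of `g` in x.
The difference `V` has zero weak x-derivative, so it is a function `e` of y alone, and `U + e` is
the representative. -/
theorem exists_sliceX_of_weak {a b c d : ℝ} (hab : a < b) {u g : ℝ × ℝ → ℝ}
    (hu : IntegrableOn u (box a b c d)) (hg : IntegrableOn g (box a b c d))
    (hm : StronglyMeasurable g)
    (hweak : ∀ η, IsTest (box a b c d) η →
      ∫ z in box a b c d, u z * pd (1, 0) η z = -∫ z in box a b c d, g z * η z) :
    ∃ F, F =ᵐ[volume.restrict (box a b c d)] u ∧ SliceX a b c d F g := by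
  obtain ⟨ρ, hρ, hρc, hρs, hρ1⟩ := exists_smooth_integral_eq_one hab
  set U : ℝ × ℝ → ℝ := fun z => ∫ t in a..z.1, g (t, z.2) with hU
  have sU : SliceX a b c d U g := sliceX_primitive hab.le hg
  have iU : IntegrableOn U (box a b c d) := integrableOn_slice_primitive hab.le hg hm
  set V : ℝ × ℝ → ℝ := fun z => u z - U z with hV
  have iV : IntegrableOn V (box a b c d) := hu.sub iU
  have mulV : ∀ {f ζ : ℝ × ℝ → ℝ}, IntegrableOn f (box a b c d) → Continuous ζ →
      (∃ C, ∀ z, |ζ z| ≤ C) → IntegrableOn (fun z => f z * ζ z) (box a b c d) :=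
    fun hf hζ ⟨C, hC⟩ => hf.mul_bdd hζ.aestronglyMeasurable (ae_of_all _ hC)
  set e : ℝ → ℝ := fun y => ∫ x in Ioo a b, V (x, y) * ρ x with he
  have bρ : ∃ C, ∀ z : ℝ × ℝ, |ρ z.1| ≤ C := by
    obtain ⟨C, hC⟩ := hρc.exists_bound_of_continuous hρ.continuous
    exact ⟨C, fun z => hC z.1⟩
  have iVρ : IntegrableOn (fun z => V z * ρ z.1) (box a b c d) :=
    mulV iV (hρ.continuous.comp continuous_fst) bρ
  have ie : IntegrableOn e (Ioo c d) := by
    have h := integrableOn_box_swap iVρ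
    rw [IntegrableOn, volume_restrict_box] at h
    exact h.integral_prod_left
  -- The candidate `e` is the average of `V` over x against the bump `ρ`. It suffices to test `V -
  -- e` against smooth `η` with compact support in the box.
  have key : ∀ᵐ z, z ∈ box a b c d → V z - e z.2 = 0 := by
    refine IsOpen.ae_eq_zero_of_integral_contDiff_smul_eq_zero (isOpen_Ioo.prod isOpen_Ioo)
      ((iV.sub (integrableOn_comp_snd ie)).locallyIntegrableOn) fun η hη hηc hηs => ?_
    set K₁ : Set ℝ := Prod.fst '' tsupport η ∪ tsupport ρ with hK₁
    have cK₁ : IsCompact K₁ := (hηc.image continuous_fst).union hρc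
    set K₂ : Set ℝ := Prod.snd '' tsupport η with hK₂
    have cK₂ : IsCompact K₂ := hηc.image continuous_snd
    have sK₁ : K₁ ⊆ Ioo a b := by
      rintro x (⟨z, hz, rfl⟩ | hx)
      · exact (hηs hz).1
      · exact hρs hx
    have sK₂ : K₂ ⊆ Ioo c d := by
      rintro _ ⟨z, hz, rfl⟩
      exact (hηs hz).2
    have η₁ : ∀ x y, x ∉ K₁ → η (x, y) = 0 := fun x y hx =>
      image_eq_zero_of_notMem_tsupport fun h => hx (Or.inl ⟨_, h, rfl⟩)
    have η₂ : ∀ x y, y ∉ K₂ → η (x, y) = 0 := fun x y hy =>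
      image_eq_zero_of_notMem_tsupport fun h => hy ⟨_, h, rfl⟩
    have ρ₁ : ∀ x, x ∉ K₁ → ρ x = 0 := fun x hx =>
      image_eq_zero_of_notMem_tsupport fun h => hx (Or.inr h)
    set m : ℝ → ℝ := fun y => ∫ t, η (t, y) with hmdef
    have cm : ContDiff ℝ ∞ m := contDiff_slice_integral hη cK₁ η₁
    have m₂ : ∀ y, y ∉ K₂ → m y = 0 := fun y hy => by simp [hmdef, η₂ _ y hy]
    -- Since `ρ` has integral one, this correction of `η` has zero integral on every horizontal
    -- line. Its primitive `A` therefore has compact support and is an admissible test function with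
    -- x-derivative `ζ`.
    set ζ : ℝ × ℝ → ℝ := fun z => η z - ρ z.1 * m z.2 with hζ
    have cζ : ContDiff ℝ ∞ ζ := hη.sub ((hρ.comp contDiff_fst).mul (cm.comp contDiff_snd))
    have ζ₁ : ∀ x y, x ∉ K₁ → ζ (x, y) = 0 := fun x y hx => by simp [hζ, η₁ x y hx, ρ₁ x hx]
    have ζ₂ : ∀ x y, y ∉ K₂ → ζ (x, y) = 0 := fun x y hy => by simp [hζ, η₂ x y hy, m₂ y hy]
    have nK₁ : K₁.Nonempty := by
      by_contra hne
      rw [not_nonempty_iff_eq_empty] at hne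
      have : ρ = 0 := funext fun x => ρ₁ x (by simp [hne])
      simp [this] at hρ1
    obtain ⟨i₀, hi₀, hi₀'⟩ := cK₁.exists_isLeast nK₁
    obtain ⟨i₁, hi₁, hi₁'⟩ := cK₁.exists_isGreatest nK₁
    set A : ℝ × ℝ → ℝ := fun z => ∫ t in a..z.1, ζ (t, z.2) with hA
    have cA : ContDiff ℝ ∞ A := contDiff_slice_primitive cζ cK₁ ζ₁ fun x hx => (sK₁ hx).1.le
    have slζ : ∀ y, Continuous fun t => ζ (t, y) := fun y => cζ.continuous.comp (by fun_prop)
    have slη : ∀ y, Continuous fun t => η (t, y) := fun y => hη.continuous.comp (by fun_prop)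
    have intη : ∀ y, Integrable fun t => η (t, y) := fun y =>
      (slη y).integrable_of_hasCompactSupport (HasCompactSupport.intro cK₁ fun x hx => η₁ x _ hx)
    have intρ : Integrable ρ := hρ.continuous.integrable_of_hasCompactSupport hρc
    have intζ : ∀ y, ∫ t, ζ (t, y) = 0 := fun y => by
      simp only [hζ]
      rw [integral_sub (intη y) (intρ.mul_const _), integral_mul_const, hρ1, one_mul, sub_self]
    have A₁ : ∀ x y, x < i₀ → A (x, y) = 0 := fun x y hx => by
      refine intervalIntegral.integral_zero_ae (ae_of_all _ fun t ht => ζ₁ _ _ fun hk => ?_)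
      have h1 := hi₀' hk
      have h2 := (sK₁ hi₀).1
      rcases le_total a x with h | h
      · rw [uIoc_of_le h] at ht; linarith [ht.2]
      · rw [uIoc_of_ge h] at ht; linarith [ht.2]
    have A₁' : ∀ x y, i₁ < x → A (x, y) = 0 := fun x y hx => by
      have hax : a ≤ x := ((sK₁ hi₁).1.trans hx).le
      rw [hA]
      simp only
      rw [intervalIntegral.integral_of_le hax, ← intζ y]
      refine setIntegral_eq_integral_of_forall_compl_eq_zero fun t ht => ζ₁ _ _ fun hk => ht ?_
      exact ⟨(sK₁ hk).1, (hi₁' hk).trans hx.le⟩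
    have A₂ : ∀ x y, y ∉ K₂ → A (x, y) = 0 := fun x y hy => by simp [hA, ζ₂ _ y hy]
    have suppA : Function.support A ⊆ Icc i₀ i₁ ×ˢ K₂ := by
      rintro ⟨x, y⟩ hz
      rw [Function.mem_support] at hz
      refine ⟨⟨?_, ?_⟩, ?_⟩
      · by_contra h; exact hz (A₁ x y (not_le.1 h))
      · by_contra h; exact hz (A₁' x y (not_le.1 h))
      · by_contra h; exact hz (A₂ x y h)
    have tsA : tsupport A ⊆ Icc i₀ i₁ ×ˢ K₂ :=
      closure_minimal suppA (isClosed_Icc.prod cK₂.isClosed)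
    have tA : IsTest (box a b c d) A := by
      refine ⟨cA, (isCompact_Icc.prod cK₂).of_isClosed_subset (isClosed_tsupport _) tsA,
        tsA.trans (prod_mono ?_ sK₂)⟩
      exact Icc_subset_Ioo (sK₁ hi₀).1 (sK₁ hi₁).2
    have pA : ∀ z, pd (1, 0) A z = ζ z := by
      rintro ⟨x, y⟩
      have h1 : HasFDerivAt A (fderiv ℝ A (x, y)) (x, y) :=
        (cA.differentiable (by simp)).differentiableAt.hasFDerivAt
      have h2 : HasDerivAt (fun t : ℝ => (t, y)) ((1, 0) : ℝ × ℝ) x :=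
        (hasDerivAt_id x).prodMk (hasDerivAt_const x y)
      have h3 := h1.comp_hasDerivAt x h2
      have h4 : HasDerivAt (A ∘ fun t : ℝ => (t, y)) (ζ (x, y)) x :=
        intervalIntegral.integral_hasDerivAt_right ((slζ y).intervalIntegrable _ _)
          (slζ y).stronglyMeasurable.stronglyMeasurableAtFilter (slζ y).continuousAt
      exact h3.unique h4
    have bdd : ∀ {f : ℝ × ℝ → ℝ}, Continuous f → HasCompactSupport f → ∃ C, ∀ z, |f z| ≤ C :=
      fun hf hfc => hfc.exists_bound_of_continuous hf
    have csζ : HasCompactSupport ζ := HasCompactSupport.intro (cK₁.prod cK₂) fun z hz => by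
      rw [mem_prod, not_and_or] at hz
      rcases hz with h | h
      exacts [ζ₁ _ _ h, ζ₂ _ _ h]
    have hw := hweak A tA
    simp only [pA] at hw
    have sA : SliceX a b c d A ζ := ae_of_all _ fun y =>
      ⟨(slζ y).intervalIntegrable _ _, fun x _ => by simp [hA]⟩
    have igA : IntegrableOn (fun z => g z * A z) (box a b c d) :=
      mulV hg cA.continuous (bdd cA.continuous tA.2.1)
    have iUζ : IntegrableOn (fun z => U z * ζ z) (box a b c d) :=
      mulV iU cζ.continuous (bdd cζ.continuous csζ)
    have iuζ : IntegrableOn (fun z => u z * ζ z) (box a b c d) :=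
      mulV hu cζ.continuous (bdd cζ.continuous csζ)
    -- Integrating by parts on slices shows that `U` pairs with `ζ` exactly as `u` does in the weak
    -- formulation, so `V` is orthogonal to `ζ`.
    have hp := (sU.mul hab.le sA).integral hab.le (igA.add iUζ)
    have hz : ∀ y, A (b, y) = 0 ∧ A (a, y) = 0 := fun y =>
      ⟨A₁' b y (sK₁ hi₁).2, A₁ a y (sK₁ hi₀).1⟩
    simp only [hz, mul_zero, sub_self, integral_zero] at hp
    rw [integral_add igA iUζ] at hp
    have hVζ : ∫ z in box a b c d, V z * ζ z = 0 := by
      simp only [hV, sub_mul]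
      rw [integral_sub iuζ iUζ]
      linarith
    have iVη : IntegrableOn (fun z => V z * η z) (box a b c d) :=
      mulV iV hη.continuous (bdd hη.continuous hηc)
    have bm : ∃ C, ∀ z : ℝ × ℝ, |m z.2| ≤ C := by
      obtain ⟨C, hC⟩ := (HasCompactSupport.intro cK₂ m₂).exists_bound_of_continuous cm.continuous
      exact ⟨C, fun z => hC z.2⟩
    have iVρm : IntegrableOn (fun z => V z * ρ z.1 * m z.2) (box a b c d) :=
      mulV iVρ (cm.continuous.comp continuous_snd) bm
    have h1 : ∫ z in box a b c d, V z * η z = ∫ z in box a b c d, V z * ρ z.1 * m z.2 := by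
      rw [← sub_eq_zero, ← integral_sub iVη iVρm, ← hVζ]
      congr 1
      ext z
      simp only [hζ]
      ring
    have ieη : IntegrableOn (fun z => e z.2 * η z) (box a b c d) :=
      mulV (integrableOn_comp_snd ie) hη.continuous (bdd hη.continuous hηc)
    have h2 : ∫ z in box a b c d, e z.2 * η z = ∫ z in box a b c d, V z * ρ z.1 * m z.2 := by
      rw [setIntegral_box' ieη, setIntegral_box' iVρm]
      congr 1
      ext y
      simp only
      rw [integral_mul_const, integral_const_mul]
      congr 1
      refine setIntegral_eq_integral_of_forall_compl_eq_zero fun t ht => η₁ _ _ fun hk => ht ?_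
      exact sK₁ hk
    have h3 : ∫ z in box a b c d, η z • (V z - e z.2) = 0 := by
      have : ∀ z : ℝ × ℝ, η z • (V z - e z.2) = V z * η z - e z.2 * η z := fun z => by
        rw [smul_eq_mul]; ring
      simp only [this]
      rw [integral_sub iVη ieη, h1, h2, sub_self]
    rw [← h3]
    symm
    refine setIntegral_eq_integral_of_forall_compl_eq_zero fun z hz => ?_
    rw [image_eq_zero_of_notMem_tsupport fun h => hz (hηs h), zero_smul]
  refine ⟨fun z => U z + e z.2, ?_, ?_⟩
  · filter_upwards [ae_restrict_of_ae key, ae_restrict_mem (measurableSet_box a b c d)] with z h hz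
    have := h hz
    linarith [show V z = u z - U z from rfl]
  · filter_upwards [sU] with y hy
    refine ⟨hy.int, fun x hx => ?_⟩
    have h1 : U (x, y) = U (a, y) + ∫ t in a..x, g (t, y) := hy.eq x hx
    linarith

lemma isTest_comp_swap {a b c d : ℝ} {η : ℝ × ℝ → ℝ} (h : IsTest (box c d a b) η) :
    IsTest (box a b c d) (η ∘ Prod.swap) := by
  refine ⟨h.1.comp (contDiff_snd.prodMk contDiff_fst),
    h.2.1.comp_homeomorph (Homeomorph.prodComm ℝ ℝ), ?_⟩
  have : tsupport (η ∘ Prod.swap) = Prod.swap ⁻¹' tsupport η :=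
    tsupport_comp_eq_preimage η (Homeomorph.prodComm ℝ ℝ)
  rw [this]
  intro z hz
  exact ⟨(h.2.2 hz).2, (h.2.2 hz).1⟩

theorem exists_sliceY_of_weak {a b c d : ℝ} (hcd : c < d) {u g : ℝ × ℝ → ℝ}
    (hu : IntegrableOn u (box a b c d)) (hg : IntegrableOn g (box a b c d))
    (hm : StronglyMeasurable g)
    (hweak : ∀ η, IsTest (box a b c d) η →
      ∫ z in box a b c d, u z * pd (0, 1) η z = -∫ z in box a b c d, g z * η z) :
    ∃ F, F =ᵐ[volume.restrict (box a b c d)] u ∧ SliceY a b c d F g := by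
  obtain ⟨F, hF, hs⟩ := exists_sliceX_of_weak hcd (integrableOn_box_swap hu)
    (integrableOn_box_swap hg) (hm.comp_measurable measurable_swap) fun η hη => by
      have h := hweak _ (isTest_comp_swap hη)
      rw [← setIntegral_box_swap,
        ← setIntegral_box_swap a b c d (fun z => g z * (η ∘ Prod.swap) z)] at h
      simp only [Function.comp, Prod.swap_swap] at h ⊢
      rw [← h]
      congr 1
      ext z
      congr 1
      have h1 : HasFDerivAt η (fderiv ℝ η z) z :=
        (hη.1.differentiable (by simp)).differentiableAt.hasFDerivAt
      have h2 : HasFDerivAt (fun z : ℝ × ℝ => η z.swap)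
          ((fderiv ℝ η z).comp ((ContinuousLinearMap.snd ℝ ℝ ℝ).prod
            (ContinuousLinearMap.fst ℝ ℝ ℝ))) z.swap := by
        refine HasFDerivAt.comp z.swap (g := η) (f := Prod.swap) h1 ?_
        exact hasFDerivAt_snd.prodMk hasFDerivAt_fst
      have h3 : fderiv ℝ (η ∘ Prod.swap) z.swap = _ := h2.fderiv
      simp [pd, h3]
  refine ⟨F ∘ Prod.swap, ?_, ?_⟩
  · filter_upwards [ae_box_swap hF] with z hz
    simpa using hz
  · rw [sliceY_iff_swap]
    simpa [Function.comp_assoc] using hs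

/-! ### Continuous representatives on a box -/

instance (a b c d : ℝ) : IsFiniteMeasure ((volume : Measure (ℝ × ℝ)).restrict (box a b c d)) := by
  rw [volume_restrict_box]; infer_instance

lemma closure_box {a b c d : ℝ} (hab : a < b) (hcd : c < d) :
    closure (box a b c d) = Icc a b ×ˢ Icc c d := by
  rw [closure_prod_eq, closure_Ioo hab.ne, closure_Ioo hcd.ne]

lemma ae_eq_box_of_ae_ae {a b c d : ℝ} {f g : ℝ × ℝ → ℝ}
    (hf : AEStronglyMeasurable f (volume.restrict (box a b c d)))
    (hg : AEStronglyMeasurable g (volume.restrict (box a b c d)))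
    (h : ∀ᵐ x ∂volume.restrict (Ioo a b), ∀ᵐ y ∂volume.restrict (Ioo c d), f (x, y) = g (x, y)) :
    f =ᵐ[volume.restrict (box a b c d)] g := by
  obtain ⟨f', mf, ef⟩ := hf
  obtain ⟨g', mg, eg⟩ := hg
  have key : f' =ᵐ[volume.restrict (box a b c d)] g' := by
    rw [volume_restrict_box]
    refine (Measure.ae_prod_iff_ae_ae (measurableSet_eq_fun mf.measurable mg.measurable)).2 ?_
    filter_upwards [h, ae_ae_left ef, ae_ae_left eg] with x h1 h2 h3
    filter_upwards [h1, h2, h3] with y h1 h2 h3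
    rw [← h2, ← h3, h1]
  exact ef.trans (key.trans eg.symm)

lemma ae_box_snd {a b c d : ℝ} {p : ℝ → Prop} (h : ∀ᵐ y ∂volume.restrict (Ioo c d), p y) :
    ∀ᵐ z ∂(volume : Measure (ℝ × ℝ)).restrict (box a b c d), p z.2 := by
  rw [volume_restrict_box]
  exact Measure.quasiMeasurePreserving_snd.ae h

lemma ae_box_fst {a b c d : ℝ} {p : ℝ → Prop} (h : ∀ᵐ x ∂volume.restrict (Ioo a b), p x) :
    ∀ᵐ z ∂(volume : Measure (ℝ × ℝ)).restrict (box a b c d), p z.1 := by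
  rw [volume_restrict_box]
  exact Measure.quasiMeasurePreserving_fst.ae h

lemma ae_fst_ne (p : ℝ) {s : Set (ℝ × ℝ)} : ∀ᵐ q ∂(volume : Measure (ℝ × ℝ)).restrict s, q.1 ≠ p := by
  refine ae_restrict_of_ae ?_
  rw [Measure.volume_eq_prod]
  exact Measure.quasiMeasurePreserving_fst.ae (Measure.ae_ne volume p)

lemma ae_snd_ne (p : ℝ) {s : Set (ℝ × ℝ)} : ∀ᵐ q ∂(volume : Measure (ℝ × ℝ)).restrict s, q.2 ≠ p := by
  refine ae_restrict_of_ae ?_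
  rw [Measure.volume_eq_prod]
  exact Measure.quasiMeasurePreserving_snd.ae (Measure.ae_ne volume p)

lemma eventually_le_iff {x p : ℝ} (h : x ≠ p) : ∀ᶠ q in nhds p, (x ≤ q ↔ x ≤ p) := by
  rcases lt_or_gt_of_ne h with h | h
  · filter_upwards [lt_mem_nhds h] with q hq
    exact ⟨fun _ => h.le, fun _ => hq.le⟩
  · filter_upwards [gt_mem_nhds h] with q hq
    exact ⟨fun h' => absurd hq (not_lt.2 h'), fun h' => absurd h (not_lt.2 h')⟩

/-- The double primitive of an integrable function is continuous. -/
lemma continuousOn_double_primitive {a b c d : ℝ} {g : ℝ × ℝ → ℝ}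
    (hg : IntegrableOn g (box a b c d)) (hm : StronglyMeasurable g) :
    ContinuousOn (fun z : ℝ × ℝ => ∫ s in c..z.2, ∫ t in a..z.1, g (t, s))
      (Icc a b ×ˢ Icc c d) := by
  have hmi : ∀ z : ℝ × ℝ, MeasurableSet {q : ℝ × ℝ | q.1 ≤ z.1 ∧ q.2 ≤ z.2} := fun z =>
    (measurableSet_le measurable_fst measurable_const).inter
      (measurableSet_le measurable_snd measurable_const)
  have hc : Continuous fun z : ℝ × ℝ =>
      ∫ q in box a b c d, {q : ℝ × ℝ | q.1 ≤ z.1 ∧ q.2 ≤ z.2}.indicator g q := by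
    -- Dominated convergence: for `q` off the two axis-parallel lines through `z₀`, the indicator of
    -- the quadrant below `z`, evaluated at `q`, is constant for `z` near `z₀`.
    refine continuous_iff_continuousAt.2 fun z₀ => ?_
    refine continuousAt_of_dominated (bound := fun q => ‖g q‖)
      (Filter.Eventually.of_forall fun z => (hm.indicator (hmi z)).aestronglyMeasurable)
      (Filter.Eventually.of_forall fun z => ae_of_all _ fun q => norm_indicator_le_norm_self _ _)
      hg.norm ?_
    filter_upwards [ae_fst_ne z₀.1, ae_snd_ne z₀.2] with q h1 h2
    refine ContinuousAt.congr (continuousAt_const (y := {q : ℝ × ℝ | q.1 ≤ z₀.1 ∧ q.2 ≤ z₀.2}.indicator g q)) ?_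
    have e1 := continuousAt_fst.eventually (eventually_le_iff h1)
    have e2 := continuousAt_snd.eventually (eventually_le_iff h2)
    filter_upwards [e1, e2] with z h1 h2
    simp [indicator, h1, h2]
  refine hc.continuousOn.congr fun z hz => ?_
  simp only
  rw [setIntegral_box' (hg.indicator (hmi z)), intervalIntegral.integral_of_le hz.2.1]
  have e : ∀ s, (∫ t in Ioo a b, {q : ℝ × ℝ | q.1 ≤ z.1 ∧ q.2 ≤ z.2}.indicator g (t, s)) =
      (Iic z.2).indicator (fun s => ∫ t in a..z.1, g (t, s)) s := by
    intro s
    by_cases hs : s ≤ z.2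
    · rw [indicator_of_mem (show s ∈ Iic z.2 from hs), intervalIntegral.integral_of_le hz.1.1,
        ← integral_Ioc_eq_integral_Ioo]
      have : ∀ t, {q : ℝ × ℝ | q.1 ≤ z.1 ∧ q.2 ≤ z.2}.indicator g (t, s) =
          (Iic z.1).indicator (fun t => g (t, s)) t := fun t => by
        simp [indicator, hs]
      simp only [this]
      rw [setIntegral_indicator measurableSet_Iic, Ioc_inter_Iic, min_eq_right hz.1.2]
    · rw [indicator_of_notMem (show s ∉ Iic z.2 from hs)]
      simp [indicator, hs]
  simp only [e]
  rw [← integral_Ioc_eq_integral_Ioo, setIntegral_indicator measurableSet_Iic, Ioc_inter_Iic,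
    min_eq_right hz.2.2]

lemma ae_prop_nonempty {a b : ℝ} (hab : a < b) {p : ℝ → Prop}
    (h : ∀ᵐ x ∂volume.restrict (Ioo a b), p x) : ∃ x ∈ Ioo a b, p x := by
  have : Filter.NeBot (ae ((volume : Measure ℝ).restrict (Ioo a b))) := by
    rw [ae_neBot]
    simp [hab]
  obtain ⟨x, hx, hx'⟩ := ((ae_restrict_mem measurableSet_Ioo).and h).exists
  exact ⟨x, hx, hx'⟩

lemma integrable_slice_left {a b c d : ℝ} {g : ℝ × ℝ → ℝ} (hg : IntegrableOn g (box a b c d)) :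
    ∀ᵐ x ∂volume.restrict (Ioo a b), IntegrableOn (fun y => g (x, y)) (Ioo c d) := by
  rw [IntegrableOn, volume_restrict_box] at hg
  exact hg.prod_right_ae

/-- If `∂ᵧF = G` and `∂ₓG = g`, then `F` is given on almost every slice by integrating first along
the left side and then over a rectangle. -/
lemma slice_formula {a b c d : ℝ} (hab : a < b) {F G f g : ℝ × ℝ → ℝ}
    (hf : IntegrableOn f (box a b c d)) (hg : IntegrableOn g (box a b c d))
    (hm : StronglyMeasurable g) (sF : SliceY a b c d F f)
    (eG : G =ᵐ[volume.restrict (box a b c d)] f) (sG : SliceX a b c d G g) :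
    (∀ y ∈ Icc c d, IntervalIntegrable (fun s => G (a, s)) volume c y) ∧
    ∀ᵐ x ∂volume.restrict (Ioo a b), ∀ y ∈ Icc c d,
      F (x, y) = F (x, c) + (∫ s in c..y, G (a, s)) + ∫ s in c..y, ∫ t in a..x, g (t, s) := by
  have hs₂ : ∀ᵐ s ∂volume.restrict (Ioo c d), ∀ x ∈ Icc a b,
      G (x, s) = G (a, s) + ∫ t in a..x, g (t, s) := by
    filter_upwards [sG] with s hs
    exact hs.eq
  have iP := integrableOn_slice_primitive hab.le hg hm
  -- The trace on the left side is a null-set value, so its integrability is not immediate. It is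
  -- carried over from one good vertical line, where both `G` and the primitive of `g` are
  -- integrable.
  have iκ : IntegrableOn (fun s => G (a, s)) (Ioo c d) := by
    obtain ⟨x, hx, h1, h2, h3⟩ := ae_prop_nonempty hab
      ((ae_ae_left eG).and ((integrable_slice_left hf).and (integrable_slice_left iP)))
    refine (h2.sub h3).congr ?_
    filter_upwards [h1, hs₂] with s h1 h2
    have := h2 x (Ioo_subset_Icc_self hx)
    simp only [Pi.sub_apply]
    linarith
  have iκ' : ∀ {κ : ℝ → ℝ}, IntegrableOn κ (Ioo c d) → ∀ y ∈ Icc c d,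
      IntervalIntegrable κ volume c y := fun {κ} iκ y hy => by
    rw [intervalIntegrable_iff_integrableOn_Ioc_of_le hy.1]
    refine IntegrableOn.mono_set ?_ (Ioc_subset_Ioc_right hy.2)
    rw [IntegrableOn, ← restrict_Ioo_eq_restrict_Ioc]
    exact iκ
  refine ⟨iκ' iκ, ?_⟩
  filter_upwards [sF, ae_ae_left eG, integrable_slice_left iP, ae_restrict_mem measurableSet_Ioo]
    with x h1 h2 h3 hx y hy
  rw [h1.eq y hy, add_assoc, ← intervalIntegral.integral_add (iκ' iκ y hy) (iκ' h3 y hy)]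
  congr 1
  rw [intervalIntegral.integral_of_le hy.1, intervalIntegral.integral_of_le hy.1,
    integral_Ioc_eq_integral_Ioo, integral_Ioc_eq_integral_Ioo]
  refine integral_congr_ae (ae_mono (Measure.restrict_mono (Ioo_subset_Ioo_right hy.2) le_rfl) ?_)
  filter_upwards [h2, hs₂] with s h2 h3
  rw [← h3 x (Ioo_subset_Icc_self hx), h2]

lemma aestronglyMeasurable_box {a b c d : ℝ} {W : ℝ × ℝ → ℝ}
    (cW : ContinuousOn W (Icc a b ×ˢ Icc c d)) :
    AEStronglyMeasurable W (volume.restrict (box a b c d)) :=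
  (cW.mono (prod_mono Ioo_subset_Icc_self Ioo_subset_Icc_self)).aestronglyMeasurable
    (measurableSet_box a b c d)

/-- A function with first derivatives and mixed second derivative in `L¹` has a continuous
representative. -/
theorem exists_continuous_rep {a b c d : ℝ} (hab : a < b) (hcd : c < d) {f fx fy fxy : ℝ × ℝ → ℝ}
    (hf : IntegrableOn f (box a b c d)) (hfy : IntegrableOn fy (box a b c d))
    (hfxy : IntegrableOn fxy (box a b c d)) (hm : StronglyMeasurable fxy)
    (h1 : ∃ F, F =ᵐ[volume.restrict (box a b c d)] f ∧ SliceY a b c d F fy)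
    (h2 : ∃ F, F =ᵐ[volume.restrict (box a b c d)] fy ∧ SliceX a b c d F fxy)
    (h3 : ∃ F, F =ᵐ[volume.restrict (box a b c d)] f ∧ SliceX a b c d F fx) :
    ∃ W, ContinuousOn W (Icc a b ×ˢ Icc c d) ∧ f =ᵐ[volume.restrict (box a b c d)] W := by
  obtain ⟨F₁, e₁, s₁⟩ := h1
  obtain ⟨F₂, e₂, s₂⟩ := h2
  obtain ⟨F₃, e₃, s₃⟩ := h3
  set Z : ℝ × ℝ → ℝ := fun z => ∫ s in c..z.2, ∫ t in a..z.1, fxy (t, s) with hZ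
  have cZ : ContinuousOn Z (Icc a b ×ˢ Icc c d) := continuousOn_double_primitive hfxy hm
  obtain ⟨iκ, hF₁⟩ := slice_formula hab hfy hfxy hm s₁ e₂ s₂
  -- The slice formula for `F₁` contains F₁(x, c), whose continuity in x is unknown. Restarting the
  -- formula from a generic height `y₀` replaces it by F₃(x, y₀), which is a primitive in x and so
  -- continuous.
  obtain ⟨y₀, hy₀, hy₁, hy₂⟩ := ae_prop_nonempty hcd (s₃.and (ae_ae_right (e₁.trans e₃.symm)))
  set W : ℝ × ℝ → ℝ := fun z => F₃ (z.1, y₀) +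
    ((∫ s in c..z.2, F₂ (a, s)) - ∫ s in c..y₀, F₂ (a, s)) + (Z z - Z (z.1, y₀)) with hW
  have cW : ContinuousOn W (Icc a b ×ˢ Icc c d) := by
    have c1 : ContinuousOn (fun z : ℝ × ℝ => F₃ (z.1, y₀)) (Icc a b ×ˢ Icc c d) :=
      (hy₁.continuousOn hab.le).comp continuousOn_fst fun z hz => hz.1
    have c2 : ContinuousOn (fun z : ℝ × ℝ => ∫ s in c..z.2, F₂ (a, s)) (Icc a b ×ˢ Icc c d) := by
      have h : Prim c d (fun y => ∫ s in c..y, F₂ (a, s)) (fun s => F₂ (a, s)) :=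
        ⟨iκ d ⟨hcd.le, le_rfl⟩, fun y _ => by simp⟩
      exact (h.continuousOn hcd.le).comp continuousOn_snd fun z hz => hz.2
    have c3 : ContinuousOn (fun z : ℝ × ℝ => Z (z.1, y₀)) (Icc a b ×ˢ Icc c d) :=
      cZ.comp (by fun_prop) fun z hz => ⟨hz.1, Ioo_subset_Icc_self hy₀⟩
    exact (c1.add (c2.sub continuousOn_const)).add (cZ.sub c3)
  refine ⟨W, cW, ?_⟩
  refine ae_eq_box_of_ae_ae hf.aestronglyMeasurable (aestronglyMeasurable_box cW) ?_
  filter_upwards [hF₁, ae_ae_left e₁, hy₂] with x h1 h2 h3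
  filter_upwards [h2, ae_restrict_mem measurableSet_Ioo] with y h2 hy
  rw [← h2, h1 y (Ioo_subset_Icc_self hy)]
  have h4 := h1 y₀ (Ioo_subset_Icc_self hy₀)
  simp only [hW, hZ]
  linarith

/-- Slices on the whole closed box, when `F` is continuous: for every `x`, the trace of `G = ∂ᵧF`
on the vertical line through `x` is the derivative of the trace of `F`. -/
lemma prim_trace {a b c d : ℝ} (hab : a < b) {F G f g : ℝ × ℝ → ℝ}
    (hf : IntegrableOn f (box a b c d)) (hg : IntegrableOn g (box a b c d))
    (hm : StronglyMeasurable g) (cF : ContinuousOn F (Icc a b ×ˢ Icc c d))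
    (sF : SliceY a b c d F f) (eG : G =ᵐ[volume.restrict (box a b c d)] f)
    (sG : SliceX a b c d G g) {x : ℝ} (hx : x ∈ Icc a b) (hcd : c ≤ d) :
    Prim c d (fun y => F (x, y)) (fun y => G (x, y)) := by
  obtain ⟨iκ, hF⟩ := slice_formula hab hf hg hm sF eG sG
  have cZ := continuousOn_double_primitive hg hm
  have iP : ∀ y ∈ Icc c d, IntervalIntegrable (fun s => ∫ t in a..x, g (t, s)) volume c y := by
    intro y hy
    have h := integrableOn_box_swap (hg.mono_set (prod_mono (Ioo_subset_Ioo_right hx.2)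
      (Ioo_subset_Ioo_right hy.2) : box a x c y ⊆ box a b c d))
    rw [IntegrableOn, volume_restrict_box] at h
    rw [intervalIntegrable_iff_integrableOn_Ioc_of_le hy.1, IntegrableOn,
      ← restrict_Ioo_eq_restrict_Ioc]
    refine h.integral_prod_left.congr (ae_of_all _ fun s => ?_)
    simp only [Function.comp, Prod.swap_prod_mk]
    rw [intervalIntegral.integral_of_le hx.1, integral_Ioc_eq_integral_Ioo]
  have hG : ∀ y ∈ Icc c d, (fun s => G (x, s)) =ᵐ[volume.restrict (uIoc c y)]
      fun s => G (a, s) + ∫ t in a..x, g (t, s) := by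
    intro y hy
    rw [uIoc_of_le hy.1, ← restrict_Ioo_eq_restrict_Ioc]
    refine ae_mono (Measure.restrict_mono (Ioo_subset_Ioo_right hy.2) le_rfl) ?_
    filter_upwards [sG] with s hs
    exact hs.eq x hx
  -- The formula holds for almost every abscissa and both sides are continuous in it, so it holds
  -- for every abscissa, the two vertical sides included.
  have hmain : ∀ y ∈ Icc c d, F (x, y) =
      F (x, c) + (∫ s in c..y, G (a, s)) + ∫ s in c..y, ∫ t in a..x, g (t, s) := by
    intro y hy
    have sl : ∀ {K : ℝ × ℝ → ℝ} {y : ℝ}, ContinuousOn K (Icc a b ×ˢ Icc c d) → y ∈ Icc c d →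
        ContinuousOn (fun x => K (x, y)) (Icc a b) := fun hK hy =>
      hK.comp (by fun_prop) fun x hx => ⟨hx, hy⟩
    refine eqOn_Icc_of_ae_eq (F := fun x => F (x, y)) (G := fun x => F (x, c) +
      (∫ s in c..y, G (a, s)) + ∫ s in c..y, ∫ t in a..x, g (t, s)) hab (sl cF hy)
      (((sl cF ⟨le_rfl, hcd⟩).add continuousOn_const).add (sl cZ hy)) ?_ hx
    filter_upwards [hF] with x hx
    exact hx y hy
  refine ⟨((iκ d ⟨hcd, le_rfl⟩).add (iP d ⟨hcd, le_rfl⟩)).congr_ae (hG d ⟨hcd, le_rfl⟩).symm,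
    fun y hy => ?_⟩
  rw [hmain y hy, add_assoc, ← intervalIntegral.integral_add (iκ y hy) (iP y hy)]
  congr 1
  refine intervalIntegral.integral_congr_ae_restrict ?_
  exact (hG y hy).symm

lemma Prim.ae_eq_zero {a b : ℝ} (hab : a ≤ b) {F f : ℝ → ℝ} (h : Prim a b F f)
    (h0 : ∀ x ∈ Icc a b, F x = 0) : ∀ᵐ x ∂volume.restrict (Ioo a b), f x = 0 := by
  filter_upwards [ae_restrict_of_ae (h.ae_hasDerivAt hab), ae_restrict_mem measurableSet_Ioo]
    with x hx hx'
  have h1 := hx (by rw [uIcc_of_le hab]; exact Ioo_subset_Icc_self hx')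
  refine h1.unique ((hasDerivAt_const x (0 : ℝ)).congr_of_eventuallyEq ?_)
  filter_upwards [isOpen_Ioo.mem_nhds hx'] with t ht
  rw [← h.eq t (Ioo_subset_Icc_self ht), h0 t (Ioo_subset_Icc_self ht)]

/-- The one-dimensional Sobolev inequality on vertical lines, integrated over x. The bound is
uniform over all heights `y`, which makes it usable inside a second application in the other
variable. -/
lemma SliceY.integral_abs_le {a b c d : ℝ} (hcd : c < d) {F f : ℝ × ℝ → ℝ}
    (h : SliceY a b c d F f) (hF : IntegrableOn F (box a b c d)) (hf : IntegrableOn f (box a b c d))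
    {y : ℝ} (hy : y ∈ Icc c d) : ∫ x in Ioo a b, |F (x, y)| ≤
      (d - c)⁻¹ * (∫ z in box a b c d, |F z|) + ∫ z in box a b c d, |f z| := by
  rw [setIntegral_box hF.abs, setIntegral_box hf.abs]
  rw [IntegrableOn, volume_restrict_box] at hF hf
  rw [← integral_const_mul, ← integral_add (hF.abs.integral_prod_left.const_mul _)
    hf.abs.integral_prod_left]
  refine integral_mono_of_nonneg (ae_of_all _ fun _ => abs_nonneg _)
    ((hF.abs.integral_prod_left.const_mul _).add hf.abs.integral_prod_left) ?_
  filter_upwards [h] with x hx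
  exact hx.abs_le hcd hy

lemma abs_le_of_ae_box {a b c d : ℝ} (hab : a < b) (hcd : c < d) {W : ℝ × ℝ → ℝ} {M : ℝ}
    (hW : ContinuousOn W (Icc a b ×ˢ Icc c d))
    (h : ∀ᵐ z ∂volume.restrict (box a b c d), |W z| ≤ M) {z : ℝ × ℝ}
    (hz : z ∈ Icc a b ×ˢ Icc c d) : |W z| ≤ M := by
  have hsub : box a b c d ⊆ Icc a b ×ˢ Icc c d := prod_mono Ioo_subset_Icc_self Ioo_subset_Icc_self
  -- Truncation turns the inequality into an equality of continuous functions, which passes from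
  -- almost everywhere to the closed box.
  have hc : ContinuousOn (fun z => max |W z| M) (Icc a b ×ˢ Icc c d) :=
    hW.abs.sup continuousOn_const
  have h1 : EqOn (fun z => max |W z| M) (fun _ => M) (box a b c d) := by
    refine Measure.eqOn_open_of_ae_eq (μ := volume) ?_ (isOpen_Ioo.prod isOpen_Ioo)
      (hc.mono hsub) continuousOn_const
    filter_upwards [h] with z hz
    exact max_eq_right hz
  have h2 := h1.of_subset_closure hc continuousOn_const hsub (closure_box hab hcd).ge hz
  exact max_eq_right_iff.1 h2

/-- Sup bound for the continuous representative. -/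
theorem abs_le_of_slices {a b c d : ℝ} (hab : a < b) (hcd : c < d) {f fx fy fxy W : ℝ × ℝ → ℝ}
    (hf : IntegrableOn f (box a b c d)) (hfx : IntegrableOn fx (box a b c d))
    (hfy : IntegrableOn fy (box a b c d)) (hfxy : IntegrableOn fxy (box a b c d))
    (h1 : ∃ F, F =ᵐ[volume.restrict (box a b c d)] f ∧ SliceY a b c d F fy)
    (h2 : ∃ F, F =ᵐ[volume.restrict (box a b c d)] fx ∧ SliceY a b c d F fxy)
    (h3 : ∃ F, F =ᵐ[volume.restrict (box a b c d)] f ∧ SliceX a b c d F fx)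
    (hW : ContinuousOn W (Icc a b ×ˢ Icc c d)) (hWf : f =ᵐ[volume.restrict (box a b c d)] W)
    {z : ℝ × ℝ} (hz : z ∈ Icc a b ×ˢ Icc c d) :
    |W z| ≤ (b - a)⁻¹ * ((d - c)⁻¹ * (∫ z in box a b c d, |f z|) + ∫ z in box a b c d, |fy z|) +
      ((d - c)⁻¹ * (∫ z in box a b c d, |fx z|) + ∫ z in box a b c d, |fxy z|) := by
  obtain ⟨F₁, e₁, s₁⟩ := h1
  obtain ⟨F₂, e₂, s₂⟩ := h2
  obtain ⟨F₃, e₃, s₃⟩ := h3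
  refine abs_le_of_ae_box hab hcd hW ?_ hz
  have key : ∀ᵐ y ∂volume.restrict (Ioo c d), ∀ x ∈ Icc a b, |F₃ (x, y)| ≤
      (b - a)⁻¹ * ((d - c)⁻¹ * (∫ z in box a b c d, |f z|) + ∫ z in box a b c d, |fy z|) +
      ((d - c)⁻¹ * (∫ z in box a b c d, |fx z|) + ∫ z in box a b c d, |fxy z|) := by
    filter_upwards [s₃, ae_ae_right (e₃.trans e₁.symm), ae_ae_right e₂,
      ae_restrict_mem measurableSet_Ioo] with y h3 h1 h2 hy x hx
    refine (h3.abs_le hab hx).trans ?_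
    have i1 := s₁.integral_abs_le hcd (hf.congr e₁.symm) hfy (Ioo_subset_Icc_self hy)
    have i2 := s₂.integral_abs_le hcd (hfx.congr e₂.symm) hfxy (Ioo_subset_Icc_self hy)
    have j1 : ∫ z in box a b c d, |F₁ z| = ∫ z in box a b c d, |f z| :=
      integral_congr_ae (by filter_upwards [e₁] with z hz; rw [hz])
    have j2 : ∫ z in box a b c d, |F₂ z| = ∫ z in box a b c d, |fx z| :=
      integral_congr_ae (by filter_upwards [e₂] with z hz; rw [hz])
    have j3 : ∫ x in Ioo a b, |F₃ (x, y)| = ∫ x in Ioo a b, |F₁ (x, y)| :=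
      integral_congr_ae (by filter_upwards [h1] with z hz; rw [hz])
    have j4 : ∫ x in Ioo a b, |fx (x, y)| = ∫ x in Ioo a b, |F₂ (x, y)| :=
      integral_congr_ae (by filter_upwards [h2] with z hz; rw [hz])
    rw [j1] at i1
    rw [j2] at i2
    rw [j3, j4]
    have : 0 < (b - a)⁻¹ := inv_pos.2 (sub_pos.2 hab)
    gcongr
  filter_upwards [ae_box_snd key, e₃, hWf, ae_restrict_mem (measurableSet_box a b c d)] with z h1 h2 h3 h4
  rw [← h3, ← h2]
  exact h1 z.1 (Ioo_subset_Icc_self h4.1)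

/-! ### Square-integrable functions -/

lemma integrable_mul_L2 {Ω : Set (ℝ × ℝ)} (f g : L2 Ω) :
    Integrable (fun z => f z * g z) (volume.restrict Ω) :=
  MemLp.integrable_mul (p := 2) (q := 2) (Lp.memLp f) (Lp.memLp g)

lemma inner_L2 {Ω : Set (ℝ × ℝ)} (f g : L2 Ω) : inner ℝ f g = ∫ z in Ω, f z * g z := by
  rw [L2.inner_def]
  refine integral_congr_ae (ae_of_all _ fun z => ?_)
  simp [mul_comm]

lemma norm_sq_L2 {Ω : Set (ℝ × ℝ)} (f : L2 Ω) : ‖f‖ ^ 2 = ∫ z in Ω, f z ^ 2 := by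
  rw [← real_inner_self_eq_norm_sq, inner_L2]
  simp only [sq]

lemma integral_abs_mul_le_L2 {Ω : Set (ℝ × ℝ)} (f g : L2 Ω) :
    ∫ z in Ω, |f z * g z| ≤ ‖f‖ * ‖g‖ := by
  have h := real_inner_le_norm |f| |g|
  rw [inner_L2, norm_abs_eq_norm, norm_abs_eq_norm] at h
  refine le_of_eq_of_le (integral_congr_ae ?_) h
  filter_upwards [Lp.coeFn_abs f, Lp.coeFn_abs g] with z h1 h2
  rw [h1, h2, abs_mul]

lemma integrable_L2_box {a b c d : ℝ} (f : L2 (box a b c d)) : IntegrableOn f (box a b c d) :=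
  (Lp.memLp f).integrable (by norm_num)

lemma exists_integral_abs_le (a b c d : ℝ) : ∃ C : ℝ, 0 < C ∧ ∀ f : L2 (box a b c d),
    ∫ z in box a b c d, |f z| ≤ C * ‖f‖ := by
  have h1 : MemLp (fun _ : ℝ × ℝ => (1 : ℝ)) 2 (volume.restrict (box a b c d)) := memLp_const 1
  -- Cauchy–Schwarz against the constant 1. The extra `+ 1` keeps the constant positive even when
  -- the box is empty.
  refine ⟨‖h1.toLp _‖ + 1, by positivity, fun f => ?_⟩
  have h := integral_abs_mul_le_L2 (h1.toLp _) f
  have e : ∫ z in box a b c d, |f z| = ∫ z in box a b c d, |h1.toLp _ z * f z| := by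
    refine integral_congr_ae ?_
    filter_upwards [h1.coeFn_toLp] with z hz
    rw [hz, one_mul]
  rw [e]
  nlinarith [norm_nonneg f]

lemma continuous_integral_mul {Ω : Set (ℝ × ℝ)} {η : ℝ × ℝ → ℝ}
    (h : ContDiff ℝ ∞ η ∧ HasCompactSupport η) :
    Continuous fun f : L2 Ω => ∫ z in Ω, f z * η z := by
  have h1 : MemLp η 2 (volume.restrict Ω) := h.1.continuous.memLp_of_hasCompactSupport h.2
  have : (fun f : L2 Ω => ∫ z in Ω, f z * η z) = fun f => inner ℝ f (h1.toLp η) := by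
    ext f
    rw [inner_L2]
    refine integral_congr_ae ?_
    filter_upwards [h1.coeFn_toLp] with z hz
    rw [hz]
  rw [this]
  fun_prop

/-! ### The components of an element of `H³` -/

lemma mem_multiIndices {i j : ℕ} (h : i + j ≤ 3) : (i, j) ∈ multiIndices 3 := by
  simp only [multiIndices, Finset.mem_filter, Finset.mem_product, Finset.mem_range]
  omega

/-- The weak derivative `∂ₓ^i ∂ᵧ^j` on `H³(Ω)`. -/
def comp {Ω : Set (ℝ × ℝ)} (i j : ℕ) (h : i + j ≤ 3 := by decide) : H3 Ω →L[ℝ] L2 Ω :=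
  (PiLp.proj 2 (fun _ : multiIndices 3 => L2 Ω) ⟨(i, j), mem_multiIndices h⟩).comp
    (sobolevThree Ω).subtypeL

lemma norm_comp_le {Ω : Set (ℝ × ℝ)} (i j : ℕ) (h : i + j ≤ 3) (u : H3 Ω) :
    ‖comp i j h u‖ ≤ ‖u‖ :=
  PiLp.norm_apply_le (p := 2) u.1 ⟨(i, j), mem_multiIndices h⟩

/-- For each test function the weak-derivative identity equates two continuous functionals of the
jet. Closedness gives the completeness of H³. -/
lemma isClosed_sobolevThree (Ω : Set (ℝ × ℝ)) : IsClosed (sobolevThree Ω : Set (Jet Ω)) := by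
  have : (sobolevThree Ω : Set (Jet Ω)) = ⋂ m : multiIndices 3, ⋂ η : ℝ × ℝ → ℝ,
      ⋂ _ : IsTest Ω η, {u : Jet Ω | ∫ z in Ω, u ⟨(0, 0), by decide⟩ z * iterPd m η z =
        (-1) ^ (m.1.1 + m.1.2) * ∫ z in Ω, u m z * η z} := by
    ext u
    simp only [mem_iInter]
    rfl
  rw [this]
  refine isClosed_iInter fun m => isClosed_iInter fun η => isClosed_iInter fun hη => ?_
  have hs : ContDiff ℝ ∞ η ∧ HasCompactSupport η := ⟨hη.1, hη.2.1⟩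
  refine isClosed_eq ?_ ?_
  · exact (continuous_integral_mul (smooth_iterPd m hs)).comp (PiLp.continuous_apply 2 _ _)
  · exact continuous_const.mul ((continuous_integral_mul hs).comp
      (PiLp.continuous_apply 2 (fun _ : multiIndices 3 => L2 Ω) m))

instance (Ω : Set (ℝ × ℝ)) : CompleteSpace (H3 Ω) :=
  (isClosed_sobolevThree Ω).completeSpace_coe

lemma pd_comm {η : ℝ × ℝ → ℝ} (h : ContDiff ℝ ∞ η) (v w : ℝ × ℝ) :
    pd v (pd w η) = pd w (pd v η) := by
  have hd : ∀ z, DifferentiableAt ℝ (fderiv ℝ η) z := fun z =>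
    ((h.fderiv_right (m := ∞) (by simp)).differentiable (by simp)).differentiableAt
  have e : ∀ v w z, pd v (pd w η) z = fderiv ℝ (fderiv ℝ η) z v w := by
    intro v w z
    have : pd w η = fun z => fderiv ℝ η z w := rfl
    rw [pd, this, fderiv_clm_apply (hd z) (differentiableAt_const w)]
    simp
  ext z
  rw [e, e]
  have hsymm : IsSymmSndFDerivAt ℝ η z := h.contDiffAt.isSymmSndFDerivAt (by
    rw [minSmoothness_of_isRCLikeNormedField]; exact ENat.LEInfty.out)
  exact hsymm.eq v w

lemma pd_iterate_comm {η : ℝ × ℝ → ℝ} (h : ContDiff ℝ ∞ η ∧ HasCompactSupport η) (v w : ℝ × ℝ)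
    (n : ℕ) : pd v ((pd w)^[n] η) = (pd w)^[n] (pd v η) := by
  induction n with
  | zero => rfl
  | succ n ih =>
    rw [Function.iterate_succ_apply', Function.iterate_succ_apply',
      pd_comm (smooth_iterate w n h).1, ih]

lemma isTest_pd {Ω : Set (ℝ × ℝ)} {η : ℝ × ℝ → ℝ} (h : IsTest Ω η) (v : ℝ × ℝ) :
    IsTest Ω (pd v η) := by
  have h1 := smooth_pd v (⟨h.1, h.2.1⟩ : ContDiff ℝ ∞ η ∧ HasCompactSupport η)
  exact ⟨h1.1, h1.2, (tsupport_fderiv_apply_subset ℝ v).trans h.2.2⟩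

lemma weak_comp {Ω : Set (ℝ × ℝ)} (i j : ℕ) (h : i + j ≤ 3) (u : H3 Ω) :
    IsWeakDeriv Ω (i, j) (comp 0 0 (by decide) u) (comp i j h u) :=
  u.2 ⟨(i, j), mem_multiIndices h⟩

/-- The definition relates every component only to the function itself. Testing with ∂ₓη, which
commutes with the other partial derivatives, links consecutive components. -/
lemma weak_comp_x {Ω : Set (ℝ × ℝ)} (i j : ℕ) (h : i + j ≤ 3) (h' : i + 1 + j ≤ 3) (u : H3 Ω)
    {η : ℝ × ℝ → ℝ} (hη : IsTest Ω η) : ∫ z in Ω, comp i j h u z * pd (1, 0) η z =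
      -∫ z in Ω, comp (i + 1) j h' u z * η z := by
  have h1 := weak_comp i j h u _ (isTest_pd hη (1, 0))
  have h2 := weak_comp (i + 1) j h' u _ hη
  have e : iterPd (i, j) (pd (1, 0) η) = iterPd (i + 1, j) η := by
    simp only [iterPd, Function.iterate_succ_apply]
    rw [pd_iterate_comm ⟨hη.1, hη.2.1⟩]
  rw [e, h2] at h1
  have h3 : ((-1 : ℝ) ^ (i + j)) ≠ 0 := by positivity
  have h4 : (-1 : ℝ) ^ (i + 1 + j) = -(-1) ^ (i + j) := by ring
  simp only [h4] at h1
  refine mul_left_cancel₀ h3 ?_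
  linarith

lemma weak_comp_y {Ω : Set (ℝ × ℝ)} (i j : ℕ) (h : i + j ≤ 3) (h' : i + (j + 1) ≤ 3) (u : H3 Ω)
    {η : ℝ × ℝ → ℝ} (hη : IsTest Ω η) : ∫ z in Ω, comp i j h u z * pd (0, 1) η z =
      -∫ z in Ω, comp i (j + 1) h' u z * η z := by
  have h1 := weak_comp i j h u _ (isTest_pd hη (0, 1))
  have h2 := weak_comp i (j + 1) h' u _ hη
  have e : iterPd (i, j) (pd (0, 1) η) = iterPd (i, j + 1) η := by
    simp only [iterPd, Function.iterate_succ_apply]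
  rw [e, h2] at h1
  have h3 : ((-1 : ℝ) ^ (i + j)) ≠ 0 := by positivity
  have h4 : (-1 : ℝ) ^ (i + (j + 1)) = -(-1) ^ (i + j) := by ring
  simp only [h4] at h1
  refine mul_left_cancel₀ h3 ?_
  linarith

lemma exists_sliceX_comp {a b c d : ℝ} (hab : a < b) (i j : ℕ) (h : i + j ≤ 3)
    (h' : i + 1 + j ≤ 3) (u : H3 (box a b c d)) :
    ∃ F, F =ᵐ[volume.restrict (box a b c d)] comp i j h u ∧
      SliceX a b c d F (comp (i + 1) j h' u) :=
  exists_sliceX_of_weak hab (integrable_L2_box _) (integrable_L2_box _) (Lp.stronglyMeasurable _)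
    fun _ hη => weak_comp_x i j h h' u hη

lemma exists_sliceY_comp {a b c d : ℝ} (hcd : c < d) (i j : ℕ) (h : i + j ≤ 3)
    (h' : i + (j + 1) ≤ 3) (u : H3 (box a b c d)) :
    ∃ F, F =ᵐ[volume.restrict (box a b c d)] comp i j h u ∧
      SliceY a b c d F (comp i (j + 1) h' u) :=
  exists_sliceY_of_weak hcd (integrable_L2_box _) (integrable_L2_box _) (Lp.stronglyMeasurable _)
    fun _ hη => weak_comp_y i j h h' u hη

/-- Sobolev embedding: derivatives of order at most one of elements of `H³` of a box are continuous
up to the boundary. -/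
theorem exists_rep {a b c d : ℝ} (hab : a < b) (hcd : c < d) (i j : ℕ) (h : i + 1 + (j + 1) ≤ 3)
    (h' : i + j ≤ 3) (u : H3 (box a b c d)) :
    ∃ W, ContinuousOn W (Icc a b ×ˢ Icc c d) ∧
      comp i j h' u =ᵐ[volume.restrict (box a b c d)] W :=
  exists_continuous_rep hab hcd (integrable_L2_box _) (integrable_L2_box _) (integrable_L2_box _)
    (Lp.stronglyMeasurable _) (exists_sliceY_comp hcd i j h' (by omega) u)
    (exists_sliceX_comp hab i (j + 1) (by omega) h u)
    (exists_sliceX_comp hab i j h' (by omega) u)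

theorem exists_abs_rep_le {a b c d : ℝ} (hab : a < b) (hcd : c < d) : ∃ C : ℝ, 0 < C ∧
    ∀ (i j : ℕ) (_ : i + 1 + (j + 1) ≤ 3) (h' : i + j ≤ 3) (u : H3 (box a b c d)) (W : ℝ × ℝ → ℝ),
      ContinuousOn W (Icc a b ×ˢ Icc c d) → comp i j h' u =ᵐ[volume.restrict (box a b c d)] W →
      ∀ z ∈ Icc a b ×ˢ Icc c d, |W z| ≤ C * ‖u‖ := by
  obtain ⟨C, hC, hCb⟩ := exists_integral_abs_le a b c d
  have p1 : 0 < (b - a)⁻¹ := inv_pos.2 (sub_pos.2 hab)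
  have p2 : 0 < (d - c)⁻¹ := inv_pos.2 (sub_pos.2 hcd)
  refine ⟨(b - a)⁻¹ * ((d - c)⁻¹ * C + C) + ((d - c)⁻¹ * C + C), by positivity,
    fun i j h h' u W hW hWu z hz => ?_⟩
  have := abs_le_of_slices hab hcd (integrable_L2_box _) (integrable_L2_box _)
    (integrable_L2_box _) (integrable_L2_box _) (exists_sliceY_comp hcd i j h' (by omega) u)
    (exists_sliceY_comp hcd (i + 1) j (by omega) h u)
    (exists_sliceX_comp hab i j h' (by omega) u) hW hWu hz
  refine this.trans ?_
  have hn : ∀ (k l : ℕ) (hkl : k + l ≤ 3),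
      ∫ z in box a b c d, |comp k l hkl u z| ≤ C * ‖u‖ := fun k l hkl =>
    (hCb _).trans (mul_le_mul_of_nonneg_left (norm_comp_le k l hkl u) hC.le)
  calc _ ≤ (b - a)⁻¹ * ((d - c)⁻¹ * (C * ‖u‖) + C * ‖u‖) +
        ((d - c)⁻¹ * (C * ‖u‖) + C * ‖u‖) := by gcongr <;> apply hn
    _ = _ := by ring

/-! ### Boundary values -/

/-- The difference of two continuous representatives represents `u - v`, so the sup bound applies to
it. With `u = v` this is uniqueness of traces; in general it makes boundary conditions stable under
H³ limits. -/
lemma abs_trace_sub_le {a b c d : ℝ} (hab : a < b) (hcd : c < d) : ∃ C : ℝ, 0 < C ∧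
    ∀ (i j : ℕ) (_ : i + 1 + (j + 1) ≤ 3) (h' : i + j ≤ 3) (S : Set (ℝ × ℝ)),
      S ⊆ closure (box a b c d) → ∀ (u v : H3 (box a b c d)) (g k : ℝ × ℝ → ℝ),
      HasTrace (comp i j h' u) S g → HasTrace (comp i j h' v) S k →
      ∀ z ∈ S, |g z - k z| ≤ C * ‖u - v‖ := by
  obtain ⟨C, hC, h⟩ := exists_abs_rep_le (a := a) (b := b) (c := c) (d := d) hab hcd
  refine ⟨C, hC, fun i j hij hij' S hS u v g k ⟨w, cw, ew, hw⟩ ⟨w', cw', ew', hw'⟩ z hz => ?_⟩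
  rw [← hw z hz, ← hw' z hz]
  have hS' := hS hz
  rw [closure_box hab hcd] at hS' cw cw'
  refine h i j hij hij' (u - v) (fun z => w z - w' z) (cw.sub cw') ?_ z hS'
  rw [map_sub]
  filter_upwards [Lp.coeFn_sub (comp i j hij' u) (comp i j hij' v), ew, ew'] with z h1 h2 h3
  rw [h1, Pi.sub_apply, h2, h3]

lemma exists_hasTrace {a b c d : ℝ} (hab : a < b) (hcd : c < d) (i j : ℕ)
    (h : i + 1 + (j + 1) ≤ 3) (h' : i + j ≤ 3) (S : Set (ℝ × ℝ)) (u : H3 (box a b c d)) :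
    ∃ g, HasTrace (comp i j h' u) S g := by
  obtain ⟨W, hW, e⟩ := exists_rep hab hcd i j h h' u
  exact ⟨W, W, by rwa [closure_box hab hcd], e, fun _ _ => rfl⟩

lemma HasTrace.congr {Ω : Set (ℝ × ℝ)} {f : L2 Ω} {S : Set (ℝ × ℝ)} {g k : ℝ × ℝ → ℝ}
    (h : HasTrace f S g) (hgk : EqOn g k S) : HasTrace f S k := by
  obtain ⟨w, cw, ew, hw⟩ := h
  exact ⟨w, cw, ew, fun z hz => (hw z hz).trans (hgk hz)⟩

/-- A prescribed boundary value is a closed condition in `H³`. -/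
lemma isClosed_hasTrace {a b c d : ℝ} (hab : a < b) (hcd : c < d) (i j : ℕ)
    (h : i + 1 + (j + 1) ≤ 3) (h' : i + j ≤ 3) {S : Set (ℝ × ℝ)} (hS : S ⊆ closure (box a b c d))
    (g : ℝ × ℝ → ℝ) : IsClosed {u : H3 (box a b c d) | HasTrace (comp i j h' u) S g} := by
  obtain ⟨C, hC, hb⟩ := abs_trace_sub_le (a := a) (b := b) (c := c) (d := d) hab hcd
  refine isClosed_of_closure_subset fun u hu => ?_
  obtain ⟨k, hk⟩ := exists_hasTrace hab hcd i j h h' S u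
  refine hk.congr fun z hz => ?_
  refine sub_eq_zero.1 (abs_eq_zero.1 (le_antisymm (le_of_forall_pos_le_add fun δ hδ => ?_)
    (abs_nonneg _)))
  obtain ⟨v, hv, huv⟩ := Metric.mem_closure_iff.1 hu (δ / C) (by positivity)
  have := hb i j h h' S hS u v k g hk hv z hz
  rw [dist_eq_norm, lt_div_iff₀ hC] at huv
  linarith

lemma HasTrace.combine {Ω : Set (ℝ × ℝ)} {f k : L2 Ω} {S : Set (ℝ × ℝ)} {g l : ℝ × ℝ → ℝ}
    (s t : ℝ) (hf : HasTrace f S g) (hk : HasTrace k S l) :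
    HasTrace (s • f + t • k) S (fun z => s * g z + t * l z) := by
  obtain ⟨w, cw, ew, hw⟩ := hf
  obtain ⟨w', cw', ew', hw'⟩ := hk
  refine ⟨s • w + t • w', (cw.const_smul s).add (cw'.const_smul t), ?_, fun z hz => by
    simp [hw z hz, hw' z hz]⟩
  exact (Lp.coeFn_add _ _).trans (((Lp.coeFn_smul s f).trans (ew.const_smul s)).add
    ((Lp.coeFn_smul t k).trans (ew'.const_smul t)))

/-! ### Slices of functions with vanishing boundary values -/

lemma prim_trace' {a b c d : ℝ} (hcd : c < d) {F G f g : ℝ × ℝ → ℝ}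
    (hf : IntegrableOn f (box a b c d)) (hg : IntegrableOn g (box a b c d))
    (hm : StronglyMeasurable g) (cF : ContinuousOn F (Icc a b ×ˢ Icc c d))
    (sF : SliceX a b c d F f) (eG : G =ᵐ[volume.restrict (box a b c d)] f)
    (sG : SliceY a b c d G g) {y : ℝ} (hy : y ∈ Icc c d) (hab : a ≤ b) :
    Prim a b (fun x => F (x, y)) (fun x => G (x, y)) :=
  prim_trace (F := F ∘ Prod.swap) (G := G ∘ Prod.swap) hcd (integrableOn_box_swap hf)
    (integrableOn_box_swap hg) (hm.comp_measurable measurable_swap)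
    (cF.comp continuous_swap.continuousOn fun _ hz => ⟨hz.2, hz.1⟩) sF (ae_box_swap eG) sG hy hab

/-- Zero Dirichlet data on the boundary and zero Neumann data on the right side. -/
def ZeroTraces (a b c d : ℝ) (h : H3 (box a b c d)) : Prop :=
  HasTrace (val h) (frontier (box a b c d)) 0 ∧ HasTrace (dx h) ({b} ×ˢ Ioo c d) 0

/-- Representatives of `h`, `∂ₓh`, `∂ᵧh`, `∂ᵧ²h` and `∂ₓ∂ᵧh` that are primitives on slices, with
their boundary values. -/
structure SliceReps (a b c d : ℝ) (h : H3 (box a b c d)) (H Hx Hy Q P : ℝ × ℝ → ℝ) : Prop where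
  eH : H =ᵐ[volume.restrict (box a b c d)] comp 0 0 (by decide) h
  eHx : Hx =ᵐ[volume.restrict (box a b c d)] comp 1 0 (by decide) h
  eHy : Hy =ᵐ[volume.restrict (box a b c d)] comp 0 1 (by decide) h
  eQ : Q =ᵐ[volume.restrict (box a b c d)] comp 0 2 (by decide) h
  eP : P =ᵐ[volume.restrict (box a b c d)] comp 1 1 (by decide) h
  xH : SliceX a b c d H (comp 1 0 (by decide) h)
  xHx : SliceX a b c d Hx (comp 2 0 (by decide) h)
  xHy : SliceX a b c d Hy (comp 1 1 (by decide) h)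
  xQ : SliceX a b c d Q (comp 1 2 (by decide) h)
  yH : SliceY a b c d H (comp 0 1 (by decide) h)
  yHx : SliceY a b c d Hx (comp 1 1 (by decide) h)
  yHy : SliceY a b c d Hy (comp 0 2 (by decide) h)
  yP : SliceY a b c d P (comp 1 2 (by decide) h)
  sides : ∀ᵐ y ∂volume.restrict (Ioo c d), H (a, y) = 0 ∧ H (b, y) = 0 ∧ Hx (b, y) = 0 ∧
    Hy (a, y) = 0 ∧ Hy (b, y) = 0 ∧ Q (a, y) = 0
  bases : ∀ᵐ x ∂volume.restrict (Ioo a b), H (x, c) = 0 ∧ H (x, d) = 0 ∧ Hx (x, c) = 0 ∧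
    Hx (x, d) = 0

lemma frontier_box {a b c d : ℝ} (hab : a < b) (hcd : c < d) :
    frontier (box a b c d) = (Icc a b ×ˢ Icc c d) \ box a b c d := by
  rw [(isOpen_Ioo.prod isOpen_Ioo).frontier_eq, closure_box hab hcd]

/-- Zero Dirichlet data make the tangential derivatives vanish along each side, because by
`prim_trace` the traces of the derivatives are the derivatives of the traces. On the left side ∂ᵧ²h
vanishes as well. The normal derivative vanishes only on the right side. -/
theorem ZeroTraces.exists_sliceReps {a b c d : ℝ} (hab : a < b) (hcd : c < d)
    {h : H3 (box a b c d)} (h0 : ZeroTraces a b c d h) :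
    ∃ H Hx Hy Q P, SliceReps a b c d h H Hx Hy Q P := by
  obtain ⟨⟨H, cH, eH, zH⟩, ⟨Hx, cHx, eHx, zHx⟩⟩ := h0
  rw [closure_box hab hcd] at cH cHx
  rw [frontier_box hab hcd] at zH
  obtain ⟨Hy, cHy, eHy⟩ := exists_rep hab hcd 0 1 (by decide) (by decide) h
  obtain ⟨Q, eQ, xQ⟩ := exists_sliceX_comp hab 0 2 (by decide) (by decide) h
  obtain ⟨P, eP, yP⟩ := exists_sliceY_comp hcd 1 1 (by decide) (by decide) h
  have X : ∀ {W : ℝ × ℝ → ℝ} (i j : ℕ) (h₁ : i + j ≤ 3) (h₂ : i + 1 + j ≤ 3),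
      ContinuousOn W (Icc a b ×ˢ Icc c d) →
      comp i j h₁ h =ᵐ[volume.restrict (box a b c d)] W → SliceX a b c d W (comp (i + 1) j h₂ h) := by
    intro W i j h₁ h₂ cW eW
    obtain ⟨F, eF, sF⟩ := exists_sliceX_comp hab i j h₁ h₂ h
    exact sF.of_ae_eq hab cW (eF.trans eW)
  have Y : ∀ {W : ℝ × ℝ → ℝ} (i j : ℕ) (h₁ : i + j ≤ 3) (h₂ : i + (j + 1) ≤ 3),
      ContinuousOn W (Icc a b ×ˢ Icc c d) →
      comp i j h₁ h =ᵐ[volume.restrict (box a b c d)] W → SliceY a b c d W (comp i (j + 1) h₂ h) := by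
    intro W i j h₁ h₂ cW eW
    obtain ⟨F, eF, sF⟩ := exists_sliceY_comp hcd i j h₁ h₂ h
    exact sF.of_ae_eq hcd cW (eF.trans eW)
  have xHy := X 0 1 (by decide) (by decide) cHy eHy
  have yHx := Y 1 0 (by decide) (by decide) cHx eHx
  have xH := X 0 0 (by decide) (by decide) cH eH
  have yH := Y 0 0 (by decide) (by decide) cH eH
  have yHy := Y 0 1 (by decide) (by decide) cHy eHy
  have la : a ∈ Icc a b := left_mem_Icc.2 hab.le
  have lb : b ∈ Icc a b := right_mem_Icc.2 hab.le
  have lc : c ∈ Icc c d := left_mem_Icc.2 hcd.le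
  have ld : d ∈ Icc c d := right_mem_Icc.2 hcd.le
  have Ha : ∀ y ∈ Icc c d, H (a, y) = 0 := fun y hy =>
    zH _ ⟨⟨la, hy⟩, fun hz => lt_irrefl _ hz.1.1⟩
  have Hb : ∀ y ∈ Icc c d, H (b, y) = 0 := fun y hy =>
    zH _ ⟨⟨lb, hy⟩, fun hz => lt_irrefl _ hz.1.2⟩
  have Hc : ∀ x ∈ Icc a b, H (x, c) = 0 := fun x hx =>
    zH _ ⟨⟨hx, lc⟩, fun hz => lt_irrefl _ hz.2.1⟩
  have Hd : ∀ x ∈ Icc a b, H (x, d) = 0 := fun x hx =>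
    zH _ ⟨⟨hx, ld⟩, fun hz => lt_irrefl _ hz.2.2⟩
  have PY : ∀ x ∈ Icc a b, Prim c d (fun y => H (x, y)) (fun y => Hy (x, y)) := fun x hx =>
    prim_trace hab (integrable_L2_box _) (integrable_L2_box _) (Lp.stronglyMeasurable _) cH yH
      eHy.symm xHy hx hcd.le
  have PX : ∀ y ∈ Icc c d, Prim a b (fun x => H (x, y)) (fun x => Hx (x, y)) := fun y hy =>
    prim_trace' hcd (integrable_L2_box _) (integrable_L2_box _) (Lp.stronglyMeasurable _) cH xH
      eHx.symm yHx hy hab.le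
  have Hya := (PY a la).ae_eq_zero hcd.le Ha
  have PQ : Prim c d (fun y => Hy (a, y)) (fun y => Q (a, y)) :=
    prim_trace hab (integrable_L2_box _) (integrable_L2_box _) (Lp.stronglyMeasurable _) cHy yHy
      eQ xQ la hcd.le
  -- By continuity ∂ᵧh vanishes everywhere on the left side, not merely almost everywhere, so the
  -- argument can be repeated one order higher.
  have Hya' : EqOn (fun y => Hy (a, y)) (fun _ => 0) (Icc c d) :=
    eqOn_Icc_of_ae_eq hcd (cHy.comp (by fun_prop) fun y hy => ⟨la, hy⟩) continuousOn_const Hya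
  refine ⟨H, Hx, Hy, Q, P, eH.symm, eHx.symm, eHy.symm, eQ, eP, xH,
    X 1 0 (by decide) (by decide) cHx eHx, xHy, xQ, yH, yHx, yHy, yP, ?_, ?_⟩
  · filter_upwards [Hya, (PY b lb).ae_eq_zero hcd.le Hb, PQ.ae_eq_zero hcd.le Hya',
      ae_restrict_mem measurableSet_Ioo] with y h1 h2 h3 hy
    have hy' := Ioo_subset_Icc_self hy
    exact ⟨Ha y hy', Hb y hy', zHx _ ⟨rfl, hy⟩, h1, h2, h3⟩
  · filter_upwards [(PX c lc).ae_eq_zero hab.le Hc, (PX d ld).ae_eq_zero hab.le Hd,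
      ae_restrict_mem measurableSet_Ioo] with x h1 h2 hx
    have hx' := Ioo_subset_Icc_self hx
    exact ⟨Hc x hx', Hd x hx', h1, h2⟩

/-! ### Weighted integration by parts -/

lemma integrableOn_mul_weight {a b c d : ℝ} {f : ℝ × ℝ → ℝ} (hf : IntegrableOn f (box a b c d))
    {p : ℝ → ℝ} (hp : Continuous p) : IntegrableOn (fun z => f z * p z.1) (box a b c d) := by
  obtain ⟨C, hC⟩ := isCompact_Icc.exists_bound_of_continuousOn (s := Icc a b) hp.continuousOn
  refine Integrable.mul_bdd (c := C) hf (hp.comp continuous_fst).aestronglyMeasurable ?_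
  filter_upwards [ae_restrict_mem (measurableSet_box a b c d)] with z hz
  exact hC z.1 (Ioo_subset_Icc_self hz.1)

lemma integrableOn_mul_L2_weight {a b c d : ℝ} (f g : L2 (box a b c d)) {p : ℝ → ℝ}
    (hp : Continuous p) : IntegrableOn (fun z => f z * g z * p z.1) (box a b c d) :=
  integrableOn_mul_weight (integrable_mul_L2 f g) hp

/-- Integration by parts in `x` for members of `L²` with slice representatives. -/
lemma integral_parts_x {a b c d : ℝ} (hab : a ≤ b) {f g f' g' : L2 (box a b c d)}
    {F G : ℝ × ℝ → ℝ} (eF : F =ᵐ[volume.restrict (box a b c d)] f)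
    (eG : G =ᵐ[volume.restrict (box a b c d)] g) (sF : SliceX a b c d F f')
    (sG : SliceX a b c d G g') {p p' : ℝ → ℝ} (hp : ∀ x, HasDerivAt p (p' x) x)
    (hp' : Continuous p') :
    ∫ z in box a b c d, (f' z * g z * p z.1 + f z * g' z * p z.1 + f z * g z * p' z.1) =
      ∫ y in Ioo c d, (F (b, y) * G (b, y) * p b - F (a, y) * G (a, y) * p a) := by
  have cp : Continuous p := continuous_iff_continuousAt.2 fun x => (hp x).continuousAt
  refine SliceX.integral (F := fun z => F z * G z * p z.1) hab ?_ ?_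
  · refine ((sF.mul hab sG).mul hab (sliceX_weight a b c d hp hp')).congr_deriv hab ?_
    filter_upwards [eF, eG] with z h1 h2
    rw [h1, h2]
    ring
  · exact ((integrableOn_mul_L2_weight _ _ cp).add (integrableOn_mul_L2_weight _ _ cp)).add
      (integrableOn_mul_L2_weight _ _ hp')

/-- Integration by parts in `y`, with a weight depending on `x`. -/
lemma integral_parts_y {a b c d : ℝ} (hcd : c ≤ d) {f g f' g' : L2 (box a b c d)}
    {F G : ℝ × ℝ → ℝ} (eF : F =ᵐ[volume.restrict (box a b c d)] f)
    (eG : G =ᵐ[volume.restrict (box a b c d)] g) (sF : SliceY a b c d F f')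
    (sG : SliceY a b c d G g') {p : ℝ → ℝ} (cp : Continuous p) :
    ∫ z in box a b c d, (f' z * g z * p z.1 + f z * g' z * p z.1) =
      ∫ x in Ioo a b, (F (x, d) * G (x, d) * p x - F (x, c) * G (x, c) * p x) := by
  refine SliceY.integral (F := fun z => F z * G z * p z.1) hcd ?_ ?_
  · refine ((sF.mul hcd sG).mul hcd (sliceY_weight a b c d p)).congr_deriv hcd ?_
    filter_upwards [eF, eG] with z h1 h2
    rw [h1, h2]
    ring
  · exact (integrableOn_mul_L2_weight _ _ cp).add (integrableOn_mul_L2_weight _ _ cp)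

section Identities

variable {a b c d : ℝ} {h : H3 (box a b c d)} {p p' : ℝ → ℝ}

/-- The integrand is the x-derivative of p(∂ₓh)². Nothing is prescribed for ∂ₓh on the left side,
but its contribution there, -p(a)(∂ₓh)², has a favourable sign. -/
lemma ZeroTraces.integral_xx_x_le (hab : a < b) (hcd : c < d) (h0 : ZeroTraces a b c d h)
    (hp : ∀ x, HasDerivAt p (p' x) x) (hp' : Continuous p') (pa : 0 ≤ p a) :
    ∫ z in box a b c d, (2 * (comp 2 0 (by decide) h z * comp 1 0 (by decide) h z * p z.1) +
      comp 1 0 (by decide) h z * comp 1 0 (by decide) h z * p' z.1) ≤ 0 := by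
  obtain ⟨H, Hx, Hy, Q, P, r⟩ := h0.exists_sliceReps hab hcd
  have := integral_parts_x hab.le r.eHx r.eHx r.xHx r.xHx hp hp'
  calc _ = _ := by congr 1; ext z; ring
    _ = _ := this
    _ ≤ 0 := integral_nonpos_of_ae (by
      filter_upwards [r.sides] with y hy
      have : 0 ≤ Hx (a, y) * Hx (a, y) * p a := mul_nonneg (mul_self_nonneg _) pa
      simp only [hy.2.2.1, Pi.zero_apply]
      linarith)

/-- Move one y-derivative off ∂ᵧ²h, then recognise 2 ∂ᵧh ∂ₓ∂ᵧh as ∂ₓ(∂ᵧh)². The boundary terms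
vanish since ∂ₓh = 0 on the bases and ∂ᵧh = 0 on the vertical sides. -/
lemma ZeroTraces.integral_yy_x (hab : a < b) (hcd : c < d) (h0 : ZeroTraces a b c d h)
    (hp : ∀ x, HasDerivAt p (p' x) x) (hp' : Continuous p') :
    ∫ z in box a b c d, (2 * (comp 0 2 (by decide) h z * comp 1 0 (by decide) h z * p z.1) -
      comp 0 1 (by decide) h z * comp 0 1 (by decide) h z * p' z.1) = 0 := by
  obtain ⟨H, Hx, Hy, Q, P, r⟩ := h0.exists_sliceReps hab hcd
  have cp : Continuous p := continuous_iff_continuousAt.2 fun x => (hp x).continuousAt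
  have h1 := integral_parts_x hab.le r.eHy r.eHy r.xHy r.xHy hp hp'
  have h2 := integral_parts_y hcd.le r.eHy r.eHx r.yHy r.yHx cp
  replace h1 := h1.trans
    (integral_eq_zero_of_ae (by filter_upwards [r.sides] with y hy; simp [hy]))
  replace h2 := h2.trans
    (integral_eq_zero_of_ae (by filter_upwards [r.bases] with y hy; simp [hy]))
  have i1 : ∀ i j k l hij hkl, IntegrableOn (fun z => comp i j hij h z * comp k l hkl h z * p z.1)
      (box a b c d) := fun _ _ _ _ _ _ => integrableOn_mul_L2_weight _ _ cp
  have i2 : ∀ i j k l hij hkl, IntegrableOn (fun z => comp i j hij h z * comp k l hkl h z * p' z.1)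
      (box a b c d) := fun _ _ _ _ _ _ => integrableOn_mul_L2_weight _ _ hp'
  have h3 := integral_sub (((i1 0 2 1 0 (by decide) (by decide)).add
    (i1 0 1 1 1 (by decide) (by decide))).const_mul 2) (((i1 1 1 0 1 (by decide) (by decide)).add
    (i1 0 1 1 1 (by decide) (by decide))).add (i2 0 1 0 1 (by decide) (by decide)))
  simp only [Pi.add_apply] at h3
  rw [integral_const_mul, h1, h2] at h3
  rw [mul_zero, sub_zero] at h3
  rw [← h3]
  congr 1; ext z; ring

lemma ZeroTraces.integral_xx (hab : a < b) (hcd : c < d) (h0 : ZeroTraces a b c d h)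
    (hp : ∀ x, HasDerivAt p (p' x) x) (hp' : Continuous p') :
    ∫ z in box a b c d, (comp 2 0 (by decide) h z * comp 0 0 (by decide) h z * p z.1 +
      comp 1 0 (by decide) h z * comp 1 0 (by decide) h z * p z.1 +
      comp 1 0 (by decide) h z * comp 0 0 (by decide) h z * p' z.1) = 0 := by
  obtain ⟨H, Hx, Hy, Q, P, r⟩ := h0.exists_sliceReps hab hcd
  rw [integral_parts_x hab.le r.eHx r.eH r.xHx r.xH hp hp']
  exact integral_eq_zero_of_ae (by filter_upwards [r.sides] with y hy; simp [hy])

lemma ZeroTraces.integral_yy (hab : a < b) (hcd : c < d) (h0 : ZeroTraces a b c d h)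
    (cp : Continuous p) :
    ∫ z in box a b c d, (comp 0 2 (by decide) h z * comp 0 0 (by decide) h z * p z.1 +
      comp 0 1 (by decide) h z * comp 0 1 (by decide) h z * p z.1) = 0 := by
  obtain ⟨H, Hx, Hy, Q, P, r⟩ := h0.exists_sliceReps hab hcd
  rw [integral_parts_y hcd.le r.eHy r.eH r.yHy r.yH cp]
  exact integral_eq_zero_of_ae (by filter_upwards [r.bases] with y hy; simp [hy])

lemma ZeroTraces.integral_x (hab : a < b) (hcd : c < d) (h0 : ZeroTraces a b c d h)
    (hp : ∀ x, HasDerivAt p (p' x) x) (hp' : Continuous p') :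
    ∫ z in box a b c d, (2 * (comp 1 0 (by decide) h z * comp 0 0 (by decide) h z * p z.1) +
      comp 0 0 (by decide) h z * comp 0 0 (by decide) h z * p' z.1) = 0 := by
  obtain ⟨H, Hx, Hy, Q, P, r⟩ := h0.exists_sliceReps hab hcd
  have := integral_parts_x hab.le r.eH r.eH r.xH r.xH hp hp'
  replace this := this.trans
    (integral_eq_zero_of_ae (by filter_upwards [r.sides] with y hy; simp [hy]))
  rw [← this]
  congr 1; ext z; ring

/-- Integrate ∂ᵧ²h ∂ₓh by parts in x and ∂ₓ∂ᵧh ∂ₓh by parts in y; the third derivative ∂ₓ∂ᵧ²h occurs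
in both and cancels. On the left side, where ∂ₓh is free, the boundary term dies because ∂ᵧ²h = 0.
-/
lemma ZeroTraces.integral_xx_yy (hab : a < b) (hcd : c < d) (h0 : ZeroTraces a b c d h)
    (hp : ∀ x, HasDerivAt p (p' x) x) (hp' : Continuous p') :
    ∫ z in box a b c d, (comp 0 2 (by decide) h z * comp 2 0 (by decide) h z * p z.1 +
      comp 0 2 (by decide) h z * comp 1 0 (by decide) h z * p' z.1 -
      comp 1 1 (by decide) h z * comp 1 1 (by decide) h z * p z.1) = 0 := by
  obtain ⟨H, Hx, Hy, Q, P, r⟩ := h0.exists_sliceReps hab hcd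
  have cp : Continuous p := continuous_iff_continuousAt.2 fun x => (hp x).continuousAt
  have h1 := integral_parts_x hab.le r.eQ r.eHx r.xQ r.xHx hp hp'
  have h2 := integral_parts_y hcd.le r.eP r.eHx r.yP r.yHx cp
  replace h1 := h1.trans
    (integral_eq_zero_of_ae (by filter_upwards [r.sides] with y hy; simp [hy]))
  replace h2 := h2.trans
    (integral_eq_zero_of_ae (by filter_upwards [r.bases] with y hy; simp [hy]))
  have i1 : ∀ i j k l hij hkl, IntegrableOn (fun z => comp i j hij h z * comp k l hkl h z * p z.1)
      (box a b c d) := fun _ _ _ _ _ _ => integrableOn_mul_L2_weight _ _ cp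
  have i2 : ∀ i j k l hij hkl, IntegrableOn (fun z => comp i j hij h z * comp k l hkl h z * p' z.1)
      (box a b c d) := fun _ _ _ _ _ _ => integrableOn_mul_L2_weight _ _ hp'
  have h3 := integral_sub (((i1 1 2 1 0 (by decide) (by decide)).add
    (i1 0 2 2 0 (by decide) (by decide))).add (i2 0 2 1 0 (by decide) (by decide)))
    ((i1 1 2 1 0 (by decide) (by decide)).add (i1 1 1 1 1 (by decide) (by decide)))
  simp only [Pi.add_apply] at h3
  rw [h1, h2, sub_zero] at h3
  rw [← h3]
  congr 1; ext z; ring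

end Identities

/-! ### The Carleman estimate -/

/-- The Carleman weight. -/
def weight (lam x : ℝ) : ℝ := Real.exp (2 * lam * x ^ 2)

lemma weight_pos (lam x : ℝ) : 0 < weight lam x := Real.exp_pos _

lemma continuous_weight (lam : ℝ) : Continuous (weight lam) := by
  unfold weight; fun_prop

/-- The derivative is kept as a factor times the same weight, so that the Carleman integrands differ
by a polynomial multiple of the weight. -/
lemma hasDerivAt_mul_weight (lam : ℝ) {g : ℝ → ℝ} {g' x : ℝ} (hg : HasDerivAt g g' x) :
    HasDerivAt (fun x => g x * weight lam x) ((g' + g x * (4 * lam * x)) * weight lam x) x := by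
  have h1 : HasDerivAt (weight lam) (weight lam x * (2 * lam * (2 * x))) x := by
    have := ((hasDerivAt_pow 2 x).const_mul (2 * lam)).exp
    exact this.congr_deriv (by simp [weight])
  refine (hg.mul h1).congr_deriv ?_
  ring

section Carleman

variable {a b c d lam : ℝ} {h : H3 (box a b c d)}

lemma integrableOn_comp_mul_weight (h : H3 (box a b c d)) (i j k l : ℕ) (hij : i + j ≤ 3)
    (hkl : k + l ≤ 3) {p : ℝ → ℝ} (hp : Continuous p) :
    IntegrableOn (fun z => comp i j hij h z * comp k l hkl h z * p z.1) (box a b c d) :=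
  integrableOn_mul_L2_weight _ _ hp

lemma integrableOn_laplacian_sq (h : H3 (box a b c d)) (lam : ℝ) :
    IntegrableOn (fun z => (comp 2 0 (by decide) h z + comp 0 2 (by decide) h z) ^ 2 *
      weight lam z.1) (box a b c d) := by
  have hw := continuous_weight lam
  refine (((integrableOn_comp_mul_weight h 2 0 2 0 (by decide) (by decide) hw).add
    ((integrableOn_comp_mul_weight h 2 0 0 2 (by decide) (by decide) hw).const_mul 2)).add
    (integrableOn_comp_mul_weight h 0 2 0 2 (by decide) (by decide) hw)).congr
    (ae_of_all _ fun z => ?_)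
  simp only [Pi.add_apply]
  ring

/-- The bracket collects the integrands of the five integration-by-parts identities, for multipliers
chosen so that the right side minus the left side is a sum of squares. Conjugation by exp(λx²)
splits the Laplacian into a symmetric and an antisymmetric part; the multipliers come from expanding
the product of the two parts and from testing the Laplacian with `h`. The constant 3 is 2 from the
splitting plus 1 from the square (D + 4λh)². -/
lemma carleman_pointwise {D hxx hyy hx hy h0 x w lam a : ℝ} (hD : D = hxx + hyy) (hw : 0 < w)
    (ha : 0 < a) (hx' : a < x) (hl : 1 ≤ lam) (hla : 1 ≤ lam * a ^ 2) :
    (lam * (hx ^ 2 + hy ^ 2) + lam ^ 3 * a ^ 2 * h0 ^ 2) * w ≤ 3 * (D ^ 2 * w) +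
      ((2 * (hxx * hx * (8 * lam * x * w)) +
        hx * hx * ((8 * lam + 8 * lam * x * (4 * lam * x)) * w)) +
      (2 * (hyy * hx * (8 * lam * x * w)) -
        hy * hy * ((8 * lam + 8 * lam * x * (4 * lam * x)) * w)) +
      2 * (hxx * h0 * ((16 * lam ^ 2 * x ^ 2 + 8 * lam) * w) +
        hx * hx * ((16 * lam ^ 2 * x ^ 2 + 8 * lam) * w) +
        hx * h0 * ((32 * lam ^ 2 * x + (16 * lam ^ 2 * x ^ 2 + 8 * lam) * (4 * lam * x)) * w)) +
      2 * (hyy * h0 * ((16 * lam ^ 2 * x ^ 2 + 8 * lam) * w) +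
        hy * hy * ((16 * lam ^ 2 * x ^ 2 + 8 * lam) * w)) +
      2 * (2 * (hx * h0 * ((8 * lam ^ 2 * x + 32 * lam ^ 3 * x ^ 3) * w)) +
        h0 * h0 * ((8 * lam ^ 2 + 96 * lam ^ 3 * x ^ 2 +
          (8 * lam ^ 2 * x + 32 * lam ^ 3 * x ^ 3) * (4 * lam * x)) * w))) := by
  set n := -2 * lam * (2 * x * hx + (4 * lam * x ^ 2 + 1) * h0) with hn
  set V := hx + 2 * lam * x * h0 with hV
  have hl0 : 0 < lam := by linarith
  have hxa : a ^ 2 ≤ x ^ 2 := by nlinarith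
  have hlx : 1 ≤ lam * x ^ 2 := hla.trans (by gcongr)
  have key : 0 ≤ w * (2 * (D - n) ^ 2 + (D + 4 * lam * h0) ^ 2 + 2 * n ^ 2 +
      (22 * lam * V ^ 2 + lam * (V + 2 * lam * x * h0) ^ 2 + 7 * lam * hy ^ 2 +
        16 * lam ^ 2 * h0 ^ 2 * (lam * x ^ 2 - 1) + lam ^ 3 * h0 ^ 2 * (x ^ 2 - a ^ 2) +
        7 * lam ^ 3 * x ^ 2 * h0 ^ 2)) := by
    have h1 : 0 ≤ lam * x ^ 2 - 1 := by linarith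
    have h2 : 0 ≤ x ^ 2 - a ^ 2 := by linarith
    positivity
  refine le_of_sub_nonneg (le_of_le_of_eq key ?_)
  rw [hn, hV, hD]
  ring

theorem ZeroTraces.carleman_first (ha : 0 < a) (hab : a < b) (hcd : c < d) (hl : 1 ≤ lam)
    (hla : 1 ≤ lam * a ^ 2) (h0 : ZeroTraces a b c d h) :
    ∫ z in box a b c d, (lam * (comp 1 0 (by decide) h z ^ 2 + comp 0 1 (by decide) h z ^ 2) +
      lam ^ 3 * a ^ 2 * comp 0 0 (by decide) h z ^ 2) * weight lam z.1 ≤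
    3 * ∫ z in box a b c d, (comp 2 0 (by decide) h z + comp 0 2 (by decide) h z) ^ 2 *
      weight lam z.1 := by
  have cw := continuous_weight lam
  have dp : ∀ x, HasDerivAt (fun x => 8 * lam * x * weight lam x)
      ((8 * lam + 8 * lam * x * (4 * lam * x)) * weight lam x) x := fun x =>
    hasDerivAt_mul_weight lam (((hasDerivAt_id x).const_mul (8 * lam)).congr_deriv (by ring))
  have dq : ∀ x, HasDerivAt (fun x => (16 * lam ^ 2 * x ^ 2 + 8 * lam) * weight lam x)
      ((32 * lam ^ 2 * x + (16 * lam ^ 2 * x ^ 2 + 8 * lam) * (4 * lam * x)) * weight lam x) x :=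
    fun x => hasDerivAt_mul_weight lam
      ((((hasDerivAt_pow 2 x).const_mul (16 * lam ^ 2)).add_const (8 * lam)).congr_deriv
        (by simp; ring))
  have ds : ∀ x, HasDerivAt (fun x => (8 * lam ^ 2 * x + 32 * lam ^ 3 * x ^ 3) * weight lam x)
      ((8 * lam ^ 2 + 96 * lam ^ 3 * x ^ 2 +
          (8 * lam ^ 2 * x + 32 * lam ^ 3 * x ^ 3) * (4 * lam * x)) * weight lam x) x :=
    fun x => hasDerivAt_mul_weight lam
      ((((hasDerivAt_id x).const_mul (8 * lam ^ 2)).add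
        ((hasDerivAt_pow 3 x).const_mul (32 * lam ^ 3))).congr_deriv (by simp; ring))
  have cp : Continuous fun x => 8 * lam * x * weight lam x := by fun_prop
  have cp' : Continuous fun x => (8 * lam + 8 * lam * x * (4 * lam * x)) * weight lam x := by
    fun_prop
  have cq : Continuous fun x => (16 * lam ^ 2 * x ^ 2 + 8 * lam) * weight lam x := by fun_prop
  have cq' : Continuous fun x => (32 * lam ^ 2 * x + (16 * lam ^ 2 * x ^ 2 + 8 * lam) *
      (4 * lam * x)) * weight lam x := by fun_prop
  have cs : Continuous fun x => (8 * lam ^ 2 * x + 32 * lam ^ 3 * x ^ 3) * weight lam x := by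
    fun_prop
  have cs' : Continuous fun x => (8 * lam ^ 2 + 96 * lam ^ 3 * x ^ 2 +
          (8 * lam ^ 2 * x + 32 * lam ^ 3 * x ^ 3) * (4 * lam * x)) * weight lam x := by fun_prop
  -- The only one of the five that is an inequality. Its multiplier 8λx is nonnegative on the left
  -- side since a > 0, which is where the position of the rectangle matters for the boundary terms.
  have I1 := h0.integral_xx_x_le hab hcd dp cp' (by have := weight_pos lam a; positivity)
  have I2 := h0.integral_yy_x hab hcd dp cp'
  have I3 := h0.integral_xx hab hcd dq cq'
  have I4 := h0.integral_yy hab hcd cq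
  have I5 := h0.integral_x hab hcd ds cs'
  have M := fun i j k l hij hkl (p : ℝ → ℝ) (hp : Continuous p) =>
    integrableOn_comp_mul_weight h i j k l hij hkl hp
  have i1 := ((M 2 0 1 0 (by decide) (by decide) _ cp).const_mul 2).add
    (M 1 0 1 0 (by decide) (by decide) _ cp')
  have i2 := ((M 0 2 1 0 (by decide) (by decide) _ cp).const_mul 2).sub
    (M 0 1 0 1 (by decide) (by decide) _ cp')
  have i3 := (((M 2 0 0 0 (by decide) (by decide) _ cq).add
    (M 1 0 1 0 (by decide) (by decide) _ cq)).add
    (M 1 0 0 0 (by decide) (by decide) _ cq')).const_mul 2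
  have i4 := ((M 0 2 0 0 (by decide) (by decide) _ cq).add
    (M 0 1 0 1 (by decide) (by decide) _ cq)).const_mul 2
  have i5 := (((M 1 0 0 0 (by decide) (by decide) _ cs).const_mul 2).add
    (M 0 0 0 0 (by decide) (by decide) _ cs')).const_mul 2
  have iD := (integrableOn_laplacian_sq h lam).const_mul 3
  have S := integral_add' iD ((((i1.add i2).add i3).add i4).add i5)
  rw [integral_add' (((i1.add i2).add i3).add i4) i5, integral_add' ((i1.add i2).add i3) i4,
    integral_add' (i1.add i2) i3, integral_add' i1 i2] at S
  simp only [Pi.add_apply, Pi.sub_apply, integral_const_mul] at S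
  rw [I2, I3, I4, I5] at S
  have iL : IntegrableOn (fun z => (lam * (comp 1 0 (by decide) h z ^ 2 +
      comp 0 1 (by decide) h z ^ 2) + lam ^ 3 * a ^ 2 * comp 0 0 (by decide) h z ^ 2) *
      weight lam z.1) (box a b c d) := by
    refine ((((M 1 0 1 0 (by decide) (by decide) _ cw).add
      (M 0 1 0 1 (by decide) (by decide) _ cw)).const_mul lam).add
      ((M 0 0 0 0 (by decide) (by decide) _ cw).const_mul (lam ^ 3 * a ^ 2))).congr
      (ae_of_all _ fun z => ?_)
    simp only [Pi.add_apply]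
    ring
  refine (integral_mono_ae iL (iD.add ((((i1.add i2).add i3).add i4).add i5)) ?_).trans
    (le_of_eq_of_le S ?_)
  · filter_upwards [ae_restrict_mem (measurableSet_box a b c d)] with z hz
    simp only [Pi.add_apply, Pi.sub_apply]
    exact carleman_pointwise rfl (weight_pos _ _) ha hz.1.1 hl hla
  · linarith

/-- Squaring the Laplacian produces 2 ∂ₓ²h ∂ᵧ²h, which becomes 2(∂ₓ∂ᵧh)² up to a term with the
derivative 4λx of the exponent. That term is absorbed through the first Carleman estimate, at the
price of a factor λ. -/
theorem ZeroTraces.carleman_second (ha : 0 < a) (hab : a < b) (hcd : c < d) (hl : 1 ≤ lam)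
    (hla : 1 ≤ lam * a ^ 2) (h0 : ZeroTraces a b c d h) :
    ∫ z in box a b c d, (comp 2 0 (by decide) h z ^ 2 + comp 0 2 (by decide) h z ^ 2 +
      comp 1 1 (by decide) h z ^ 2) * weight lam z.1 ≤
    (2 + 192 * b ^ 2 * lam) * ∫ z in box a b c d,
      (comp 2 0 (by decide) h z + comp 0 2 (by decide) h z) ^ 2 * weight lam z.1 := by
  have cw := continuous_weight lam
  have dw : ∀ x, HasDerivAt (weight lam) ((0 + 1 * (4 * lam * x)) * weight lam x) x := fun x => by
    simpa using hasDerivAt_mul_weight lam (hasDerivAt_const x (1 : ℝ))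
  have cw' : Continuous fun x => (0 + 1 * (4 * lam * x)) * weight lam x := by fun_prop
  have I := h0.integral_xx_yy hab hcd dw cw'
  have F := h0.carleman_first ha hab hcd hl hla
  have M := fun i j k l hij hkl (p : ℝ → ℝ) (hp : Continuous p) =>
    integrableOn_comp_mul_weight h i j k l hij hkl hp
  have iI := ((((M 0 2 2 0 (by decide) (by decide) _ cw).add
    (M 0 2 1 0 (by decide) (by decide) _ cw')).sub
    (M 1 1 1 1 (by decide) (by decide) _ cw))).const_mul (-4)
  have iD := (integrableOn_laplacian_sq h lam).const_mul 2
  have iF := ((((M 1 0 1 0 (by decide) (by decide) _ cw).add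
      (M 0 1 0 1 (by decide) (by decide) _ cw)).const_mul lam).add
      ((M 0 0 0 0 (by decide) (by decide) _ cw).const_mul (lam ^ 3 * a ^ 2))).const_mul
        (64 * b ^ 2 * lam)
  have S := integral_add' iD (iI.add iF)
  rw [integral_add' iI iF] at S
  simp only [Pi.add_apply, Pi.sub_apply, integral_const_mul] at S
  rw [I] at S
  have iL : IntegrableOn (fun z => (comp 2 0 (by decide) h z ^ 2 + comp 0 2 (by decide) h z ^ 2 +
      comp 1 1 (by decide) h z ^ 2) * weight lam z.1) (box a b c d) := by
    refine (((M 2 0 2 0 (by decide) (by decide) _ cw).add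
      (M 0 2 0 2 (by decide) (by decide) _ cw)).add
      (M 1 1 1 1 (by decide) (by decide) _ cw)).congr (ae_of_all _ fun z => ?_)
    simp only [Pi.add_apply]
    ring
  have hb : 0 < b := ha.trans hab
  have hl0 : 0 < lam := by linarith
  refine (integral_mono_ae iL (iD.add (iI.add iF)) ?_).trans (le_of_eq_of_le S ?_)
  · filter_upwards [ae_restrict_mem (measurableSet_box a b c d)] with z hz
    simp only [Pi.add_apply, Pi.sub_apply]
    set hxx := comp 2 0 (by decide) h z
    set hyy := comp 0 2 (by decide) h z
    set hxy := comp 1 1 (by decide) h z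
    set hx := comp 1 0 (by decide) h z
    set hy := comp 0 1 (by decide) h z
    set hh := comp 0 0 (by decide) h z
    set x := z.1
    have hx1 : a < x := hz.1.1
    have hx2 : x < b := hz.1.2
    have hw := weight_pos lam x
    have h2 : 0 ≤ b ^ 2 - x ^ 2 := by nlinarith
    -- The factor -4 cancels the cross term of 2D², and 64b²λ times the first-order estimate
    -- completes the square in hyy - 8λx·hx. With its constant 3 this is the origin of 192.
    have key : 0 ≤ weight lam x * (hxx ^ 2 + (hyy - 8 * lam * x * hx) ^ 2 +
        3 * hxy ^ 2 + 64 * lam ^ 2 * hx ^ 2 * (b ^ 2 - x ^ 2) + 64 * b ^ 2 * lam ^ 2 * hy ^ 2 +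
        64 * b ^ 2 * lam ^ 4 * a ^ 2 * hh ^ 2) := by
      positivity
    refine le_of_sub_nonneg (le_of_le_of_eq key ?_)
    ring
  · have e : ∫ z in box a b c d, (lam * (comp 1 0 (by decide) h z * comp 1 0 (by decide) h z *
        weight lam z.1 + comp 0 1 (by decide) h z * comp 0 1 (by decide) h z * weight lam z.1) +
        lam ^ 3 * a ^ 2 * (comp 0 0 (by decide) h z * comp 0 0 (by decide) h z * weight lam z.1)) =
        ∫ z in box a b c d, (lam * (comp 1 0 (by decide) h z ^ 2 +
          comp 0 1 (by decide) h z ^ 2) +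
          lam ^ 3 * a ^ 2 * comp 0 0 (by decide) h z ^ 2) * weight lam z.1 := by
      congr 1; ext z; ring
    rw [e]
    have : 0 < 64 * b ^ 2 * lam := by positivity
    nlinarith [mul_le_mul_of_nonneg_left F this.le]

end Carleman

/-! ### A product estimate -/

/-- The one-dimensional Sobolev inequality applied to F², whose derivative is 2Ff. -/
lemma Prim.sq_le {a b : ℝ} (hab : a < b) {F f : ℝ → ℝ} (h : Prim a b F f) {x : ℝ}
    (hx : x ∈ Icc a b) :
    F x ^ 2 ≤ (b - a)⁻¹ * (∫ s in Ioo a b, F s ^ 2) + 2 * ∫ s in Ioo a b, |F s * f s| := by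
  have h1 := (h.mul hab.le h).abs_le hab hx
  have h2 : ∀ s, |f s * F s + F s * f s| = 2 * |F s * f s| := fun s => by
    rw [show f s * F s + F s * f s = 2 * (F s * f s) by ring, abs_mul, abs_two]
  simp only [h2, integral_const_mul, ← sq, abs_sq] at h1
  exact h1

/-- `‖F V‖` in `L²` of a box, when `F` has a derivative in `y` and `V` a derivative in `x`. -/
theorem integral_sq_mul_sq_le {a b c d : ℝ} (hab : a < b) (hcd : c < d) {F f V v : ℝ × ℝ → ℝ}
    (sF : SliceY a b c d F f) (sV : SliceX a b c d V v)
    (iF : IntegrableOn (fun z => F z ^ 2) (box a b c d))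
    (iFf : IntegrableOn (fun z => F z * f z) (box a b c d))
    (iV : IntegrableOn (fun z => V z ^ 2) (box a b c d))
    (iVv : IntegrableOn (fun z => V z * v z) (box a b c d)) :
    IntegrableOn (fun z => F z ^ 2 * V z ^ 2) (box a b c d) ∧
    ∫ z in box a b c d, F z ^ 2 * V z ^ 2 ≤
      ((d - c)⁻¹ * (∫ z in box a b c d, F z ^ 2) + 2 * ∫ z in box a b c d, |F z * f z|) *
      ((b - a)⁻¹ * (∫ z in box a b c d, V z ^ 2) + 2 * ∫ z in box a b c d, |V z * v z|) := by
  -- As in Ladyzhenskaya's inequality: F² is bounded by a function of x alone and V² by a function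
  -- of y alone, so the integral of the product factorises.
  set Φ : ℝ → ℝ := fun x => (d - c)⁻¹ * (∫ y in Ioo c d, F (x, y) ^ 2) +
    2 * ∫ y in Ioo c d, |F (x, y) * f (x, y)| with hΦ
  set Ψ : ℝ → ℝ := fun y => (b - a)⁻¹ * (∫ x in Ioo a b, V (x, y) ^ 2) +
    2 * ∫ x in Ioo a b, |V (x, y) * v (x, y)| with hΨ
  have key : ∀ᵐ z ∂volume.restrict (box a b c d), F z ^ 2 * V z ^ 2 ≤ Φ z.1 * Ψ z.2 := by
    filter_upwards [ae_box_fst sF, ae_box_snd sV, ae_restrict_mem (measurableSet_box a b c d)]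
      with z h1 h2 hz
    exact mul_le_mul (h1.sq_le hcd (Ioo_subset_Icc_self hz.2))
      (h2.sq_le hab (Ioo_subset_Icc_self hz.1)) (sq_nonneg _)
      ((sq_nonneg _).trans (h1.sq_le hcd (Ioo_subset_Icc_self hz.2)))
  have left : ∀ {g : ℝ × ℝ → ℝ}, IntegrableOn g (box a b c d) →
      IntegrableOn (fun x => ∫ y in Ioo c d, g (x, y)) (Ioo a b) := fun hg => by
    rw [IntegrableOn, volume_restrict_box] at hg
    exact hg.integral_prod_left
  have right : ∀ {g : ℝ × ℝ → ℝ}, IntegrableOn g (box a b c d) →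
      IntegrableOn (fun y => ∫ x in Ioo a b, g (x, y)) (Ioo c d) := fun hg => by
    have hg := integrableOn_box_swap hg
    rw [IntegrableOn, volume_restrict_box] at hg
    exact hg.integral_prod_left
  have iΦ : IntegrableOn Φ (Ioo a b) := ((left iF).const_mul _).add ((left iFf.abs).const_mul _)
  have iΨ : IntegrableOn Ψ (Ioo c d) := ((right iV).const_mul _).add ((right iVv.abs).const_mul _)
  have iP : IntegrableOn (fun z : ℝ × ℝ => Φ z.1 * Ψ z.2) (box a b c d) := by
    rw [IntegrableOn, volume_restrict_box]
    exact Integrable.mul_prod iΦ iΨ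
  have eΦ : ∫ x in Ioo a b, Φ x =
      (d - c)⁻¹ * (∫ z in box a b c d, F z ^ 2) + 2 * ∫ z in box a b c d, |F z * f z| := by
    rw [hΦ, integral_add ((left iF).const_mul _) ((left iFf.abs).const_mul _), integral_const_mul,
      integral_const_mul, setIntegral_box iF, setIntegral_box iFf.abs]
  have eΨ : ∫ y in Ioo c d, Ψ y =
      (b - a)⁻¹ * (∫ z in box a b c d, V z ^ 2) + 2 * ∫ z in box a b c d, |V z * v z| := by
    rw [hΨ, integral_add ((right iV).const_mul _) ((right iVv.abs).const_mul _),
      integral_const_mul, integral_const_mul, setIntegral_box' iV, setIntegral_box' iVv.abs]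
  refine ⟨Integrable.mono' iP (iF.aestronglyMeasurable.mul iV.aestronglyMeasurable) ?_, ?_⟩
  · filter_upwards [key] with z hz
    rwa [Real.norm_of_nonneg (by positivity)]
  · rw [← eΦ, ← eΨ, ← integral_prod_mul, ← volume_restrict_box]
    exact integral_mono_of_nonneg (ae_of_all _ fun z => by positivity) iP key

lemma weight_half_sq (lam x : ℝ) : weight (lam / 2) x ^ 2 = weight lam x := by
  unfold weight
  rw [← Real.exp_nat_mul]
  congr 1
  push_cast
  ring

/-- Second derivatives of `u` times first derivatives of `h`, in the weighted norm. -/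
theorem integral_second_mul_first_le {a b c d : ℝ} (ha : 0 < a) (hab : a < b) (hcd : c < d) :
    ∃ C : ℝ, 0 < C ∧ ∀ (i j k l : ℕ) (hij : i + j ≤ 3) (_ : i + (j + 1) ≤ 3) (hkl : k + l ≤ 3)
      (hkl' : k + 1 + l ≤ 3) (u h : H3 (box a b c d)) (lam : ℝ), 1 ≤ lam →
      IntegrableOn (fun z => comp i j hij u z ^ 2 * comp k l hkl h z ^ 2 * weight lam z.1)
        (box a b c d) ∧
      ∫ z in box a b c d, comp i j hij u z ^ 2 * comp k l hkl h z ^ 2 * weight lam z.1 ≤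
        C * ‖u‖ ^ 2 * (lam * (∫ z in box a b c d, comp k l hkl h z ^ 2 * weight lam z.1) +
          lam⁻¹ * ∫ z in box a b c d, comp (k + 1) l hkl' h z ^ 2 * weight lam z.1) := by
  have p1 : 0 < (b - a)⁻¹ := inv_pos.2 (sub_pos.2 hab)
  have p2 : 0 < (d - c)⁻¹ := inv_pos.2 (sub_pos.2 hcd)
  have hb : 0 < b := ha.trans hab
  refine ⟨((d - c)⁻¹ + 2) * ((b - a)⁻¹ + 1 + 4 * b), by positivity,
    fun i j k l hij hij' hkl hkl' u h lam hl => ?_⟩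
  have hl0 : 0 < lam := by linarith
  obtain ⟨F, eF, sF⟩ := exists_sliceY_comp hcd i j hij hij' u
  obtain ⟨V, eV, sV⟩ := exists_sliceX_comp hab k l hkl hkl' h
  -- The square root of the weight travels with `V`. Differentiating it in x produces the factor λ
  -- in front of the lower-order integral.
  set w := weight (lam / 2) with hw
  have cw : Continuous w := continuous_weight _
  have ew : ∀ x, w x * w x = weight lam x := fun x => by rw [← sq, hw, weight_half_sq]
  have dw : ∀ x, HasDerivAt w (2 * lam * x * w x) x := fun x => by
    have := hasDerivAt_mul_weight (lam / 2) (hasDerivAt_const x (1 : ℝ))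
    simp only [one_mul, zero_add] at this
    exact this.congr_deriv (by ring)
  have sW := sV.mul hab.le (sliceX_weight a b c d dw (by fun_prop))
  have iF : IntegrableOn (fun z => F z ^ 2) (box a b c d) :=
    (integrable_mul_L2 (comp i j hij u) (comp i j hij u)).congr (by
      filter_upwards [eF] with z hz; rw [hz, sq])
  have iFf : IntegrableOn (fun z => F z * comp i (j + 1) hij' u z) (box a b c d) :=
    (integrable_mul_L2 (comp i j hij u) _).congr (by filter_upwards [eF] with z hz; rw [hz])
  have i0 : IntegrableOn (fun z => comp k l hkl h z ^ 2 * weight lam z.1) (box a b c d) :=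
    (integrableOn_mul_L2_weight (comp k l hkl h) (comp k l hkl h) (continuous_weight lam)).congr
      (ae_of_all _ fun z => by simp only; ring)
  have i1 : IntegrableOn (fun z => comp (k + 1) l hkl' h z ^ 2 * weight lam z.1) (box a b c d) :=
    (integrableOn_mul_L2_weight (comp (k + 1) l hkl' h) (comp (k + 1) l hkl' h)
      (continuous_weight lam)).congr (ae_of_all _ fun z => by simp only; ring)
  have eV2 : (fun z => comp k l hkl h z ^ 2 * weight lam z.1) =ᵐ[volume.restrict (box a b c d)]
      fun z => (V z * w z.1) ^ 2 := by
    filter_upwards [eV] with z hz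
    rw [hz, ← ew]; ring
  have iV := i0.congr eV2
  have ceq : (fun z => comp k l hkl h z * comp (k + 1) l hkl' h z * weight lam z.1 +
      comp k l hkl h z * comp k l hkl h z * (2 * lam * z.1 * weight lam z.1))
      =ᵐ[volume.restrict (box a b c d)]
      fun z => (V z * w z.1) * (comp (k + 1) l hkl' h z * w z.1 + V z * (2 * lam * z.1 * w z.1)) := by
    filter_upwards [eV] with z hz
    rw [hz, ← ew]; ring
  have cw2 : Continuous fun x => 2 * lam * x * weight lam x := by
    have := continuous_weight lam
    fun_prop
  have iVv' := (integrableOn_mul_L2_weight (comp k l hkl h) (comp (k + 1) l hkl' h)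
    (continuous_weight lam)).add (integrableOn_mul_L2_weight (comp k l hkl h) (comp k l hkl h) cw2)
  have iVv := iVv'.congr ceq
  obtain ⟨r1, r2⟩ := integral_sq_mul_sq_le hab hcd sF sW iF iFf iV iVv
  have eFV : (fun z => F z ^ 2 * (V z * w z.1) ^ 2) =ᵐ[volume.restrict (box a b c d)]
      fun z => comp i j hij u z ^ 2 * comp k l hkl h z ^ 2 * weight lam z.1 := by
    filter_upwards [eF, eV] with z h1 h2
    rw [h1, h2, ← ew]; ring
  refine ⟨r1.congr eFV, ?_⟩
  rw [← integral_congr_ae eFV]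
  refine r2.trans ?_
  have b1 : ∫ z in box a b c d, F z ^ 2 ≤ ‖u‖ ^ 2 := by
    have : ∫ z in box a b c d, F z ^ 2 = ‖comp i j hij u‖ ^ 2 := by
      rw [norm_sq_L2]
      exact integral_congr_ae (by filter_upwards [eF] with z hz; rw [hz])
    rw [this]
    gcongr
    exact norm_comp_le i j hij u
  have b2 : ∫ z in box a b c d, |F z * comp i (j + 1) hij' u z| ≤ ‖u‖ ^ 2 := by
    have : ∫ z in box a b c d, |F z * comp i (j + 1) hij' u z| =
        ∫ z in box a b c d, |comp i j hij u z * comp i (j + 1) hij' u z| :=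
      integral_congr_ae (by filter_upwards [eF] with z hz; rw [hz])
    rw [this, sq]
    exact (integral_abs_mul_le_L2 _ _).trans (mul_le_mul (norm_comp_le i j hij u)
      (norm_comp_le i (j + 1) hij' u) (norm_nonneg _) (norm_nonneg _))
  set X := ∫ z in box a b c d, comp k l hkl h z ^ 2 * weight lam z.1
  set Y := ∫ z in box a b c d, comp (k + 1) l hkl' h z ^ 2 * weight lam z.1
  have X0 : 0 ≤ X := integral_nonneg fun z => mul_nonneg (sq_nonneg _) (weight_pos _ _).le
  have Y0 : 0 ≤ Y := integral_nonneg fun z => mul_nonneg (sq_nonneg _) (weight_pos _ _).le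
  have b3 : ∫ z in box a b c d, (V z * w z.1) ^ 2 = X := (integral_congr_ae eV2).symm
  have b4 : 2 * ∫ z in box a b c d, |(V z * w z.1) *
      (comp (k + 1) l hkl' h z * w z.1 + V z * (2 * lam * z.1 * w z.1))| ≤
      (1 + 4 * b) * (lam * X) + lam⁻¹ * Y := by
    rw [← integral_const_mul]
    have : (1 + 4 * b) * (lam * X) + lam⁻¹ * Y = ∫ z in box a b c d,
        ((1 + 4 * b) * (lam * (comp k l hkl h z ^ 2 * weight lam z.1)) +
          lam⁻¹ * (comp (k + 1) l hkl' h z ^ 2 * weight lam z.1)) := by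
      rw [integral_add ((i0.const_mul _).const_mul _) (i1.const_mul _)]
      simp only [integral_const_mul, X, Y]
    rw [this]
    refine integral_mono_ae (iVv.abs.const_mul 2)
      (((i0.const_mul _).const_mul _).add (i1.const_mul _)) ?_
    filter_upwards [ceq, ae_restrict_mem (measurableSet_box a b c d)] with z h1 hz
    rw [← h1]
    have hw0 := weight_pos lam z.1
    have hz1 : a < z.1 := hz.1.1
    have hz2 : z.1 < b := hz.1.2
    generalize comp k l hkl h z = p
    generalize comp (k + 1) l hkl' h z = q
    generalize weight lam z.1 = W at *
    generalize z.1 = x at *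
    have hx0 : 0 < x := by linarith
    have e : p * q * W + p * p * (2 * lam * x * W) = (p * q + 2 * lam * x * p ^ 2) * W := by ring
    rw [e, abs_mul, abs_of_pos hw0]
    have h3 : |p * q + 2 * lam * x * p ^ 2| ≤ |p * q| + 2 * lam * x * p ^ 2 := by
      refine (abs_add_le _ _).trans ?_
      rw [abs_of_nonneg (by positivity : 0 ≤ 2 * lam * x * p ^ 2)]
    -- Young's inequality balanced with λ, so that the higher derivative carries λ⁻¹, exactly what
    -- is needed against the loss in `ZeroTraces.carleman_second`.
    have h4 : 2 * |p * q| ≤ lam * p ^ 2 + lam⁻¹ * q ^ 2 := by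
      rw [abs_mul, ← sq_abs p, ← sq_abs q]
      have h5 : 0 ≤ lam⁻¹ * (lam * |p| - |q|) ^ 2 := by positivity
      have h6 : lam⁻¹ * (lam * |p| - |q|) ^ 2 =
          lam * |p| ^ 2 + lam⁻¹ * |q| ^ 2 - 2 * (|p| * |q|) := by field_simp; ring
      linarith
    have h7 : lam * x * p ^ 2 ≤ lam * b * p ^ 2 := by gcongr
    have h8 : 2 * |p * q + 2 * lam * x * p ^ 2| ≤ (1 + 4 * b) * (lam * p ^ 2) + lam⁻¹ * q ^ 2 := by
      linarith
    nlinarith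
  rw [b3]
  have h1 : X ≤ lam * X := le_mul_of_one_le_left X0 hl
  have hu := sq_nonneg ‖u‖
  have hY : 0 ≤ lam⁻¹ * Y := by positivity
  have s1 : (d - c)⁻¹ * (∫ z in box a b c d, F z ^ 2) +
      2 * (∫ z in box a b c d, |F z * comp i (j + 1) hij' u z|) ≤ ((d - c)⁻¹ + 2) * ‖u‖ ^ 2 := by
    nlinarith [mul_le_mul_of_nonneg_left b1 p2.le]
  have s2 : (b - a)⁻¹ * X + ((1 + 4 * b) * (lam * X) + lam⁻¹ * Y) ≤
      ((b - a)⁻¹ + 1 + 4 * b) * (lam * X + lam⁻¹ * Y) := by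
    nlinarith [mul_le_mul_of_nonneg_left h1 p1.le, mul_nonneg p1.le hY, mul_nonneg hb.le hY]
  calc _ ≤ (((d - c)⁻¹ + 2) * ‖u‖ ^ 2) * (((b - a)⁻¹ + 1 + 4 * b) * (lam * X + lam⁻¹ * Y)) := by
        refine mul_le_mul s1 ((add_le_add_right b4 _).trans s2) ?_ (by positivity)
        have : 0 ≤ ∫ z in box a b c d, |(V z * w z.1) *
            (comp (k + 1) l hkl' h z * w z.1 + V z * (2 * lam * z.1 * w z.1))| :=
          integral_nonneg fun _ => abs_nonneg _
        positivity
    _ = _ := by ring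

/-! ### Quartic functionals on a Hilbert space -/

section Energy

variable {X Y : Type*} [NormedAddCommGroup X] [InnerProductSpace ℝ X] [NormedAddCommGroup Y]
  [InnerProductSpace ℝ Y]

/-- The quadratic map `p ↦ A p + B (p, p)`. -/
def quad (A : X →L[ℝ] Y) (B : X →L[ℝ] X →L[ℝ] Y) (p : X) : Y := A p + B p p

/-- The derivative of `quad A B` at `p`. -/
def quadDeriv (A : X →L[ℝ] Y) (B : X →L[ℝ] X →L[ℝ] Y) (p : X) : X →L[ℝ] Y := A + B p + B.flip p

lemma quad_add (A : X →L[ℝ] Y) (B : X →L[ℝ] X →L[ℝ] Y) (p h : X) :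
    quad A B (p + h) = quad A B p + (quadDeriv A B p h + B h h) := by
  simp only [quad, quadDeriv, map_add, add_apply,
    ContinuousLinearMap.flip_apply]
  abel

lemma hasFDerivAt_quad (A : X →L[ℝ] Y) (B : X →L[ℝ] X →L[ℝ] Y) (p : X) :
    HasFDerivAt (quad A B) (quadDeriv A B p) p := by
  have h := A.hasFDerivAt.add ((B.hasFDerivAt (x := p)).clm_apply (hasFDerivAt_id p))
  refine h.congr_fderiv ?_
  ext v
  simp [quadDeriv, add_assoc]

/-- `κ (‖A₁ p + B (p, p)‖² + ‖A₂ p + B (p, p)‖²) + α ‖p‖²`. -/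
def energy (κ α : ℝ) (A₁ A₂ : X →L[ℝ] Y) (B : X →L[ℝ] X →L[ℝ] Y) (p : X) : ℝ :=
  κ * (‖quad A₁ B p‖ ^ 2 + ‖quad A₂ B p‖ ^ 2) + α * ‖p‖ ^ 2

/-- The derivative of `energy`. -/
def energyDeriv (κ α : ℝ) (A₁ A₂ : X →L[ℝ] Y) (B : X →L[ℝ] X →L[ℝ] Y) (p : X) : X →L[ℝ] ℝ :=
  κ • (2 • (innerSL ℝ (quad A₁ B p)).comp (quadDeriv A₁ B p) +
    2 • (innerSL ℝ (quad A₂ B p)).comp (quadDeriv A₂ B p)) + α • (2 • innerSL ℝ p)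

variable {κ α : ℝ} {A₁ A₂ : X →L[ℝ] Y} {B : X →L[ℝ] X →L[ℝ] Y}

lemma energyDeriv_apply (p h : X) : energyDeriv κ α A₁ A₂ B p h =
    κ * (2 * inner ℝ (quad A₁ B p) (quadDeriv A₁ B p h) +
      2 * inner ℝ (quad A₂ B p) (quadDeriv A₂ B p h)) + α * (2 * inner ℝ p h) := by
  simp [energyDeriv]
  ring

lemma hasFDerivAt_energy (p : X) :
    HasFDerivAt (energy κ α A₁ A₂ B) (energyDeriv κ α A₁ A₂ B p) p := by
  have h1 := ((hasFDerivAt_quad A₁ B p).norm_sq.add (hasFDerivAt_quad A₂ B p).norm_sq).const_mul κ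
  have h2 := ((hasFDerivAt_id p).norm_sq).const_mul α
  refine (h1.add h2).congr_fderiv ?_
  ext v
  simp [energyDeriv]

/-- The expansion is exact, so the Bregman remainder is available at finite distance, cubic and
quartic terms in `h` included. -/
lemma energy_add (p h : X) : energy κ α A₁ A₂ B (p + h) = energy κ α A₁ A₂ B p +
    energyDeriv κ α A₁ A₂ B p h +
    (κ * ((‖quadDeriv A₁ B p h + B h h‖ ^ 2 + 2 * inner ℝ (quad A₁ B p) (B h h)) +
      (‖quadDeriv A₂ B p h + B h h‖ ^ 2 + 2 * inner ℝ (quad A₂ B p) (B h h))) +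
      α * ‖h‖ ^ 2) := by
  rw [energyDeriv_apply]
  simp only [energy, quad_add]
  rw [norm_add_sq_real, norm_add_sq_real (quad A₂ B p), norm_add_sq_real p, inner_add_right,
    inner_add_right]
  ring

lemma norm_quad_le (A : X →L[ℝ] Y) (B : X →L[ℝ] X →L[ℝ] Y) {R : ℝ} {p : X} (hp : ‖p‖ ≤ R) :
    ‖quad A B p‖ ≤ (‖A‖ + 2 * ‖B‖ * R) * R := by
  have h1 := A.le_opNorm p
  have h2 := B.le_opNorm₂ p p
  have h0 := norm_nonneg p
  have hR : 0 ≤ R := h0.trans hp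
  have h3 : ‖A‖ * ‖p‖ ≤ ‖A‖ * R := by gcongr
  have h4 : ‖B‖ * ‖p‖ * ‖p‖ ≤ ‖B‖ * R * R := by gcongr
  have h5 : 0 ≤ ‖B‖ * R * R := by positivity
  refine (norm_add_le _ _).trans ?_
  linarith

lemma norm_quadDeriv_apply_le (A : X →L[ℝ] Y) (B : X →L[ℝ] X →L[ℝ] Y) {R : ℝ} {p : X}
    (hp : ‖p‖ ≤ R) (h : X) : ‖quadDeriv A B p h‖ ≤ (‖A‖ + 2 * ‖B‖ * R) * ‖h‖ := by
  have h1 := A.le_opNorm h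
  have h2 := B.le_opNorm₂ p h
  have h3 := B.le_opNorm₂ h p
  have h4 : ‖B‖ * ‖p‖ * ‖h‖ ≤ ‖B‖ * R * ‖h‖ := by gcongr
  have h5 := norm_add₃_le (a := A h) (b := B p h) (c := B h p)
  have e : quadDeriv A B p h = A h + B p h + B h p := rfl
  rw [e]
  linarith

lemma inner_quad_sub_le (A : X →L[ℝ] Y) (B : X →L[ℝ] X →L[ℝ] Y) {R : ℝ} {p q : X}
    (hp : ‖p‖ ≤ R) (hq : ‖q‖ ≤ R) (h : X) :
    |inner ℝ (quad A B q) (quadDeriv A B q h) - inner ℝ (quad A B p) (quadDeriv A B p h)| ≤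
      ((‖A‖ + 2 * ‖B‖ * R) * (‖A‖ + 2 * ‖B‖ * R) +
        (‖A‖ + 2 * ‖B‖ * R) * R * (2 * ‖B‖)) * ‖q - p‖ * ‖h‖ := by
  have e : inner ℝ (quad A B q) (quadDeriv A B q h) - inner ℝ (quad A B p) (quadDeriv A B p h) =
      inner ℝ (quad A B q - quad A B p) (quadDeriv A B q h) +
        inner ℝ (quad A B p) (quadDeriv A B q h - quadDeriv A B p h) := by
    rw [inner_sub_left, inner_sub_right]; ring
  set K := ‖A‖ + 2 * ‖B‖ * R with hK
  have hR : 0 ≤ R := (norm_nonneg p).trans hp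
  have K0 : 0 ≤ K := by positivity
  have d1 : ‖quad A B q - quad A B p‖ ≤ K * ‖q - p‖ := by
    have : quad A B q - quad A B p = A (q - p) + B q (q - p) + B (q - p) p := by
      simp only [quad, map_sub, sub_apply]; abel
    rw [this]
    have h1 := A.le_opNorm (q - p)
    have h2 := B.le_opNorm₂ q (q - p)
    have h3 := B.le_opNorm₂ (q - p) p
    have h4 : ‖B‖ * ‖q‖ * ‖q - p‖ ≤ ‖B‖ * R * ‖q - p‖ := by gcongr
    have h5 : ‖B‖ * ‖q - p‖ * ‖p‖ ≤ ‖B‖ * ‖q - p‖ * R := by gcongr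
    have h6 := norm_add₃_le (a := A (q - p)) (b := B q (q - p)) (c := B (q - p) p)
    rw [hK]
    linarith
  have d2 : ‖quadDeriv A B q h - quadDeriv A B p h‖ ≤ 2 * ‖B‖ * ‖q - p‖ * ‖h‖ := by
    have : quadDeriv A B q h - quadDeriv A B p h = B (q - p) h + B h (q - p) := by
      simp only [quadDeriv, map_sub, sub_apply, add_apply,
        ContinuousLinearMap.flip_apply]
      abel
    rw [this]
    have h1 := B.le_opNorm₂ (q - p) h
    have h2 := B.le_opNorm₂ h (q - p)
    have h3 := norm_add_le (B (q - p) h) (B h (q - p))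
    linarith
  rw [e]
  have i1 := abs_real_inner_le_norm (quad A B q - quad A B p) (quadDeriv A B q h)
  have i2 := abs_real_inner_le_norm (quad A B p) (quadDeriv A B q h - quadDeriv A B p h)
  have m1 : ‖quad A B q - quad A B p‖ * ‖quadDeriv A B q h‖ ≤ (K * ‖q - p‖) * (K * ‖h‖) := by
    gcongr
    exact norm_quadDeriv_apply_le A B hq h
  have m2 : ‖quad A B p‖ * ‖quadDeriv A B q h - quadDeriv A B p h‖ ≤
      (K * R) * (2 * ‖B‖ * ‖q - p‖ * ‖h‖) := by
    gcongr
    exact norm_quad_le A B hp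
  refine (abs_add_le _ _).trans ?_
  linarith

/-- The derivative of the energy is Lipschitz on balls. -/
theorem exists_energyDeriv_lipschitz (κ : ℝ) (A₁ A₂ : X →L[ℝ] Y) (B : X →L[ℝ] X →L[ℝ] Y)
    {R : ℝ} (hR : 0 ≤ R) : ∃ D : ℝ, 0 < D ∧ ∀ α ∈ Ioo (0 : ℝ) 1, ∀ p q h : X, ‖p‖ ≤ R → ‖q‖ ≤ R →
      |energyDeriv κ α A₁ A₂ B q h - energyDeriv κ α A₁ A₂ B p h| ≤ D * ‖q - p‖ * ‖h‖ := by
  refine ⟨|κ| * (2 * ((‖A₁‖ + 2 * ‖B‖ * R) * (‖A₁‖ + 2 * ‖B‖ * R) +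
        (‖A₁‖ + 2 * ‖B‖ * R) * R * (2 * ‖B‖)) + 2 * ((‖A₂‖ + 2 * ‖B‖ * R) * (‖A₂‖ + 2 * ‖B‖ * R) +
        (‖A₂‖ + 2 * ‖B‖ * R) * R * (2 * ‖B‖))) + 2, by positivity, fun α hα p q h hp hq => ?_⟩
  have h1 := inner_quad_sub_le A₁ B hp hq h
  have h2 := inner_quad_sub_le A₂ B hp hq h
  have h3 := abs_real_inner_le_norm (q - p) h
  rw [inner_sub_left] at h3
  simp only [energyDeriv_apply]
  set x := inner ℝ (quad A₁ B q) (quadDeriv A₁ B q h) - inner ℝ (quad A₁ B p) (quadDeriv A₁ B p h)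
    with hx
  set y := inner ℝ (quad A₂ B q) (quadDeriv A₂ B q h) - inner ℝ (quad A₂ B p) (quadDeriv A₂ B p h)
    with hy
  set t := inner ℝ q h - inner ℝ p h with ht
  have e : κ * (2 * inner ℝ (quad A₁ B q) (quadDeriv A₁ B q h) +
      2 * inner ℝ (quad A₂ B q) (quadDeriv A₂ B q h)) + α * (2 * inner ℝ q h) -
      (κ * (2 * inner ℝ (quad A₁ B p) (quadDeriv A₁ B p h) +
      2 * inner ℝ (quad A₂ B p) (quadDeriv A₂ B p h)) + α * (2 * inner ℝ p h)) =
      κ * (2 * x + 2 * y) + α * (2 * t) := by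
    rw [hx, hy, ht]; ring
  rw [e]
  have a1 : |κ * (2 * x + 2 * y) + α * (2 * t)| ≤ |κ| * (2 * |x| + 2 * |y|) + 2 * |t| := by
    refine (abs_add_le _ _).trans (add_le_add ?_ ?_)
    · rw [abs_mul]
      gcongr
      refine (abs_add_le _ _).trans ?_
      simp [abs_mul]
    · rw [abs_mul, abs_mul, abs_two, abs_of_pos hα.1]
      -- The bound α < 1 is used here to make the Lipschitz constant independent of α.
      nlinarith [abs_nonneg t, hα.2]
  refine a1.trans ?_
  have a2 := mul_le_mul_of_nonneg_left (add_le_add (mul_le_mul_of_nonneg_left h1 zero_le_two)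
    (mul_le_mul_of_nonneg_left h2 zero_le_two)) (abs_nonneg κ)
  linarith

end Energy

/-! ### Minimization of strongly convex functionals -/

section Minimization

variable {X : Type*} [NormedAddCommGroup X] [InnerProductSpace ℝ X]

/-- The Bregman lower bound of a strongly convex functional `f` with derivative `L` on `K`. -/
def StronglyConvexOn (f : X → ℝ) (L : X → X →L[ℝ] ℝ) (α : ℝ) (K : Set X) : Prop :=
  ∀ p ∈ K, ∀ q ∈ K, α * ‖q - p‖ ^ 2 ≤ f q - f p - L p (q - p)

variable {f : X → ℝ} {L : X → X →L[ℝ] ℝ} {α : ℝ} {K : Set X}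

/-- Add the Bregman inequalities from the midpoint to both endpoints: the linear terms are opposite
and cancel. -/
lemma StronglyConvexOn.midpoint_le (h : StronglyConvexOn f L α K) (hK : Convex ℝ K) {p q : X}
    (hp : p ∈ K) (hq : q ∈ K) :
    ∃ m ∈ K, α / 2 * ‖p - q‖ ^ 2 ≤ f p + f q - 2 * f m := by
  set m : X := (1 / 2 : ℝ) • p + (1 / 2 : ℝ) • q with hm
  have mK : m ∈ K := hK hp hq (by norm_num) (by norm_num) (by norm_num)
  have e1 : p - m = (1 / 2 : ℝ) • (p - q) := by rw [hm]; module
  have e2 : q - m = -((1 / 2 : ℝ) • (p - q)) := by rw [hm]; module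
  have h1 := h m mK p hp
  have h2 := h m mK q hq
  rw [e1] at h1
  rw [e2, norm_neg, map_neg] at h2
  have e3 : ‖(1 / 2 : ℝ) • (p - q)‖ ^ 2 = 1 / 4 * ‖p - q‖ ^ 2 := by
    rw [norm_smul, mul_pow]; norm_num
  rw [e3] at h1 h2
  exact ⟨m, mK, by linarith⟩

theorem StronglyConvexOn.existsUnique_min [CompleteSpace X] (h : StronglyConvexOn f L α K)
    (hα : 0 < α) (hK : Convex ℝ K) (hc : IsClosed K) (hne : K.Nonempty) (hf : Continuous f)
    (h0 : ∀ p, 0 ≤ f p) : ∃! p, p ∈ K ∧ ∀ q ∈ K, f p ≤ f q := by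
  have bdd : BddBelow (f '' K) := ⟨0, by rintro _ ⟨p, _, rfl⟩; exact h0 p⟩
  set I := sInf (f '' K) with hI
  have hle : ∀ p ∈ K, I ≤ f p := fun p hp => csInf_le bdd ⟨p, hp, rfl⟩
  have hex : ∀ n : ℕ, ∃ p ∈ K, f p < I + 1 / (n + 1 : ℝ) := fun n => by
    obtain ⟨_, ⟨p, hp, rfl⟩, hlt⟩ := exists_lt_of_csInf_lt (hne.image f)
      (lt_add_of_pos_right I (by positivity : (0 : ℝ) < 1 / (n + 1 : ℝ)))
    exact ⟨p, hp, hlt⟩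
  choose u uK hu using hex
  -- The midpoint is admissible, so its value is at least the infimum; near-minimizers are therefore
  -- close to each other.
  have hd : ∀ n m, α / 2 * ‖u n - u m‖ ^ 2 ≤ 1 / (n + 1 : ℝ) + 1 / (m + 1 : ℝ) := fun n m => by
    obtain ⟨z, zK, hz⟩ := h.midpoint_le hK (uK n) (uK m)
    linarith [hu n, hu m, hle z zK]
  have hcau : CauchySeq u := by
    refine Metric.cauchySeq_iff'.2 fun δ hδ => ?_
    obtain ⟨N, hN⟩ := exists_nat_one_div_lt (by positivity : 0 < α / 4 * δ ^ 2)
    refine ⟨N, fun n hn => ?_⟩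
    rw [dist_eq_norm]
    have h1 : (1 : ℝ) / (n + 1) ≤ 1 / (N + 1) := by
      have : (N : ℝ) ≤ n := by exact_mod_cast hn
      gcongr
    have h2 := hd n N
    have h3 : α / 2 * ‖u n - u N‖ ^ 2 < α / 2 * δ ^ 2 := by linarith
    exact lt_of_pow_lt_pow_left₀ 2 hδ.le (lt_of_mul_lt_mul_left h3 (by positivity))
  obtain ⟨p, hp⟩ := cauchySeq_tendsto_of_complete hcau
  have pK : p ∈ K := hc.mem_of_tendsto hp (Filter.Eventually.of_forall uK)
  have fp : f p ≤ I := by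
    have t1 : Filter.Tendsto (fun n => f (u n)) Filter.atTop (nhds (f p)) :=
      (hf.tendsto p).comp hp
    have t2 : Filter.Tendsto (fun n : ℕ => I + 1 / (n + 1 : ℝ)) Filter.atTop (nhds (I + 0)) :=
      tendsto_const_nhds.add tendsto_one_div_add_atTop_nhds_zero_nat
    rw [add_zero] at t2
    exact le_of_tendsto_of_tendsto' t1 t2 fun n => (hu n).le
  refine ⟨p, ⟨pK, fun q hq => fp.trans (hle q hq)⟩, fun q hq => ?_⟩
  obtain ⟨z, zK, hz⟩ := h.midpoint_le hK hq.1 pK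
  have h1 := hq.2 z zK
  have h2 := fp.trans (hle z zK)
  have h3 : ‖q - p‖ ^ 2 ≤ 0 := by
    by_contra hcon
    have : 0 < α / 2 * ‖q - p‖ ^ 2 := mul_pos (by positivity) (not_le.1 hcon)
    linarith
  have h4 : ‖q - p‖ = 0 := pow_eq_zero_iff two_ne_zero |>.1 (le_antisymm h3 (sq_nonneg _))
  exact sub_eq_zero.1 (norm_eq_zero.1 h4)

/-- Necessity is the first-order condition along segments of the convex set. Sufficiency is read off
from the Bregman inequality at `p`. -/
theorem StronglyConvexOn.isMin_iff (h : StronglyConvexOn f L α K) (hα : 0 < α) (hK : Convex ℝ K)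
    {p : X} (hp : p ∈ K) (hL : HasFDerivAt f (L p) p) :
    (∀ q ∈ K, f p ≤ f q) ↔ ∀ q ∈ K, L p (p - q) ≤ 0 := by
  constructor
  · intro hmin q hq
    have h1 : IsLocalMinOn f K p := IsMinOn.localize fun q hq => hmin q hq
    have h2 := h1.hasFDerivWithinAt_nonneg hL.hasFDerivWithinAt
      (sub_mem_posTangentConeAt_of_segment_subset (hK.segment_subset hp hq))
    rw [← neg_sub, map_neg]
    linarith
  · intro hv q hq
    have h1 := h p hp q hq
    have h2 := hv q hq
    rw [← neg_sub, map_neg] at h2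
    have : 0 ≤ α * ‖q - p‖ ^ 2 := by positivity
    linarith

end Minimization

/-! ### The functional as an energy -/

lemma exists_ae_abs_comp_le {a b c d : ℝ} (hab : a < b) (hcd : c < d) : ∃ C : ℝ, 0 < C ∧
    ∀ (i j : ℕ) (_ : i + 1 + (j + 1) ≤ 3) (h' : i + j ≤ 3) (u : H3 (box a b c d)),
      ∀ᵐ z ∂volume.restrict (box a b c d), |comp i j h' u z| ≤ C * ‖u‖ := by
  obtain ⟨C, hC, h⟩ := exists_abs_rep_le (a := a) (b := b) (c := c) (d := d) hab hcd
  refine ⟨C, hC, fun i j hij h' u => ?_⟩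
  obtain ⟨W, cW, eW⟩ := exists_rep hab hcd i j hij h' u
  filter_upwards [eW, ae_restrict_mem (measurableSet_box a b c d)] with z h1 hz
  rw [h1]
  exact h i j hij h' u W cW eW z ⟨Ioo_subset_Icc_self hz.1, Ioo_subset_Icc_self hz.2⟩

lemma memLp_bounded_mul {Ω : Set (ℝ × ℝ)} {m : ℝ × ℝ → ℝ} {C : ℝ}
    (hm : AEStronglyMeasurable m (volume.restrict Ω)) (hC : ∀ᵐ z ∂volume.restrict Ω, |m z| ≤ C)
    (f : L2 Ω) : MemLp (fun z => m z * f z) 2 (volume.restrict Ω) := by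
  refine (Lp.memLp f).of_le_mul (c := C) (hm.mul (Lp.aestronglyMeasurable f)) ?_
  filter_upwards [hC] with z hz
  rw [norm_mul]
  exact mul_le_mul_of_nonneg_right hz (norm_nonneg _)

/-- Multiplication by the values of a linear map into essentially bounded functions. -/
lemma exists_mul_clm {E : Type*} [NormedAddCommGroup E] [NormedSpace ℝ E] {Ω : Set (ℝ × ℝ)}
    (m : E →ₗ[ℝ] L2 Ω) {C : ℝ} (hC : ∀ u, ∀ᵐ z ∂volume.restrict Ω, |m u z| ≤ C * ‖u‖) :
    ∃ M : E →L[ℝ] L2 Ω →L[ℝ] L2 Ω, ∀ (u : E) (f : L2 Ω),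
      M u f =ᵐ[volume.restrict Ω] fun z => m u z * f z := by
  have hp : ∀ (u : E) (f : L2 Ω), MemLp (fun z => m u z * f z) 2
    (volume.restrict Ω) := fun u f => memLp_bounded_mul (Lp.aestronglyMeasurable _) (hC u) f
  have ev : ∀ (u : E) (f : L2 Ω), (hp u f).toLp =ᵐ[volume.restrict Ω] fun z => m u z * f z := fun u f =>
    (hp u f).coeFn_toLp
  let T : E →ₗ[ℝ] L2 Ω →ₗ[ℝ] L2 Ω := LinearMap.mk₂ ℝ (fun u f => (hp u f).toLp)
    (fun u v f => Lp.ext (by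
      filter_upwards [ev (u + v) f, Lp.coeFn_add ((hp u f).toLp) ((hp v f).toLp), ev u f, ev v f,
        Lp.coeFn_add (m u) (m v)] with z h1 h2 h3 h4 h5
      rw [h1, h2, Pi.add_apply, h3, h4, map_add, h5, Pi.add_apply, add_mul]))
    (fun t u f => Lp.ext (by
      filter_upwards [ev (t • u) f, Lp.coeFn_smul t ((hp u f).toLp), ev u f,
        Lp.coeFn_smul t (m u)] with z h1 h2 h3 h4
      rw [h1, h2, Pi.smul_apply, h3, map_smul, h4, Pi.smul_apply, smul_mul_assoc]))
    (fun u f g => Lp.ext (by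
      filter_upwards [ev u (f + g), Lp.coeFn_add ((hp u f).toLp) ((hp u g).toLp), ev u f, ev u g,
        Lp.coeFn_add f g] with z h1 h2 h3 h4 h5
      rw [h1, h2, Pi.add_apply, h3, h4, h5, Pi.add_apply, mul_add]))
    (fun t u f => Lp.ext (by
      filter_upwards [ev u (t • f), Lp.coeFn_smul t ((hp u f).toLp), ev u f,
        Lp.coeFn_smul t f] with z h1 h2 h3 h4
      rw [h1, h2, Pi.smul_apply, h3, h4, Pi.smul_apply, mul_smul_comm]))
  refine ⟨T.mkContinuous₂ C fun u f => ?_, fun u f => ev u f⟩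
  refine Lp.norm_le_mul_norm_of_ae_le_mul ?_
  filter_upwards [ev u f, hC u] with z h1 h2
  have h3 : (T u f) z = m u z * f z := h1
  rw [h3, norm_mul]
  exact mul_le_mul_of_nonneg_right h2 (norm_nonneg _)

lemma exists_weight_clm (a b c d lam : ℝ) :
    ∃ T : L2 (box a b c d) →L[ℝ] L2 (box a b c d), ∀ f,
      T f =ᵐ[volume.restrict (box a b c d)] fun z => weight lam z.1 * f z := by
  obtain ⟨C, hC⟩ := isCompact_Icc.exists_bound_of_continuousOn (s := Icc a b)
    (continuous_weight lam).continuousOn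
  have hw : ∀ᵐ z ∂volume.restrict (box a b c d), |weight lam z.1| ≤ C := by
    filter_upwards [ae_restrict_mem (measurableSet_box a b c d)] with z hz
    exact hC z.1 (Ioo_subset_Icc_self hz.1)
  have hL : MemLp (fun z : ℝ × ℝ => weight lam z.1) 2 (volume.restrict (box a b c d)) :=
    MemLp.of_bound ((continuous_weight lam).comp continuous_fst).aestronglyMeasurable C hw
  -- Multiplication by one fixed bounded function is the case of the line spanned by it, evaluated
  -- at 1.
  obtain ⟨M, hM⟩ := exists_mul_clm (E := ℝ) (LinearMap.toSpanSingleton ℝ _ (hL.toLp _)) (C := C)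
    fun t => by
      filter_upwards [hw, hL.coeFn_toLp, Lp.coeFn_smul t (hL.toLp _)] with z h1 h2 h3
      rw [LinearMap.toSpanSingleton_apply, h3, Pi.smul_apply, h2, smul_eq_mul, abs_mul,
        Real.norm_eq_abs, mul_comm]
      exact mul_le_mul_of_nonneg_right h1 (abs_nonneg _)
  refine ⟨M 1, fun f => ?_⟩
  filter_upwards [hM 1 f, hL.coeFn_toLp] with z h1 h2
  rw [h1, LinearMap.toSpanSingleton_apply, one_smul, h2]

/-- The bilinear form `2 ∇r · ∇((ρ - σ) / ε)` of `(r, s)` and `(ρ, σ)`. -/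
def nonlinTwo {Ω : Set (ℝ × ℝ)} (ε : ℝ) (p q : Pair Ω) (z : ℝ × ℝ) : ℝ :=
  2 * (dx p.fst z * ((dx q.fst z - dx q.snd z) / ε) + dy p.fst z * ((dy q.fst z - dy q.snd z) / ε))

/-- The weighted Laplacians `A₁`, `A₂` and the weighted nonlinearity `B` behind the functional. -/
structure IsModel {Ω : Set (ℝ × ℝ)} (ε lam : ℝ) (A₁ A₂ : Pair Ω →L[ℝ] L2 Ω)
    (B : Pair Ω →L[ℝ] Pair Ω →L[ℝ] L2 Ω) : Prop where
  first : ∀ p, A₁ p =ᵐ[volume.restrict Ω] fun z =>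
    weight (lam / 2) z.1 * (dxx p.fst z + dyy p.fst z)
  second : ∀ p, A₂ p =ᵐ[volume.restrict Ω] fun z =>
    weight (lam / 2) z.1 * (dxx p.snd z + dyy p.snd z)
  bilin : ∀ p q, B p q =ᵐ[volume.restrict Ω] fun z => weight (lam / 2) z.1 * nonlinTwo ε p q z

/-- `B` is bounded because the H³ norm controls the sup norm of the gradient in the first slot,
while the second gradient is needed only in L². -/
theorem exists_isModel {a b c d : ℝ} (hab : a < b) (hcd : c < d) (ε lam : ℝ) :
    ∃ A₁ A₂ B, IsModel (Ω := box a b c d) ε lam A₁ A₂ B := by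
  obtain ⟨T, hT⟩ := exists_weight_clm a b c d (lam / 2)
  obtain ⟨C, hC, hb⟩ := exists_ae_abs_comp_le (a := a) (b := b) (c := c) (d := d) hab hcd
  obtain ⟨M, hM⟩ := exists_mul_clm (E := H3 (box a b c d)) (comp 1 0 (by decide)).toLinearMap
    (C := C) (hb 1 0 (by decide) (by decide))
  obtain ⟨N, hN⟩ := exists_mul_clm (E := H3 (box a b c d)) (comp 0 1 (by decide)).toLinearMap
    (C := C) (hb 0 1 (by decide) (by decide))
  let P₁ : Pair (box a b c d) →L[ℝ] H3 (box a b c d) := WithLp.fstL 2 ℝ _ _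
  let P₂ : Pair (box a b c d) →L[ℝ] H3 (box a b c d) := WithLp.sndL 2 ℝ _ _
  let Dxx : H3 (box a b c d) →L[ℝ] L2 (box a b c d) := comp 2 0 (by decide)
  let Dyy : H3 (box a b c d) →L[ℝ] L2 (box a b c d) := comp 0 2 (by decide)
  let Dx : H3 (box a b c d) →L[ℝ] L2 (box a b c d) := comp 1 0 (by decide)
  let Dy : H3 (box a b c d) →L[ℝ] L2 (box a b c d) := comp 0 1 (by decide)
  let B₀ : Pair (box a b c d) →L[ℝ] Pair (box a b c d) →L[ℝ] L2 (box a b c d) :=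
    (2 / ε) • (M.bilinearComp P₁ (Dx.comp (P₁ - P₂)) + N.bilinearComp P₁ (Dy.comp (P₁ - P₂)))
  refine ⟨T.comp ((Dxx + Dyy).comp P₁), T.comp ((Dxx + Dyy).comp P₂),
    (ContinuousLinearMap.compL ℝ (Pair (box a b c d)) (L2 (box a b c d)) (L2 (box a b c d)) T).comp
      B₀, fun p => ?_, fun p => ?_, fun p q => ?_⟩
  · have h := hT (Dxx p.fst + Dyy p.fst)
    filter_upwards [h, Lp.coeFn_add (Dxx p.fst) (Dyy p.fst)] with z h1 h2
    rw [h2] at h1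
    exact h1
  · have h := hT (Dxx p.snd + Dyy p.snd)
    filter_upwards [h, Lp.coeFn_add (Dxx p.snd) (Dyy p.snd)] with z h1 h2
    rw [h2] at h1
    exact h1
  · have e : B₀ p q = (2 / ε) • (M p.fst (Dx q.fst - Dx q.snd) + N p.fst (Dy q.fst - Dy q.snd)) := by
      rw [← map_sub, ← map_sub]; rfl
    have h := hT (B₀ p q)
    rw [e] at h
    filter_upwards [h, Lp.coeFn_smul (2 / ε) (M p.fst (Dx q.fst - Dx q.snd) +
        N p.fst (Dy q.fst - Dy q.snd)), Lp.coeFn_add (M p.fst (Dx q.fst - Dx q.snd))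
        (N p.fst (Dy q.fst - Dy q.snd)), hM p.fst (Dx q.fst - Dx q.snd),
        hN p.fst (Dy q.fst - Dy q.snd), Lp.coeFn_sub (Dx q.fst) (Dx q.snd),
        Lp.coeFn_sub (Dy q.fst) (Dy q.snd)] with z h1 h2 h3 h4 h5 h6 h7
    rw [h2, Pi.smul_apply, h3, Pi.add_apply, h4, h5, h6, h7, Pi.sub_apply, Pi.sub_apply] at h1
    refine Eq.trans ?_ (h1.trans ?_)
    · rw [← e]; rfl
    · simp only [nonlinTwo, smul_eq_mul]
      change _ * (2 / ε * (dx p.fst z * (dx q.fst z - dx q.snd z) +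
        dy p.fst z * (dy q.fst z - dy q.snd z))) = _
      ring

lemma IsModel.J_eq {Ω : Set (ℝ × ℝ)} {ε lam : ℝ} {A₁ A₂ : Pair Ω →L[ℝ] L2 Ω}
    {B : Pair Ω →L[ℝ] Pair Ω →L[ℝ] L2 Ω} (h : IsModel ε lam A₁ A₂ B) (α : ℝ) :
    J (Ω := Ω) ε lam α = energy (√ε) α A₁ A₂ B := by
  ext p
  have i : ∀ f : L2 Ω, Integrable (fun z => f z ^ 2) (volume.restrict Ω) := fun f => by
    simpa [sq] using integrable_mul_L2 f f
  rw [J, energy, norm_sq_L2, norm_sq_L2, ← integral_add (i _) (i _)]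
  congr 2
  refine integral_congr_ae ?_
  filter_upwards [h.first p, h.second p, h.bilin p p, Lp.coeFn_add (A₁ p) (B p p),
    Lp.coeFn_add (A₂ p) (B p p)] with z h1 h2 h3 h4 h5
  have hw := weight_half_sq lam z.1
  simp only [quad]
  rw [h4, h5, Pi.add_apply, Pi.add_apply, h1, h2, h3]
  change (opL₁ ε p z ^ 2 + opL₂ ε p z ^ 2) * weight lam z.1 = _
  rw [← hw]
  have e1 : opL₁ ε p z = dxx p.fst z + dyy p.fst z + nonlinTwo ε p p z := rfl
  have e2 : opL₂ ε p z = dxx p.snd z + dyy p.snd z + nonlinTwo ε p p z := rfl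
  rw [e1, e2]
  ring

/-! ### Coercivity of the second-order remainder -/

/-- The sum of the squares of the gradients of the two components. -/
def gradSq {Ω : Set (ℝ × ℝ)} (h : Pair Ω) (z : ℝ × ℝ) : ℝ :=
  dx h.fst z ^ 2 + dy h.fst z ^ 2 + (dx h.snd z ^ 2 + dy h.snd z ^ 2)

/-- The form is not symmetric, so there is one bound for each slot: here the first argument has
bounded gradient, in the next lemma the second one does. -/
lemma nonlinTwo_sq_le_right {Ω : Set (ℝ × ℝ)} {ε M : ℝ} (hε : 0 < ε) (p q : Pair Ω) {z : ℝ × ℝ}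
    (h1 : |dx p.fst z| ≤ M) (h2 : |dy p.fst z| ≤ M) :
    nonlinTwo ε p q z ^ 2 ≤ 32 * M ^ 2 / ε ^ 2 * gradSq q z := by
  have e : nonlinTwo ε p q z ^ 2 = 4 * (dx p.fst z * (dx q.fst z - dx q.snd z) +
      dy p.fst z * (dy q.fst z - dy q.snd z)) ^ 2 / ε ^ 2 := by
    unfold nonlinTwo; field_simp; ring
  have s1 := sq_le_sq' (abs_le.1 h1).1 (abs_le.1 h1).2
  have s2 := sq_le_sq' (abs_le.1 h2).1 (abs_le.1 h2).2
  rw [e, div_mul_eq_mul_div]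
  refine div_le_div_of_nonneg_right ?_ (by positivity)
  unfold gradSq
  set A := dx p.fst z
  set B := dy p.fst z
  set X := dx q.fst z
  set Y := dy q.fst z
  set U := dx q.snd z
  set V := dy q.snd z
  have k1 := mul_le_mul_of_nonneg_right s1 (sq_nonneg (X - U))
  have k2 := mul_le_mul_of_nonneg_right s2 (sq_nonneg (Y - V))
  nlinarith [sq_nonneg (A * (X - U) - B * (Y - V)), mul_nonneg (sq_nonneg M) (sq_nonneg (X + U)),
    mul_nonneg (sq_nonneg M) (sq_nonneg (Y + V)), mul_nonneg (sq_nonneg M) (sq_nonneg X),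
    mul_nonneg (sq_nonneg M) (sq_nonneg Y), mul_nonneg (sq_nonneg M) (sq_nonneg U),
    mul_nonneg (sq_nonneg M) (sq_nonneg V)]

lemma nonlinTwo_sq_le_left {Ω : Set (ℝ × ℝ)} {ε M : ℝ} (hε : 0 < ε) (p q : Pair Ω) {z : ℝ × ℝ}
    (h1 : |dx q.fst z| ≤ M) (h2 : |dy q.fst z| ≤ M) (h3 : |dx q.snd z| ≤ M)
    (h4 : |dy q.snd z| ≤ M) :
    nonlinTwo ε p q z ^ 2 ≤ 32 * M ^ 2 / ε ^ 2 * gradSq p z := by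
  have e : nonlinTwo ε p q z ^ 2 = 4 * (dx p.fst z * (dx q.fst z - dx q.snd z) +
      dy p.fst z * (dy q.fst z - dy q.snd z)) ^ 2 / ε ^ 2 := by
    unfold nonlinTwo; field_simp; ring
  have s1 : (dx q.fst z - dx q.snd z) ^ 2 ≤ (2 * M) ^ 2 := by
    rw [abs_le] at h1 h3
    exact sq_le_sq' (by linarith) (by linarith)
  have s2 : (dy q.fst z - dy q.snd z) ^ 2 ≤ (2 * M) ^ 2 := by
    rw [abs_le] at h2 h4
    exact sq_le_sq' (by linarith) (by linarith)
  rw [e, div_mul_eq_mul_div]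
  refine div_le_div_of_nonneg_right ?_ (by positivity)
  unfold gradSq
  set A := dx p.fst z
  set B := dy p.fst z
  set X := dx q.fst z - dx q.snd z
  set Y := dy q.fst z - dy q.snd z
  have k1 := mul_le_mul_of_nonneg_right s1 (sq_nonneg A)
  have k2 := mul_le_mul_of_nonneg_right s2 (sq_nonneg B)
  nlinarith [sq_nonneg (A * X - B * Y), mul_nonneg (sq_nonneg M) (sq_nonneg (dx p.snd z)),
    mul_nonneg (sq_nonneg M) (sq_nonneg (dy p.snd z))]

lemma abs_nonlinTwo_self_le {Ω : Set (ℝ × ℝ)} {ε : ℝ} (hε : 0 < ε) (h : Pair Ω) (z : ℝ × ℝ) :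
    |nonlinTwo ε h h z| ≤ 4 / ε * gradSq h z := by
  have e : nonlinTwo ε h h z = 2 * (dx h.fst z * (dx h.fst z - dx h.snd z) +
      dy h.fst z * (dy h.fst z - dy h.snd z)) / ε := by
    unfold nonlinTwo; field_simp
  rw [e, abs_div, abs_of_pos hε, div_mul_eq_mul_div]
  refine div_le_div_of_nonneg_right ?_ hε.le
  unfold gradSq
  set A := dx h.fst z
  set B := dy h.fst z
  set X := dx h.snd z
  set Y := dy h.snd z
  rw [abs_le]
  constructor <;> nlinarith [sq_nonneg (A - X), sq_nonneg (A + X), sq_nonneg (B - Y),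
    sq_nonneg (B + Y), sq_nonneg A, sq_nonneg B, sq_nonneg X, sq_nonneg Y]

lemma integral_add_add {X : Type*} [MeasurableSpace X] {μ : Measure X} {f g k : X → ℝ}
    (hf : Integrable f μ) (hg : Integrable g μ) (hk : Integrable k μ) :
    ∫ z, (f z + g z + k z) ∂μ = (∫ z, f z ∂μ) + (∫ z, g z ∂μ) + ∫ z, k z ∂μ := by
  rw [← integral_add hf hg]
  exact integral_add (hf.add hg) hk

lemma integral_add_add_add {X : Type*} [MeasurableSpace X] {μ : Measure X} {f g k l : X → ℝ}
    (hf : Integrable f μ) (hg : Integrable g μ) (hk : Integrable k μ) (hl : Integrable l μ) :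
    ∫ z, (f z + g z + (k z + l z)) ∂μ =
      (∫ z, f z ∂μ) + (∫ z, g z ∂μ) + ((∫ z, k z ∂μ) + ∫ z, l z ∂μ) := by
  rw [← integral_add hf hg, ← integral_add hk hl]
  exact integral_add (hf.add hg) (hk.add hl)

section Coercivity

variable {a b c d ε lam : ℝ}

lemma integrableOn_gradSq_weight (h : Pair (box a b c d)) (lam : ℝ) :
    IntegrableOn (fun z => gradSq h z * weight lam z.1) (box a b c d) := by
  have cw := continuous_weight lam
  have i := fun (f : L2 (box a b c d)) => integrableOn_mul_L2_weight f f cw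
  refine (((i (dx h.fst)).add (i (dy h.fst))).add ((i (dx h.snd)).add (i (dy h.snd)))).congr
    (ae_of_all _ fun z => ?_)
  simp only [Pi.add_apply, gradSq]
  ring

lemma gradSq_nonneg {Ω : Set (ℝ × ℝ)} (h : Pair Ω) (z : ℝ × ℝ) : 0 ≤ gradSq h z := by
  unfold gradSq; positivity

lemma integral_gradSq_weight_nonneg (h : Pair (box a b c d)) (lam : ℝ) :
    0 ≤ ∫ z in box a b c d, gradSq h z * weight lam z.1 :=
  integral_nonneg fun z => mul_nonneg (gradSq_nonneg h z) (weight_pos lam z.1).le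

variable {A₁ A₂ : Pair (box a b c d) →L[ℝ] L2 (box a b c d)}
  {B : Pair (box a b c d) →L[ℝ] Pair (box a b c d) →L[ℝ] L2 (box a b c d)}

lemma IsModel.norm_sq_first (m : IsModel ε lam A₁ A₂ B) (h : Pair (box a b c d)) :
    ‖A₁ h‖ ^ 2 = ∫ z in box a b c d,
      (comp 2 0 (by decide) h.fst z + comp 0 2 (by decide) h.fst z) ^ 2 * weight lam z.1 := by
  rw [norm_sq_L2]
  refine integral_congr_ae ?_
  filter_upwards [m.first h] with z hz
  rw [hz, mul_pow, weight_half_sq, mul_comm]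
  rfl

lemma IsModel.norm_sq_second (m : IsModel ε lam A₁ A₂ B) (h : Pair (box a b c d)) :
    ‖A₂ h‖ ^ 2 = ∫ z in box a b c d,
      (comp 2 0 (by decide) h.snd z + comp 0 2 (by decide) h.snd z) ^ 2 * weight lam z.1 := by
  rw [norm_sq_L2]
  refine integral_congr_ae ?_
  filter_upwards [m.second h] with z hz
  rw [hz, mul_pow, weight_half_sq, mul_comm]
  rfl

lemma ZeroTraces.lower_order_le {u : H3 (box a b c d)} (ha : 0 < a) (hab : a < b) (hcd : c < d)
    (hl : 1 ≤ lam) (hla : 1 ≤ lam * a ^ 2) (h0 : ZeroTraces a b c d u) :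
    (lam * ∫ z in box a b c d, comp 1 0 (by decide) u z ^ 2 * weight lam z.1) +
      (lam * ∫ z in box a b c d, comp 0 1 (by decide) u z ^ 2 * weight lam z.1) +
      lam ^ 3 * a ^ 2 * ∫ z in box a b c d, comp 0 0 (by decide) u z ^ 2 * weight lam z.1 ≤
    3 * ∫ z in box a b c d, (comp 2 0 (by decide) u z + comp 0 2 (by decide) u z) ^ 2 *
      weight lam z.1 := by
  refine le_of_eq_of_le ?_ (h0.carleman_first ha hab hcd hl hla)
  have cw := continuous_weight lam
  have i := fun i j (hij : i + j ≤ 3) => integrableOn_comp_mul_weight u i j i j hij hij cw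
  simp only [← sq] at i
  rw [← integral_const_mul, ← integral_const_mul, ← integral_const_mul, ← integral_add_add
    ((i 1 0 (by decide)).const_mul lam) ((i 0 1 (by decide)).const_mul lam)
    ((i 0 0 (by decide)).const_mul _)]
  congr 1; ext z; ring

lemma ZeroTraces.second_order_le {u : H3 (box a b c d)} (ha : 0 < a) (hab : a < b) (hcd : c < d)
    (hl : 1 ≤ lam) (hla : 1 ≤ lam * a ^ 2) (h0 : ZeroTraces a b c d u) :
    (∫ z in box a b c d, comp 2 0 (by decide) u z ^ 2 * weight lam z.1) +
      (∫ z in box a b c d, comp 0 2 (by decide) u z ^ 2 * weight lam z.1) +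
      ∫ z in box a b c d, comp 1 1 (by decide) u z ^ 2 * weight lam z.1 ≤
    (2 + 192 * b ^ 2 * lam) * ∫ z in box a b c d,
      (comp 2 0 (by decide) u z + comp 0 2 (by decide) u z) ^ 2 * weight lam z.1 := by
  refine le_of_eq_of_le ?_ (h0.carleman_second ha hab hcd hl hla)
  have cw := continuous_weight lam
  have i := fun i j (hij : i + j ≤ 3) => integrableOn_comp_mul_weight u i j i j hij hij cw
  simp only [← sq] at i
  rw [← integral_add_add (i 2 0 (by decide)) (i 0 2 (by decide)) (i 1 1 (by decide))]
  congr 1; ext z; ring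

lemma integral_gradSq_weight (h : Pair (box a b c d)) (lam : ℝ) :
    ∫ z in box a b c d, gradSq h z * weight lam z.1 =
      (∫ z in box a b c d, comp 1 0 (by decide) h.fst z ^ 2 * weight lam z.1) +
      (∫ z in box a b c d, comp 0 1 (by decide) h.fst z ^ 2 * weight lam z.1) +
      ((∫ z in box a b c d, comp 1 0 (by decide) h.snd z ^ 2 * weight lam z.1) +
      (∫ z in box a b c d, comp 0 1 (by decide) h.snd z ^ 2 * weight lam z.1)) := by
  have cw := continuous_weight lam
  have i := fun (u : H3 (box a b c d)) i j (hij : i + j ≤ 3) =>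
    integrableOn_comp_mul_weight u i j i j hij hij cw
  simp only [← sq] at i
  rw [← integral_add_add_add (i h.fst 1 0 (by decide)) (i h.fst 0 1 (by decide))
    (i h.snd 1 0 (by decide)) (i h.snd 0 1 (by decide))]
  congr 1; ext z
  rw [← add_mul, ← add_mul, ← add_mul]
  rfl

lemma IsModel.integral_gradSq_le (m : IsModel ε lam A₁ A₂ B) (ha : 0 < a) (hab : a < b)
    (hcd : c < d) (hl : 1 ≤ lam) (hla : 1 ≤ lam * a ^ 2) {h : Pair (box a b c d)}
    (h1 : ZeroTraces a b c d h.fst) (h2 : ZeroTraces a b c d h.snd) :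
    lam * ∫ z in box a b c d, gradSq h z * weight lam z.1 ≤ 3 * (‖A₁ h‖ ^ 2 + ‖A₂ h‖ ^ 2) := by
  have e1 := h1.lower_order_le ha hab hcd hl hla
  have e2 := h2.lower_order_le ha hab hcd hl hla
  rw [m.norm_sq_first, m.norm_sq_second, integral_gradSq_weight]
  have n : ∀ u : H3 (box a b c d), 0 ≤ lam ^ 3 * a ^ 2 *
      ∫ z in box a b c d, comp 0 0 (by decide) u z ^ 2 * weight lam z.1 := fun u =>
    mul_nonneg (by positivity) (integral_nonneg fun z =>
      mul_nonneg (sq_nonneg _) (weight_pos _ _).le)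
  have n1 := n h.fst
  have n2 := n h.snd
  linarith

/-- Second derivatives of a bounded function times the gradient are controlled by the Laplacian. -/
lemma exists_integral_second_mul_gradSq_le (ha : 0 < a) (hab : a < b) (hcd : c < d) (R : ℝ) :
    ∃ K : ℝ, 0 < K ∧ ∀ (i j : ℕ) (hij : i + j ≤ 3) (_ : i + (j + 1) ≤ 3) (ε lam : ℝ)
      (A₁ A₂ : Pair (box a b c d) →L[ℝ] L2 (box a b c d))
      (B : Pair (box a b c d) →L[ℝ] Pair (box a b c d) →L[ℝ] L2 (box a b c d)),
      IsModel ε lam A₁ A₂ B → 1 ≤ lam → 1 ≤ lam * a ^ 2 →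
      ∀ (u : H3 (box a b c d)) (h : Pair (box a b c d)), ‖u‖ ≤ R →
        ZeroTraces a b c d h.fst → ZeroTraces a b c d h.snd →
        IntegrableOn (fun z => comp i j hij u z ^ 2 * (gradSq h z * weight lam z.1))
          (box a b c d) ∧
        ∫ z in box a b c d, comp i j hij u z ^ 2 * (gradSq h z * weight lam z.1) ≤
          K * (‖A₁ h‖ ^ 2 + ‖A₂ h‖ ^ 2) := by
  obtain ⟨C, hC, H⟩ := integral_second_mul_first_le (c := c) (d := d) ha hab hcd
  refine ⟨C * R ^ 2 * (5 + 192 * b ^ 2) + 1, by positivity,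
    fun i j hij hij' ε lam A₁ A₂ B m hl hla u h hu h1 h2 => ?_⟩
  have l0 : 0 < lam := by linarith
  obtain ⟨I1, E1⟩ := H i j 1 0 hij hij' (by decide) (by decide) u h.fst lam hl
  obtain ⟨I2, E2⟩ := H i j 0 1 hij hij' (by decide) (by decide) u h.fst lam hl
  obtain ⟨I3, E3⟩ := H i j 1 0 hij hij' (by decide) (by decide) u h.snd lam hl
  obtain ⟨I4, E4⟩ := H i j 0 1 hij hij' (by decide) (by decide) u h.snd lam hl
  have e : (fun z => comp i j hij u z ^ 2 * (gradSq h z * weight lam z.1)) = fun z =>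
      (comp i j hij u z ^ 2 * comp 1 0 (by decide) h.fst z ^ 2 * weight lam z.1 +
        comp i j hij u z ^ 2 * comp 0 1 (by decide) h.fst z ^ 2 * weight lam z.1) +
      (comp i j hij u z ^ 2 * comp 1 0 (by decide) h.snd z ^ 2 * weight lam z.1 +
        comp i j hij u z ^ 2 * comp 0 1 (by decide) h.snd z ^ 2 * weight lam z.1) := by
    ext z
    rw [← add_mul, ← mul_add, ← add_mul, ← mul_add, ← add_mul, ← mul_add, mul_assoc]
    rfl
  rw [e]
  refine ⟨(I1.add I2).add (I3.add I4), ?_⟩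
  rw [integral_add_add_add I1 I2 I3 I4]
  have f1 := h1.second_order_le ha hab hcd hl hla
  have f2 := h2.second_order_le ha hab hcd hl hla
  have g := m.integral_gradSq_le ha hab hcd hl hla h1 h2
  rw [integral_gradSq_weight] at g
  rw [← m.norm_sq_first] at f1
  rw [← m.norm_sq_second] at f2
  have nn : ∀ k l hkl (v : H3 (box a b c d)),
      0 ≤ ∫ z in box a b c d, comp k l hkl v z ^ 2 * weight lam z.1 := fun k l hkl v =>
    integral_nonneg fun z => mul_nonneg (sq_nonneg _) (weight_pos _ _).le
  have n1 := nn 0 2 (by decide) h.fst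
  have n2 := nn 0 2 (by decide) h.snd
  have S0 : 0 ≤ ‖A₁ h‖ ^ 2 + ‖A₂ h‖ ^ 2 := by positivity
  set S := ‖A₁ h‖ ^ 2 + ‖A₂ h‖ ^ 2
  have hR : C * ‖u‖ ^ 2 ≤ C * R ^ 2 := by gcongr
  have hp : 0 ≤ C * ‖u‖ ^ 2 := by positivity
  have inv1 : lam⁻¹ ≤ 1 := inv_le_one_of_one_le₀ hl
  have inv2 : lam⁻¹ * lam = 1 := inv_mul_cancel₀ l0.ne'
  have inv3 : 0 < lam⁻¹ := inv_pos.2 l0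
  -- The factor λ lost in the second-order Carleman estimate is cancelled by λ⁻¹, so the final
  -- constant does not depend on λ.
  have q : lam⁻¹ * ((∫ z in box a b c d, comp (1 + 1) 0 (by decide) h.fst z ^ 2 * weight lam z.1) +
      (∫ z in box a b c d, comp (0 + 1) 1 (by decide) h.fst z ^ 2 * weight lam z.1) +
      ((∫ z in box a b c d, comp (1 + 1) 0 (by decide) h.snd z ^ 2 * weight lam z.1) +
      (∫ z in box a b c d, comp (0 + 1) 1 (by decide) h.snd z ^ 2 * weight lam z.1))) ≤
      (2 + 192 * b ^ 2) * S := by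
    calc _ ≤ lam⁻¹ * ((2 + 192 * b ^ 2 * lam) * S) := by
          refine mul_le_mul_of_nonneg_left ?_ inv3.le
          rw [mul_add]
          have f1' : (∫ z in box a b c d, comp (1 + 1) 0 (by decide) h.fst z ^ 2 *
            weight lam z.1) + (∫ z in box a b c d, comp (0 + 1) 1 (by decide) h.fst z ^ 2 *
            weight lam z.1) ≤ (2 + 192 * b ^ 2 * lam) * ‖A₁ h‖ ^ 2 := by
              refine le_trans ?_ f1
              linarith
          have f2' : (∫ z in box a b c d, comp (1 + 1) 0 (by decide) h.snd z ^ 2 *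
            weight lam z.1) + (∫ z in box a b c d, comp (0 + 1) 1 (by decide) h.snd z ^ 2 *
            weight lam z.1) ≤ (2 + 192 * b ^ 2 * lam) * ‖A₂ h‖ ^ 2 := by
              refine le_trans ?_ f2
              linarith
          exact add_le_add f1' f2'
      _ = (2 * lam⁻¹ + 192 * b ^ 2 * (lam⁻¹ * lam)) * S := by ring
      _ ≤ (2 + 192 * b ^ 2) * S := by
          rw [inv2]
          refine mul_le_mul_of_nonneg_right ?_ S0
          linarith
  refine (add_le_add (add_le_add E1 E2) (add_le_add E3 E4)).trans ?_
  calc _ = C * ‖u‖ ^ 2 * (lam * _ + lam⁻¹ * _) := by rw [← mul_add, ← mul_add, ← mul_add]; congr 1; ring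
    _ ≤ C * ‖u‖ ^ 2 * (3 * S + (2 + 192 * b ^ 2) * S) :=
        mul_le_mul_of_nonneg_left (add_le_add g q) hp
    _ ≤ C * R ^ 2 * (3 * S + (2 + 192 * b ^ 2) * S) :=
        mul_le_mul_of_nonneg_right hR (by positivity)
    _ ≤ _ := by linarith

end Coercivity

lemma half_norm_sq_sub_le {Y : Type*} [SeminormedAddCommGroup Y] (x y : Y) :
    1 / 2 * ‖x‖ ^ 2 - ‖y‖ ^ 2 ≤ ‖x + y‖ ^ 2 := by
  have h := norm_sub_le (x + y) y
  rw [add_sub_cancel_right] at h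
  have h1 := norm_nonneg x
  nlinarith [sq_nonneg (‖x + y‖ - ‖y‖)]

lemma norm_add_three_sq_le {Y : Type*} [SeminormedAddCommGroup Y] (x y z : Y) :
    ‖x + y + z‖ ^ 2 ≤ 3 * (‖x‖ ^ 2 + ‖y‖ ^ 2 + ‖z‖ ^ 2) := by
  have h := norm_add₃_le (a := x) (b := y) (c := z)
  have h1 := norm_nonneg (x + y + z)
  nlinarith [sq_nonneg (‖x‖ - ‖y‖), sq_nonneg (‖x‖ - ‖z‖), sq_nonneg (‖y‖ - ‖z‖)]

section Coercivity

variable {a b c d ε lam : ℝ} {A₁ A₂ : Pair (box a b c d) →L[ℝ] L2 (box a b c d)}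
  {B : Pair (box a b c d) →L[ℝ] Pair (box a b c d) →L[ℝ] L2 (box a b c d)}

lemma IsModel.norm_bilin_sq_le (m : IsModel ε lam A₁ A₂ B) {p q h : Pair (box a b c d)} {K : ℝ}
    (hb : ∀ᵐ z ∂volume.restrict (box a b c d), nonlinTwo ε p q z ^ 2 ≤ K * gradSq h z) :
    ‖B p q‖ ^ 2 ≤ K * ∫ z in box a b c d, gradSq h z * weight lam z.1 := by
  rw [norm_sq_L2, ← integral_const_mul]
  refine integral_mono_ae ?_ ((integrableOn_gradSq_weight h lam).const_mul K) ?_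
  · simpa [sq] using integrable_mul_L2 (B p q) (B p q)
  · filter_upwards [hb, m.bilin p q] with z h1 h2
    rw [h2, mul_pow, weight_half_sq, mul_comm, ← mul_assoc]
    exact mul_le_mul_of_nonneg_right h1 (weight_pos _ _).le

/-- Here `f` plays the role of A₁p + B(p,p) or A₂p + B(p,p). Its unbounded second derivatives enter
through Young's inequality with a free small parameter `τ`; the price 1/(2τ) multiplies only the
integral of |∇h|², which a large λ absorbs. -/
lemma IsModel.abs_inner_bilin_le (m : IsModel ε lam A₁ A₂ B) (hε : 0 < ε) {M τ : ℝ} (hτ : 0 < τ)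
    {u : H3 (box a b c d)} {f : L2 (box a b c d)} {n : ℝ × ℝ → ℝ}
    (hf : f =ᵐ[volume.restrict (box a b c d)] fun z =>
      weight (lam / 2) z.1 * (dxx u z + dyy u z + n z))
    (hn : ∀ᵐ z ∂volume.restrict (box a b c d), |n z| ≤ M) {h : Pair (box a b c d)}
    (i1 : IntegrableOn (fun z => dxx u z ^ 2 * (gradSq h z * weight lam z.1)) (box a b c d))
    (i2 : IntegrableOn (fun z => dyy u z ^ 2 * (gradSq h z * weight lam z.1)) (box a b c d)) :
    |inner ℝ f (B h h)| ≤ 4 / ε * (τ * ((∫ z in box a b c d, dxx u z ^ 2 *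
      (gradSq h z * weight lam z.1)) + ∫ z in box a b c d, dyy u z ^ 2 *
      (gradSq h z * weight lam z.1)) +
      (M + 1 / (2 * τ)) * ∫ z in box a b c d, gradSq h z * weight lam z.1) := by
  have i3 := (integrableOn_gradSq_weight h lam).const_mul (M + 1 / (2 * τ))
  have T := integral_add_add (i1.const_mul τ) (i2.const_mul τ) i3
  rw [integral_const_mul, integral_const_mul, integral_const_mul (M + 1 / (2 * τ))] at T
  rw [mul_add τ, ← T, ← integral_const_mul, inner_L2]
  refine abs_integral_le_integral_abs.trans (integral_mono_ae (integrable_mul_L2 _ _).abs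
    ((((i1.const_mul τ).add (i2.const_mul τ)).add i3).const_mul _) ?_)
  filter_upwards [hf, hn, m.bilin h h] with z h1 h2 h3
  change |f z * B h h z| ≤ _
  have hw := weight_half_sq lam z.1
  have w0 := weight_pos lam z.1
  have e : f z * B h h z =
      weight lam z.1 * ((dxx u z + dyy u z + n z) * nonlinTwo ε h h z) := by
    rw [h1, h3, ← hw]; ring
  rw [e, abs_mul, abs_mul, abs_of_pos w0]
  have g0 := gradSq_nonneg h z
  have a1 := abs_nonlinTwo_self_le hε h z
  have a2 : |dxx u z + dyy u z + n z| ≤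
      τ * (dxx u z ^ 2 + dyy u z ^ 2) + (M + 1 / (2 * τ)) := by
    have b1 : |dxx u z + dyy u z| ≤ τ * (dxx u z ^ 2 + dyy u z ^ 2) + 1 / (2 * τ) := by
      have b2 : 0 ≤ 1 / (2 * τ) * (τ * |dxx u z + dyy u z| - 1) ^ 2 := by positivity
      have b3 : 1 / (2 * τ) * (τ * |dxx u z + dyy u z| - 1) ^ 2 =
          τ / 2 * (dxx u z + dyy u z) ^ 2 - |dxx u z + dyy u z| + 1 / (2 * τ) := by
        rw [← sq_abs (dxx u z + dyy u z)]
        field_simp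
        ring
      nlinarith [mul_nonneg hτ.le (sq_nonneg (dxx u z - dyy u z))]
    have b4 := abs_add_le (dxx u z + dyy u z) (n z)
    linarith
  calc _ ≤ weight lam z.1 * ((τ * (dxx u z ^ 2 + dyy u z ^ 2) + (M + 1 / (2 * τ))) *
        (4 / ε * gradSq h z)) := by
        refine mul_le_mul_of_nonneg_left ?_ w0.le
        exact mul_le_mul a2 a1 (abs_nonneg _) ((abs_nonneg _).trans a2)
    _ = _ := by ring

lemma ae_abs_gradient_le {C M : ℝ} (hC : 0 < C)
    (hb : ∀ (i j : ℕ) (_ : i + 1 + (j + 1) ≤ 3) (h' : i + j ≤ 3) (u : H3 (box a b c d)),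
      ∀ᵐ z ∂volume.restrict (box a b c d), |comp i j h' u z| ≤ C * ‖u‖)
    {p : Pair (box a b c d)} (hp : C * ‖p‖ ≤ M) :
    ∀ᵐ z ∂volume.restrict (box a b c d), |dx p.fst z| ≤ M ∧ |dy p.fst z| ≤ M ∧
      |dx p.snd z| ≤ M ∧ |dy p.snd z| ≤ M := by
  have n1 : C * ‖p.fst‖ ≤ M :=
    (mul_le_mul_of_nonneg_left (WithLp.norm_fst_le (x := p)) hC.le).trans hp
  have n2 : C * ‖p.snd‖ ≤ M :=
    (mul_le_mul_of_nonneg_left (WithLp.norm_snd_le (x := p)) hC.le).trans hp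
  filter_upwards [hb 1 0 (by decide) (by decide) p.fst, hb 0 1 (by decide) (by decide) p.fst,
    hb 1 0 (by decide) (by decide) p.snd, hb 0 1 (by decide) (by decide) p.snd] with z h1 h2 h3 h4
  exact ⟨h1.trans n1, h2.trans n1, h3.trans n2, h4.trans n2⟩

/-- For large `lam` the second-order remainder of the functional is coercive on `H₀³ × H₀³`. -/
theorem exists_coercive (ha : 0 < a) (hab : a < b) (hcd : c < d) (hε : 0 < ε) {R : ℝ}
    (hR : 0 < R) : ∃ Λ : ℝ, 1 ≤ Λ ∧ ∀ (lam : ℝ), Λ ≤ lam → 1 ≤ lam * a ^ 2 →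
      ∀ (A₁ A₂ : Pair (box a b c d) →L[ℝ] L2 (box a b c d))
        (B : Pair (box a b c d) →L[ℝ] Pair (box a b c d) →L[ℝ] L2 (box a b c d)),
      IsModel ε lam A₁ A₂ B → ∀ p h : Pair (box a b c d), ‖p‖ ≤ R → ‖h‖ ≤ 2 * R →
        ZeroTraces a b c d h.fst → ZeroTraces a b c d h.snd →
        1 / 4 * (‖A₁ h‖ ^ 2 + ‖A₂ h‖ ^ 2) ≤
          (‖quadDeriv A₁ B p h + B h h‖ ^ 2 + 2 * inner ℝ (quad A₁ B p) (B h h)) +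
          (‖quadDeriv A₂ B p h + B h h‖ ^ 2 + 2 * inner ℝ (quad A₂ B p) (B h h)) := by
  obtain ⟨K₁, hK₁, HK⟩ := exists_integral_second_mul_gradSq_le (c := c) (d := d) ha hab hcd R
  obtain ⟨C, hC, hb⟩ := exists_ae_abs_comp_le (a := a) (b := b) (c := c) (d := d) hab hcd
  -- A common bound for the gradients of `p`, of norm at most R, and of the increment `h`, of norm
  -- at most 2R.
  set M := C * (2 * R) with hM
  set K := 32 * M ^ 2 / ε ^ 2 with hK
  set M' := 4 / ε * (4 * M ^ 2) with hM'
  -- Chosen so that (4/ε)·τ·2K₁ = 1/32; the two inner products, each with a factor 2, then cost S/8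
  -- in total.
  set τ := ε / (256 * K₁) with hτ
  have τ0 : 0 < τ := by positivity
  -- The total coefficient of ∫|∇h|²w: 9K from the three bilinear terms in each component, and four
  -- times (4/ε)(M' + 1/(2τ)) from the doubled inner products.
  set K₂ := 18 * K + 16 / ε * (M' + 1 / (2 * τ)) with hK₂
  have K₂0 : 0 < K₂ := by positivity
  -- With λ ≥ 24K₂ the Carleman bound 3S makes the K₂-term at most S/8. The balance is 1/2 - 1/8 -
  -- 1/8 = 1/4.
  refine ⟨1 + 24 * K₂, by linarith, fun lam hlam hla A₁ A₂ B m p h hp hh h1 h2 => ?_⟩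
  have hl : 1 ≤ lam := by linarith
  have gp := ae_abs_gradient_le (M := M) hC hb (p := p) (by
    rw [hM]; exact mul_le_mul_of_nonneg_left (by linarith) hC.le)
  have gh := ae_abs_gradient_le (M := M) hC hb (p := h) (mul_le_mul_of_nonneg_left hh hC.le)
  have N0 := integral_gradSq_weight_nonneg h lam
  have NS := m.integral_gradSq_le ha hab hcd hl hla h1 h2
  have b1 : ‖B p h‖ ^ 2 ≤ K * ∫ z in box a b c d, gradSq h z * weight lam z.1 := by
    refine m.norm_bilin_sq_le ?_
    filter_upwards [gp] with z hz
    exact nonlinTwo_sq_le_right hε p h hz.1 hz.2.1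
  have b2 : ‖B h p‖ ^ 2 ≤ K * ∫ z in box a b c d, gradSq h z * weight lam z.1 := by
    refine m.norm_bilin_sq_le ?_
    filter_upwards [gp] with z hz
    exact nonlinTwo_sq_le_left hε h p hz.1 hz.2.1 hz.2.2.1 hz.2.2.2
  have b3 : ‖B h h‖ ^ 2 ≤ K * ∫ z in box a b c d, gradSq h z * weight lam z.1 := by
    refine m.norm_bilin_sq_le ?_
    filter_upwards [gh] with z hz
    exact nonlinTwo_sq_le_right hε h h hz.1 hz.2.1
  have hn : ∀ᵐ z ∂volume.restrict (box a b c d), |nonlinTwo ε p p z| ≤ M' := by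
    filter_upwards [gp] with z ⟨h1, h2, h3, h4⟩
    refine (abs_nonlinTwo_self_le hε p z).trans (mul_le_mul_of_nonneg_left ?_ (by positivity))
    have s1 := sq_le_sq' (abs_le.1 h1).1 (abs_le.1 h1).2
    have s2 := sq_le_sq' (abs_le.1 h2).1 (abs_le.1 h2).2
    have s3 := sq_le_sq' (abs_le.1 h3).1 (abs_le.1 h3).2
    have s4 := sq_le_sq' (abs_le.1 h4).1 (abs_le.1 h4).2
    unfold gradSq
    linarith
  have q1 : (quad A₁ B p : L2 (box a b c d)) =ᵐ[volume.restrict (box a b c d)] fun z =>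
      weight (lam / 2) z.1 * (dxx p.fst z + dyy p.fst z + nonlinTwo ε p p z) := by
    filter_upwards [m.first p, m.bilin p p, Lp.coeFn_add (A₁ p) (B p p)] with z z1 z2 z3
    rw [quad, z3, Pi.add_apply, z1, z2]; ring
  have q2 : (quad A₂ B p : L2 (box a b c d)) =ᵐ[volume.restrict (box a b c d)] fun z =>
      weight (lam / 2) z.1 * (dxx p.snd z + dyy p.snd z + nonlinTwo ε p p z) := by
    filter_upwards [m.second p, m.bilin p p, Lp.coeFn_add (A₂ p) (B p p)] with z z1 z2 z3
    rw [quad, z3, Pi.add_apply, z1, z2]; ring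
  have n1 : ‖p.fst‖ ≤ R := (WithLp.norm_fst_le (x := p)).trans hp
  have n2 : ‖p.snd‖ ≤ R := (WithLp.norm_snd_le (x := p)).trans hp
  obtain ⟨i1, j1⟩ := HK 2 0 (by decide) (by decide) ε lam A₁ A₂ B m hl hla p.fst h n1 h1 h2
  obtain ⟨i2, j2⟩ := HK 0 2 (by decide) (by decide) ε lam A₁ A₂ B m hl hla p.fst h n1 h1 h2
  obtain ⟨i3, j3⟩ := HK 2 0 (by decide) (by decide) ε lam A₁ A₂ B m hl hla p.snd h n2 h1 h2
  obtain ⟨i4, j4⟩ := HK 0 2 (by decide) (by decide) ε lam A₁ A₂ B m hl hla p.snd h n2 h1 h2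
  have S0 : 0 ≤ ‖A₁ h‖ ^ 2 + ‖A₂ h‖ ^ 2 := by positivity
  have r1 := m.abs_inner_bilin_le hε τ0 q1 hn i1 i2
  have r2 := m.abs_inner_bilin_le hε τ0 q2 hn i3 i4
  set N := ∫ z in box a b c d, gradSq h z * weight lam z.1
  have t : ∀ {x y r : ℝ}, x ≤ K₁ * (‖A₁ h‖ ^ 2 + ‖A₂ h‖ ^ 2) →
      y ≤ K₁ * (‖A₁ h‖ ^ 2 + ‖A₂ h‖ ^ 2) →
      |r| ≤ 4 / ε * (τ * (x + y) + (M' + 1 / (2 * τ)) * N) →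
      -(1 / 32 * (‖A₁ h‖ ^ 2 + ‖A₂ h‖ ^ 2) + 4 / ε * (M' + 1 / (2 * τ)) * N) ≤ r := by
    intro x y r hx hy hr
    have e1 : 4 / ε * (τ * (x + y)) ≤ 4 / ε * (τ * (K₁ * (‖A₁ h‖ ^ 2 + ‖A₂ h‖ ^ 2) +
        K₁ * (‖A₁ h‖ ^ 2 + ‖A₂ h‖ ^ 2))) := by gcongr
    have e2 : 4 / ε * (τ * (K₁ * (‖A₁ h‖ ^ 2 + ‖A₂ h‖ ^ 2) +
        K₁ * (‖A₁ h‖ ^ 2 + ‖A₂ h‖ ^ 2))) = 1 / 32 * (‖A₁ h‖ ^ 2 + ‖A₂ h‖ ^ 2) := by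
      rw [hτ]; field_simp; ring
    have e3 := (abs_le.1 hr).1
    rw [mul_add, ← mul_assoc (4 / ε) (M' + 1 / (2 * τ))] at e3
    linarith
  have v1 := t j1 j2 r1
  have v2 := t j3 j4 r2
  have w : ∀ A : Pair (box a b c d) →L[ℝ] L2 (box a b c d),
      1 / 2 * ‖A h‖ ^ 2 - 9 * K * N ≤ ‖quadDeriv A B p h + B h h‖ ^ 2 := by
    intro A
    have e : quadDeriv A B p h + B h h = A h + (B p h + B h p + B h h) := by
      simp only [quadDeriv, add_apply, ContinuousLinearMap.flip_apply]
      abel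
    have f1 := half_norm_sq_sub_le (A h) (B p h + B h p + B h h)
    have f2 := norm_add_three_sq_le (B p h) (B h p) (B h h)
    rw [e]
    linarith
  have w1 := w A₁
  have w2 := w A₂
  have z1 : 24 * K₂ * N ≤ lam * N := mul_le_mul_of_nonneg_right (by linarith) N0
  have z2 : K₂ * N = 18 * K * N + 16 / ε * (M' + 1 / (2 * τ)) * N := by rw [hK₂, add_mul]
  have z3 : 16 / ε * (M' + 1 / (2 * τ)) * N = 4 * (4 / ε * (M' + 1 / (2 * τ)) * N) := by ring
  linarith

end Coercivity

/-! ### Strong convexity: from the Laplacians to the H² norm -/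

section StrongConvexity

variable {a b c d ε lam : ℝ}

lemma exp_mul_norm_sq_le (ha : 0 < a) (hl : 0 ≤ lam) (f : L2 (box a b c d)) :
    Real.exp (2 * lam * a ^ 2) * ‖f‖ ^ 2 ≤ ∫ z in box a b c d, f z ^ 2 * weight lam z.1 := by
  rw [norm_sq_L2, ← integral_const_mul]
  have i := integrable_mul_L2 f f
  have i' := integrableOn_mul_L2_weight f f (continuous_weight lam)
  simp only [← sq] at i i'
  refine integral_mono_ae (i.const_mul _) i' ?_
  filter_upwards [ae_restrict_mem (measurableSet_box a b c d)] with z hz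
  rw [mul_comm]
  refine mul_le_mul_of_nonneg_left (Real.exp_le_exp.2 ?_) (sq_nonneg _)
  have : a ^ 2 ≤ z.1 ^ 2 := pow_le_pow_left₀ ha.le hz.1.1.le 2
  gcongr

/-- On the box the weight is at least its value at the left side, so every derivative of order at
most two is controlled by the two Carleman estimates. The second-order one forces the factor λ on
the right. -/
lemma ZeroTraces.exp_mul_sobolevTwoSq_le {u : H3 (box a b c d)} (ha : 0 < a) (hab : a < b)
    (hcd : c < d) (hl : 1 ≤ lam) (hla : 1 ≤ lam * a ^ 2) (h0 : ZeroTraces a b c d u) :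
    Real.exp (2 * lam * a ^ 2) * sobolevTwoSq u ≤
      Fintype.card (multiIndices 3) * (3 + 192 * b ^ 2) * (lam * ∫ z in box a b c d,
        (comp 2 0 (by decide) u z + comp 0 2 (by decide) u z) ^ 2 * weight lam z.1) := by
  have e1 := h0.lower_order_le ha hab hcd hl hla
  have e2 := h0.second_order_le ha hab hcd hl hla
  set S := ∫ z in box a b c d,
    (comp 2 0 (by decide) u z + comp 0 2 (by decide) u z) ^ 2 * weight lam z.1
  have S0 : 0 ≤ S := integral_nonneg fun z => mul_nonneg (sq_nonneg _) (weight_pos _ _).le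
  have nn : ∀ k l (hkl : k + l ≤ 3),
      0 ≤ ∫ z in box a b c d, comp k l hkl u z ^ 2 * weight lam z.1 := fun k l hkl =>
    integral_nonneg fun z => mul_nonneg (sq_nonneg _) (weight_pos _ _).le
  have l0 : 0 ≤ lam := zero_le_one.trans hl
  have lS : S ≤ lam * S := le_mul_of_one_le_left S0 hl
  have c00 := nn 0 0 (by decide)
  have c10 := nn 1 0 (by decide)
  have c01 := nn 0 1 (by decide)
  have c20 := nn 2 0 (by decide)
  have c02 := nn 0 2 (by decide)
  have c11 := nn 1 1 (by decide)
  have m00 := le_mul_of_one_le_left c00 (show (1 : ℝ) ≤ lam ^ 3 * a ^ 2 by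
    have : lam ^ 3 * a ^ 2 = lam ^ 2 * (lam * a ^ 2) := by ring
    rw [this]
    exact one_le_mul_of_one_le_of_one_le (one_le_pow₀ hl) hla)
  have m10 := le_mul_of_one_le_left c10 hl
  have m01 := le_mul_of_one_le_left c01 hl
  have b0 : 0 ≤ b ^ 2 * (lam * S) := by positivity
  have key : ∀ i j (hij : i + j ≤ 3), i + j ≤ 2 →
      Real.exp (2 * lam * a ^ 2) * ‖comp i j hij u‖ ^ 2 ≤ (3 + 192 * b ^ 2) * (lam * S) := by
    intro i j hij h2
    refine (exp_mul_norm_sq_le ha l0 _).trans ?_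
    have hi : i ≤ 2 := by omega
    have hj : j ≤ 2 := by omega
    interval_cases i <;> interval_cases j <;> first | omega | linarith
  rw [sobolevTwoSq, Finset.mul_sum]
  refine (Finset.sum_le_card_nsmul _ _ ((3 + 192 * b ^ 2) * (lam * S)) fun m _ => ?_).trans_eq ?_
  · split_ifs with h2
    · exact key m.1.1 m.1.2 (h2.trans (by decide)) h2
    · rw [mul_zero]
      positivity
  · rw [nsmul_eq_mul, Finset.card_univ, mul_assoc]

lemma h2NormSq_nonneg {Ω : Set (ℝ × ℝ)} (h : Pair Ω) : 0 ≤ h2NormSq h := by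
  have : ∀ u : H3 Ω, 0 ≤ sobolevTwoSq u := fun u =>
    Finset.sum_nonneg fun m _ => by split_ifs <;> positivity
  exact add_nonneg (this _) (this _)

/-- Strong convexity of the functional for large `lam`. -/
theorem exists_strong_convexity (ha : 0 < a) (hab : a < b) (hcd : c < d) (hε : 0 < ε) {R : ℝ}
    (hR : 0 < R) : ∃ Λ : ℝ, ∃ C : ℝ, 0 < C ∧ ∀ lam : ℝ, Λ ≤ lam →
      ∀ (A₁ A₂ : Pair (box a b c d) →L[ℝ] L2 (box a b c d))
        (B : Pair (box a b c d) →L[ℝ] Pair (box a b c d) →L[ℝ] L2 (box a b c d)),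
      IsModel ε lam A₁ A₂ B → ∀ (α : ℝ) (p q : Pair (box a b c d)), ‖p‖ ≤ R → ‖q‖ ≤ R →
        q - p ∈ H30Pair (box a b c d) ({b} ×ˢ Ioo c d) →
        C * Real.exp (lam * a ^ 2) * h2NormSq (q - p) + α * ‖q - p‖ ^ 2 ≤
          energy (√ε) α A₁ A₂ B q - energy (√ε) α A₁ A₂ B p -
            energyDeriv (√ε) α A₁ A₂ B p (q - p) ∧
        (1 / 2 < a → C * Real.exp (lam * a) * h2NormSq (q - p) + α * ‖q - p‖ ^ 2 ≤
          energy (√ε) α A₁ A₂ B q - energy (√ε) α A₁ A₂ B p -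
            energyDeriv (√ε) α A₁ A₂ B p (q - p)) := by
  obtain ⟨Λ, hΛ, H⟩ := exists_coercive (c := c) (d := d) ha hab hcd hε hR
  have hs : 0 < √ε := Real.sqrt_pos.2 hε
  set n : ℝ := Fintype.card (multiIndices 3) * (3 + 192 * b ^ 2) with hn
  have n0 : 0 < n := by
    have : 0 < Fintype.card (multiIndices 3) := Fintype.card_pos_iff.2 ⟨⟨(0, 0), by decide⟩⟩
    positivity
  set μ : ℝ := min (a ^ 2) (if 1 / 2 < a then 2 * a ^ 2 - a else 1) with hμ
  have μ0 : 0 < μ := by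
    refine lt_min (by positivity) ?_
    split_ifs with h
    · nlinarith
    · exact one_pos
  -- The second threshold ensures λa² ≥ 1, as the Carleman estimates require.
  refine ⟨max Λ (1 / a ^ 2), √ε / 4 / n * μ, by positivity,
    fun lam hlam A₁ A₂ B m α p q hp hq hz => ?_⟩
  have hΛl : Λ ≤ lam := (le_max_left _ _).trans hlam
  have hl : 1 ≤ lam := hΛ.trans hΛl
  have l0 : 0 < lam := by linarith
  have hla : 1 ≤ lam * a ^ 2 := (div_le_iff₀ (by positivity)).1 ((le_max_right _ _).trans hlam)
  obtain ⟨h, rfl⟩ : ∃ h, q = p + h := ⟨q - p, by abel⟩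
  rw [add_sub_cancel_left] at hz ⊢
  have hh : ‖h‖ ≤ 2 * R := by
    have := norm_sub_le (p + h) p
    rw [add_sub_cancel_left] at this
    linarith
  have h1 : ZeroTraces a b c d h.fst := hz.1
  have h2 : ZeroTraces a b c d h.snd := hz.2
  have c1 := H lam hΛl hla A₁ A₂ B m p h hp hh h1 h2
  have d1 := h1.exp_mul_sobolevTwoSq_le ha hab hcd hl hla
  have d2 := h2.exp_mul_sobolevTwoSq_le ha hab hcd hl hla
  rw [← m.norm_sq_first] at d1
  rw [← m.norm_sq_second] at d2
  set S := ‖A₁ h‖ ^ 2 + ‖A₂ h‖ ^ 2 with hS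
  have d3 : Real.exp (2 * lam * a ^ 2) * h2NormSq h ≤ n * (lam * S) := by
    rw [h2NormSq, hS]
    linarith
  have E0 := h2NormSq_nonneg h
  have main : ∀ e : ℝ, lam * μ * e ≤ Real.exp (2 * lam * a ^ 2) →
      √ε / 4 / n * μ * e * h2NormSq h + α * ‖h‖ ^ 2 ≤
        energy (√ε) α A₁ A₂ B (p + h) - energy (√ε) α A₁ A₂ B p -
          energyDeriv (√ε) α A₁ A₂ B p h := by
    intro e he
    rw [energy_add]
    have k1 : lam * (μ * e * h2NormSq h) ≤ lam * (n * S) := by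
      have := (mul_le_mul_of_nonneg_right he E0).trans d3
      linarith
    have k2 := le_of_mul_le_mul_left k1 l0
    have k3 : √ε / 4 / n * μ * e * h2NormSq h = √ε / 4 / n * (μ * e * h2NormSq h) := by ring
    have k4 : √ε / 4 / n * (n * S) = √ε * (1 / 4 * S) := by field_simp
    have k5 : √ε / 4 / n * (μ * e * h2NormSq h) ≤ √ε / 4 / n * (n * S) :=
      mul_le_mul_of_nonneg_left k2 (by positivity)
    have k6 := mul_le_mul_of_nonneg_left c1 hs.le
    rw [k3]
    linarith
  have expo : ∀ x : ℝ, x ≤ Real.exp x := fun x => by linarith [Real.add_one_le_exp x]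
  refine ⟨main _ ?_, fun h12 => main _ ?_⟩
  · calc lam * μ * Real.exp (lam * a ^ 2) ≤ lam * a ^ 2 * Real.exp (lam * a ^ 2) := by
          gcongr; exact min_le_left _ _
      _ ≤ Real.exp (lam * a ^ 2) * Real.exp (lam * a ^ 2) := by
          gcongr; exact expo _
      _ = _ := by rw [← Real.exp_add]; congr 1; ring
  · calc lam * μ * Real.exp (lam * a) ≤ lam * (2 * a ^ 2 - a) * Real.exp (lam * a) := by
          gcongr
          refine (min_le_right _ _).trans_eq (if_pos h12)
      _ ≤ Real.exp (lam * (2 * a ^ 2 - a)) * Real.exp (lam * a) := by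
          gcongr; exact expo _
      _ = _ := by rw [← Real.exp_add]; congr 1; ring

end StrongConvexity

/-! ### The gradient -/

section Gradient

variable {a b c d ε lam : ℝ}

lemma continuous_fst_pair {Ω : Set (ℝ × ℝ)} : Continuous fun p : Pair Ω => p.fst :=
  (WithLp.fstL 2 ℝ (H3 Ω) (H3 Ω)).continuous

lemma continuous_snd_pair {Ω : Set (ℝ × ℝ)} : Continuous fun p : Pair Ω => p.snd :=
  (WithLp.sndL 2 ℝ (H3 Ω) (H3 Ω)).continuous

lemma rightSide_subset_closure (hab : a < b) (hcd : c < d) :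
    ({b} ×ˢ Ioo c d : Set (ℝ × ℝ)) ⊆ closure (box a b c d) := by
  rw [closure_box hab hcd]
  rintro z ⟨h1, h2⟩
  exact ⟨by rw [show z.1 = b from h1]; exact right_mem_Icc.2 hab.le, Ioo_subset_Icc_self h2⟩

lemma isClosed_boundary (hab : a < b) (hcd : c < d) (g₀ g₁ k₀ k₁ : ℝ × ℝ → ℝ) :
    IsClosed {p : Pair (box a b c d) | (HasTrace (val p.fst) (frontier (box a b c d)) g₀ ∧
      HasTrace (dx p.fst) ({b} ×ˢ Ioo c d) g₁) ∧ HasTrace (val p.snd) (frontier (box a b c d)) k₀ ∧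
      HasTrace (dx p.snd) ({b} ×ˢ Ioo c d) k₁} := by
  have f := fun g => isClosed_hasTrace hab hcd 0 0 (by decide) (by decide) (frontier_subset_closure) g
  have r := fun g => isClosed_hasTrace hab hcd 1 0 (by decide) (by decide)
    (rightSide_subset_closure hab hcd) g
  exact (((f g₀).preimage continuous_fst_pair).inter ((r g₁).preimage continuous_fst_pair)).inter
    (((f k₀).preimage continuous_snd_pair).inter ((r k₁).preimage continuous_snd_pair))

lemma isClosed_H30Pair (hab : a < b) (hcd : c < d) :
    IsClosed (H30Pair (box a b c d) ({b} ×ˢ Ioo c d) : Set (Pair (box a b c d))) :=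
  isClosed_boundary hab hcd 0 0 0 0

variable {Ω Γ : Set (ℝ × ℝ)} {A₁ A₂ : Pair Ω →L[ℝ] L2 Ω} {B : Pair Ω →L[ℝ] Pair Ω →L[ℝ] L2 Ω}
  {α : ℝ}

lemma IsModel.isFrechetDeriv_iff (m : IsModel ε lam A₁ A₂ B) (p : Pair Ω) (g : H30Pair Ω Γ) :
    IsFrechetDeriv Γ ε lam α p g ↔
      innerSL ℝ g = (energyDeriv (√ε) α A₁ A₂ B p).comp (H30Pair Ω Γ).subtypeL := by
  have h : HasFDerivAt (fun h : H30Pair Ω Γ => J ε lam α (p + (h : Pair Ω)))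
      ((energyDeriv (√ε) α A₁ A₂ B p).comp (H30Pair Ω Γ).subtypeL) 0 := by
    rw [m.J_eq]
    have h1 : HasFDerivAt (fun h : H30Pair Ω Γ => p + (h : Pair Ω)) (H30Pair Ω Γ).subtypeL 0 :=
      (H30Pair Ω Γ).subtypeL.hasFDerivAt.const_add p
    have h2 : HasFDerivAt (energy (√ε) α A₁ A₂ B) (energyDeriv (√ε) α A₁ A₂ B p)
        (p + ((0 : H30Pair Ω Γ) : Pair Ω)) := by
      rw [Submodule.coe_zero, add_zero]
      exact hasFDerivAt_energy p
    exact HasFDerivAt.comp (f := fun h : H30Pair Ω Γ => p + (h : Pair Ω)) 0 h2 h1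
  exact ⟨fun hg => hg.unique h, fun hg => by rw [IsFrechetDeriv, hg]; exact h⟩

lemma IsModel.inner_eq (m : IsModel ε lam A₁ A₂ B) {p : Pair Ω} {g : H30Pair Ω Γ}
    (hg : IsFrechetDeriv Γ ε lam α p g) {h : Pair Ω} (hh : h ∈ H30Pair Ω Γ) :
    inner ℝ (g : Pair Ω) h = energyDeriv (√ε) α A₁ A₂ B p h :=
  DFunLike.congr_fun ((m.isFrechetDeriv_iff p g).1 hg) (⟨h, hh⟩ : H30Pair Ω Γ)

/-- Riesz representation of the restricted derivative. The gradient is taken inside H₀³ × H₀³, so it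
is determined only by variations that preserve the boundary data. -/
lemma IsModel.existsUnique_gradient [CompleteSpace (H30Pair Ω Γ)] (m : IsModel ε lam A₁ A₂ B)
    (p : Pair Ω) : ∃! g : H30Pair Ω Γ, IsFrechetDeriv Γ ε lam α p g := by
  simp only [m.isFrechetDeriv_iff]
  exact (InnerProductSpace.toDual ℝ (H30Pair Ω Γ)).bijective.existsUnique _

end Gradient

/-! ### Admissible pairs at a fixed angle -/

/-- The pairs that satisfy the boundary conditions at the angle `φ`, of norm at most `R`. -/
def slice (Ω Γ : Set (ℝ × ℝ)) (ε : ℝ) (s₀ s₁ : ℝ × ℝ → ℝ → ℝ) (R : ℝ) (φ : Angle) :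
    Set (Pair Ω) :=
  {p | BoundaryCond Ω Γ ε s₀ s₁ φ p ∧ ‖p‖ ≤ R}

section Slice

variable {Ω Γ : Set (ℝ × ℝ)} {ε R : ℝ} {s₀ s₁ : ℝ × ℝ → ℝ → ℝ} {φ : Angle}

lemma convex_slice : Convex ℝ (slice Ω Γ ε s₀ s₁ R φ) := by
  intro p hp q hq s t hs ht hst
  have e : ∀ x : ℝ, s * x + t * x = x := fun x => by rw [← add_mul, hst, one_mul]
  refine ⟨⟨(hp.1.1.combine s t hq.1.1).congr fun z _ => e _,
    (hp.1.2.1.combine s t hq.1.2.1).congr fun z _ => e _,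
    (hp.1.2.2.1.combine s t hq.1.2.2.1).congr fun z _ => e _,
    (hp.1.2.2.2.combine s t hq.1.2.2.2).congr fun z _ => e _⟩, ?_⟩
  refine (norm_add_le _ _).trans ?_
  rw [norm_smul, norm_smul, Real.norm_of_nonneg hs, Real.norm_of_nonneg ht, ← e R]
  exact add_le_add (mul_le_mul_of_nonneg_left hp.2 hs) (mul_le_mul_of_nonneg_left hq.2 ht)

lemma sub_mem_H30Pair {p q : Pair Ω} (hp : BoundaryCond Ω Γ ε s₀ s₁ φ p)
    (hq : BoundaryCond Ω Γ ε s₀ s₁ φ q) : q - p ∈ H30Pair Ω Γ := by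
  have e : q - p = (1 : ℝ) • q + (-1 : ℝ) • p := by module
  have z : ∀ x : ℝ, 1 * x + -1 * x = 0 := fun x => by ring
  rw [e]
  exact ⟨⟨(hq.1.combine 1 (-1) hp.1).congr fun _ _ => z _,
    (hq.2.1.combine 1 (-1) hp.2.1).congr fun _ _ => z _⟩,
    (hq.2.2.1.combine 1 (-1) hp.2.2.1).congr fun _ _ => z _,
    (hq.2.2.2.combine 1 (-1) hp.2.2.2).congr fun _ _ => z _⟩

lemma isClosed_slice {a b c d : ℝ} (hab : a < b) (hcd : c < d) :
    IsClosed (slice (box a b c d) ({b} ×ˢ Ioo c d) ε s₀ s₁ R φ) := by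
  have h := (isClosed_boundary hab hcd (fun z => deriv (s₀ z) φ) (fun z => deriv (s₁ z) φ)
    (fun z => deriv (s₀ z) φ - ε * s₀ z φ) (fun z => deriv (s₁ z) φ - ε * s₁ z φ)).inter
    (isClosed_le continuous_norm (continuous_const (y := R)))
  convert h using 1
  ext p
  simp only [slice, BoundaryCond, mem_inter_iff, mem_ofPred_eq, and_assoc]

/-- Families carry no regularity in the angle, so changing one at a single angle keeps it
admissible. This decouples the angles. -/
lemma exists_mem_closedBall {p : Angle → Pair Ω} (hp : p ∈ closedBall Ω Γ ε s₀ s₁ R) {q : Pair Ω}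
    (hq : q ∈ slice Ω Γ ε s₀ s₁ R φ) : ∃ r ∈ closedBall Ω Γ ε s₀ s₁ R, r φ = q := by
  classical
  refine ⟨Function.update p φ q, fun ψ => ?_, Function.update_self _ _ _⟩
  rcases eq_or_ne ψ φ with rfl | h
  · rw [Function.update_self]; exact hq
  · rw [Function.update_of_ne h]; exact hp ψ

/-- Minimizing over families is minimizing at each angle separately. -/
lemma isMinimizer_iff {lam α : ℝ} {p : Angle → Pair Ω} :
    IsMinimizer ε lam α (closedBall Ω Γ ε s₀ s₁ R) p ↔ ∀ φ, p φ ∈ slice Ω Γ ε s₀ s₁ R φ ∧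
      ∀ q ∈ slice Ω Γ ε s₀ s₁ R φ, J ε lam α (p φ) ≤ J ε lam α q := by
  constructor
  · rintro ⟨hp, hm⟩ φ
    refine ⟨hp φ, fun q hq => ?_⟩
    obtain ⟨r, hr, rfl⟩ := exists_mem_closedBall hp hq
    exact hm φ r hr
  · exact fun h => ⟨fun φ => (h φ).1, fun φ q hq => (h φ).2 _ (hq φ)⟩

end Slice

end EIT

end

/-! ### Assembly of the theorem -/

theorem theorem5p2 (a b c₁ c₂ : ℝ) (hc₁ : 0 < c₁) (hc₂ : 0 < c₂) (ha : 0 < a - c₁)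
    (ε : ℝ) (hε : ε ∈ Ioo (0 : ℝ) 1) (R : ℝ) (hR : 0 < R)
    (Ω Γ : Set (ℝ × ℝ)) (hΩ : Ω = EIT.rect a b c₁ c₂) (hΓ : Γ = EIT.rightSide a b c₁ c₂) :
    -- existence and Lipschitz continuity of the derivative, for every positive `lam`
    (∀ lam : ℝ, 0 < lam → ∀ φ : EIT.Angle, ∃ D : ℝ, 0 < D ∧
      ∀ s₀ s₁ : ℝ × ℝ → ℝ → ℝ, EIT.IsData Ω Γ s₀ s₁ → ∀ α ∈ Ioo (0 : ℝ) 1,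
        (∀ p ∈ EIT.closedBall Ω Γ ε s₀ s₁ R,
          ∃! g : EIT.H30Pair Ω Γ, EIT.IsFrechetDeriv Γ ε lam α (p φ) g) ∧
        (∀ p₁ ∈ EIT.closedBall Ω Γ ε s₀ s₁ R, ∀ p₂ ∈ EIT.closedBall Ω Γ ε s₀ s₁ R,
          ∀ g₁ g₂ : EIT.H30Pair Ω Γ,
            EIT.IsFrechetDeriv Γ ε lam α (p₁ φ) g₁ → EIT.IsFrechetDeriv Γ ε lam α (p₂ φ) g₂ →
            ‖g₂ - g₁‖ ≤ D * ‖p₂ φ - p₁ φ‖)) ∧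
    -- strong convexity and the minimizer, for large `lam`
    (∀ lam₀ : ℝ, 1 ≤ lam₀ → ∃ lam₁ : ℝ, lam₀ ≤ lam₁ ∧ ∃ C₁ : ℝ, 0 < C₁ ∧
      ∀ s₀ s₁ : ℝ × ℝ → ℝ → ℝ, EIT.IsData Ω Γ s₀ s₁ → ∀ α ∈ Ioo (0 : ℝ) 1,
        ∀ lam : ℝ, lam₁ ≤ lam →
        (∀ φ : EIT.Angle,
          ∀ p₁ ∈ EIT.closedBall Ω Γ ε s₀ s₁ R, ∀ p₂ ∈ EIT.closedBall Ω Γ ε s₀ s₁ R,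
          ∀ g₁ : EIT.H30Pair Ω Γ, EIT.IsFrechetDeriv Γ ε lam α (p₁ φ) g₁ →
            (C₁ * Real.exp (lam * (a - c₁) ^ 2) * EIT.h2NormSq (p₂ φ - p₁ φ)
                + α * ‖p₂ φ - p₁ φ‖ ^ 2 ≤
              EIT.J ε lam α (p₂ φ) - EIT.J ε lam α (p₁ φ)
                - inner ℝ (g₁ : EIT.Pair Ω) (p₂ φ - p₁ φ)) ∧
            (1 / 2 < a - c₁ →
              C₁ * Real.exp (lam * (a - c₁)) * EIT.h2NormSq (p₂ φ - p₁ φ)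
                  + α * ‖p₂ φ - p₁ φ‖ ^ 2 ≤
                EIT.J ε lam α (p₂ φ) - EIT.J ε lam α (p₁ φ)
                  - inner ℝ (g₁ : EIT.Pair Ω) (p₂ φ - p₁ φ))) ∧
        ((EIT.closedBall Ω Γ ε s₀ s₁ R).Nonempty →
          ∃! p, EIT.IsMinimizer ε lam α (EIT.closedBall Ω Γ ε s₀ s₁ R) p) ∧
        (∀ p ∈ EIT.closedBall Ω Γ ε s₀ s₁ R,
          EIT.IsMinimizer ε lam α (EIT.closedBall Ω Γ ε s₀ s₁ R) p ↔
            ∀ φ : EIT.Angle, ∀ g : EIT.H30Pair Ω Γ, EIT.IsFrechetDeriv Γ ε lam α (p φ) g →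
              ∀ q ∈ EIT.closedBall Ω Γ ε s₀ s₁ R,
                inner ℝ (g : EIT.Pair Ω) (p φ - q φ) ≤ 0)) := by
  replace hΩ : Ω = EIT.box (a - c₁) (a + c₁) (b - c₂) (b + c₂) := hΩ
  replace hΓ : Γ = {a + c₁} ×ˢ Ioo (b - c₂) (b + c₂) := hΓ
  have hab : a - c₁ < a + c₁ := by linarith
  have hcd : b - c₂ < b + c₂ := by linarith
  have hce : CompleteSpace (EIT.H30Pair Ω Γ) := by
    subst hΩ hΓ
    exact (EIT.isClosed_H30Pair hab hcd).completeSpace_coe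
  have hmodel : ∀ lam, ∃ A₁ A₂ B, EIT.IsModel (Ω := Ω) ε lam A₁ A₂ B := by
    subst hΩ
    exact EIT.exists_isModel hab hcd ε
  refine ⟨fun lam _ φ => ?_, fun lam₀ _ => ?_⟩
  · obtain ⟨A₁, A₂, B, m⟩ := hmodel lam
    -- The maps depend only on λ, ε and the domain, so `D` is fixed before the boundary data and α.
    obtain ⟨D, hD, hL⟩ := EIT.exists_energyDeriv_lipschitz (√ε) A₁ A₂ B hR.le
    refine ⟨D, hD, fun s₀ s₁ _ α hα => ⟨fun p _ => m.existsUnique_gradient _, ?_⟩⟩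
    intro p₁ h₁ p₂ h₂ g₁ g₂ hg₁ hg₂
    -- The difference of the gradients lies in H₀³ × H₀³ and can serve as its own test vector.
    have e : ‖g₂ - g₁‖ ^ 2 = EIT.energyDeriv (√ε) α A₁ A₂ B (p₂ φ) (g₂ - g₁ : EIT.H30Pair _ _) -
        EIT.energyDeriv (√ε) α A₁ A₂ B (p₁ φ) (g₂ - g₁ : EIT.H30Pair _ _) := by
      rw [← m.inner_eq hg₂ (g₂ - g₁).2, ← m.inner_eq hg₁ (g₂ - g₁).2, ← inner_sub_left,
        ← Submodule.coe_sub, ← Submodule.coe_inner, real_inner_self_eq_norm_sq]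
    have h := (le_abs_self _).trans (hL α hα (p₁ φ) (p₂ φ) (g₂ - g₁ : EIT.H30Pair _ _)
      (h₁ φ).2 (h₂ φ).2)
    rw [← e, Submodule.coe_norm, sq] at h
    rcases (norm_nonneg (g₂ - g₁)).eq_or_lt' with h0 | h0
    · rw [h0]; positivity
    · exact le_of_mul_le_mul_right h h0
  · obtain ⟨Λ, C, hC, H⟩ := EIT.exists_strong_convexity ha hab hcd hε.1 hR
    refine ⟨max lam₀ Λ, le_max_left _ _, C, hC, fun s₀ s₁ _ α hα lam hlam => ?_⟩
    obtain ⟨A₁, A₂, B, m⟩ := hmodel lam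
    have hcl : ∀ φ, IsClosed (EIT.slice Ω Γ ε s₀ s₁ R φ) := by
      subst hΩ hΓ
      exact fun φ => EIT.isClosed_slice hab hcd
    subst hΩ hΓ
    have hs := H lam ((le_max_right _ _).trans hlam) A₁ A₂ B m α
    have hd : ∀ p : EIT.Pair (EIT.box (a - c₁) (a + c₁) (b - c₂) (b + c₂)), HasFDerivAt (EIT.J ε lam α)
        (EIT.energyDeriv (√ε) α A₁ A₂ B p) p := fun p => by
      rw [m.J_eq]
      exact EIT.hasFDerivAt_energy p
    have hJ : ∀ p : EIT.Pair (EIT.box (a - c₁) (a + c₁) (b - c₂) (b + c₂)), EIT.J ε lam α p =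
        EIT.energy (√ε) α A₁ A₂ B p := fun p => by rw [m.J_eq]
    -- Discarding the H² term leaves strong convexity in H³ with modulus α.
    have sc : ∀ φ, EIT.StronglyConvexOn (EIT.J ε lam α) (EIT.energyDeriv (√ε) α A₁ A₂ B) α
        (EIT.slice (EIT.box (a - c₁) (a + c₁) (b - c₂) (b + c₂))
          ({a + c₁} ×ˢ Ioo (b - c₂) (b + c₂)) ε s₀ s₁ R φ) := by
      intro φ p hp q hq
      have h := (hs p q hp.2 hq.2 (EIT.sub_mem_H30Pair hp.1 hq.1)).1
      have h2 : 0 ≤ EIT.h2NormSq (q - p) := EIT.h2NormSq_nonneg _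
      have h3 : 0 ≤ C * Real.exp (lam * (a - c₁) ^ 2) * EIT.h2NormSq (q - p) := by positivity
      rw [hJ, hJ]
      exact (le_add_of_nonneg_left h3).trans h
    refine ⟨fun φ p₁ h₁ p₂ h₂ g₁ hg₁ => ?_, fun hne => ?_, fun p hp => ?_⟩
    · have hz := EIT.sub_mem_H30Pair (h₁ φ).1 (h₂ φ).1
      rw [m.inner_eq hg₁ hz, hJ, hJ]
      exact hs _ _ (h₁ φ).2 (h₂ φ).2 hz
    · obtain ⟨p₀, hp₀⟩ := hne
      have hu := fun φ => (sc φ).existsUnique_min hα.1 EIT.convex_slice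
        (hcl φ) ⟨p₀ φ, hp₀ φ⟩
        (continuous_iff_continuousAt.2 fun p => (hd p).continuousAt)
        fun p => by
          have := hα.1
          rw [hJ, EIT.energy]
          positivity
      -- The minimizers at the individual angles are assembled into one family; uniqueness holds
      -- angle by angle.
      choose p hp hpu using hu
      exact ⟨p, EIT.isMinimizer_iff.2 hp, fun q hq => funext fun φ =>
        hpu φ (q φ) (EIT.isMinimizer_iff.1 hq φ)⟩
    · rw [EIT.isMinimizer_iff]
      constructor
      · intro h φ g hg q hq
        rw [m.inner_eq hg (EIT.sub_mem_H30Pair (hq φ).1 (hp φ).1)]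
        exact ((sc φ).isMin_iff hα.1 EIT.convex_slice (hp φ) (hd _)).1 (h φ).2 _ (hq φ)
      · intro h φ
        refine ⟨hp φ, ((sc φ).isMin_iff hα.1 EIT.convex_slice (hp φ) (hd _)).2 fun q hq => ?_⟩
        obtain ⟨r, hr, rfl⟩ := EIT.exists_mem_closedBall hp hq
        -- The hypothesis quantifies over all gradients at `p φ`, so one must be exhibited before it
        -- can be used.
        obtain ⟨g, hg, _⟩ := m.existsUnique_gradient (Γ := {a + c₁} ×ˢ Ioo (b - c₂) (b + c₂)) (α := α)
          (p φ)
        rw [← m.inner_eq hg (EIT.sub_mem_H30Pair hq.1 (hp φ).1)]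
        exact h φ g hg r hr
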